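/- Let $C=(\mathbb R/4\pi\mathbb Z)\times\mathbb R$ with points $\lambda=(\gamma,c)$, and let $M=\mathrm{SH}(2)\cong\mathbb R^3$ with coordinates $q=(x,y,z)$. For $\lambda\in C$ let $(\gamma_t,c_t,x_t,y_t,z_t)$, $t\in\mathbb R$, be the solution of the normal Hamiltonian system $$\dot\gamma=c,\quad \dot c=-\sin\gamma,\quad \dot x=\cos\tfrac{\gamma}{2}\cosh z,\quad \dot y=\cos\tfrac{\gamma}{2}\sinh z,\quad \dot z=\sin\tfrac{\gamma}{2}$$ with $(\gamma_0,c_0)=\lambda$ and $(x_0,y_0,z_0)=(0,0,0)$; the exponential mapping is $\mathrm{Exp}(\lambda,t)=(x_t,y_t,z_t)$, defined on $N=C\times(0,+\infty)$. Put $E(\lambda)=\frac{c^2}{2}-\cos\gamma$ and $$C_1=\{E\in(-1,1)\},\quad C_2=\{E>1\},\quad C_3=\{E=1,\ c\ne0\},\quad C_4=\{E=-1,\ c=0\},\quad C_5=\{E=1,\ c=0\}.$$ With $K(k)=\int_0^{\pi/2}\frac{d\theta}{\sqrt{1-k^2\sin^2\theta}}$ define $\mathbf t:C\to(0,+\infty]$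 by $$\mathbf t(\lambda)=\begin{cases}4K(k),\ k=\sqrt{(E+1)/2}, & \lambda\in C_1,\\ 4kK(k),\ k=\sqrt{2/(E+1)}, & \lambda\in C_2,\\ 2\pi, & \lambda\in C_4,\\ +\infty, & \lambda\in C_3\cup C_5.\end{cases}$$ Let $$\widetilde N=\Big\{(\lambda,t)\in (C_1\cup C_2\cup C_3)\times(0,+\infty)\ :\ t<\mathbf t(\lambda),\ \sin\tfrac{\gamma_{t/2}}{2}\neq0\Big\}\ \cup\ \big(C_5\times(0,+\infty)\big),\qquad \widetilde M=\{q\in M: z\ne0\}.$$ Then $\widetilde N$ is open in $C\times\mathbb R$, $\widetilde M$ is open in $M$, and $\mathrm{Exp}:\widetilde N\to\widetilde M$ is a $C^\infty$ diffeomorphism. -/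

import Mathlib

open Set
open scoped Manifold ContDiff Topology

noncomputable section

namespace SH2

/-! ### The circle `ℝ / pℤ` as a smooth manifold -/

section Circle

variable (p : ℝ) [hp : Fact (0 < p)]

/-- The charts of `ℝ / pℤ` are the inverses of the restrictions of the quotient map `ℝ → ℝ / pℤ`
to the open intervals `(a, a + p)`. -/
instance instChartedSpaceAddCircle : ChartedSpace ℝ (AddCircle p) where
  atlas := {e | ∃ a : ℝ, e = (AddCircle.openPartialHomeomorphCoe p a).symm}
  chartAt x := (AddCircle.openPartialHomeomorphCoe p (x.out - p / 2)).symm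
  mem_chart_source x := by
    have h0 := hp.out
    have h : (AddCircle.openPartialHomeomorphCoe p (x.out - p / 2)) x.out ∈
        (AddCircle.openPartialHomeomorphCoe p (x.out - p / 2)).target := by
      apply OpenPartialHomeomorph.map_source
      simp only [AddCircle.openPartialHomeomorphCoe_source, mem_Ioo]
      constructor <;> linarith
    have h2 : (AddCircle.openPartialHomeomorphCoe p (x.out - p / 2)) x.out = x := by
      simp only [AddCircle.openPartialHomeomorphCoe_apply]
      exact Quotient.out_eq x
    rw [h2] at h
    exact h
  chart_mem_atlas x := ⟨_, rfl⟩

/-- The changes of charts are locally translations by multiples of `p`, hence smooth. -/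
instance instIsManifoldAddCircle : IsManifold 𝓘(ℝ, ℝ) ∞ (AddCircle p) := by
  apply isManifold_of_contDiffOn
  rintro _ _ ⟨a, rfl⟩ ⟨b, rfl⟩ x hx
  simp only [modelWithCornersSelf_coe, modelWithCornersSelf_coe_symm,
    OpenPartialHomeomorph.symm_symm, preimage_id_eq, id_eq, range_id,
    inter_univ, OpenPartialHomeomorph.trans_source, mem_inter_iff, mem_preimage,
    AddCircle.openPartialHomeomorphCoe_apply, OpenPartialHomeomorph.symm_source,
    AddCircle.openPartialHomeomorphCoe_target, mem_compl_iff, mem_singleton_iff] at hx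
  have hne : ¬ x ≡ b [PMOD p] := fun h =>
    hx.2 ((AddCommGroup.modEq_iff_eq_mod_zmultiples).1 h)
  have hev := eventuallyEq_toIcoDiv_nhds hp.out b hne
  apply ContDiffAt.contDiffWithinAt
  have : ContDiffAt ℝ ∞ (fun y : ℝ => y - toIcoDiv hp.out b x • p) x := by fun_prop
  refine this.congr_of_eventuallyEq ?_
  filter_upwards [hev] with y hy
  change toIcoMod hp.out b y = _
  rw [toIcoMod, hy]

end Circle

instance instFactFourPi : Fact (0 < 4 * Real.pi) := ⟨by positivity⟩

/-! ### The Hamiltonian system and the exponential mapping -/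

/-- The phase cylinder `C = (ℝ / 4πℤ) × ℝ` of the vertical subsystem, with points `(γ, c)`. -/
abbrev PhaseCylinder : Type := AddCircle (4 * Real.pi) × ℝ

/-- A normal extremal, parametrised by all of `ℝ`, starting at the identity of `SH(2) ≅ ℝ³` with
initial covector `lam` in the phase cylinder. The curve `γ` is a real-valued lift of the
`ℝ / 4πℤ`-valued angle. -/
structure NormalExtremal (lam : PhaseCylinder) where
  γ : ℝ → ℝ
  c : ℝ → ℝ
  x : ℝ → ℝ
  y : ℝ → ℝ
  z : ℝ → ℝ
  deriv_γ : ∀ t, HasDerivAt γ (c t) t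
  deriv_c : ∀ t, HasDerivAt c (-Real.sin (γ t)) t
  deriv_x : ∀ t, HasDerivAt x (Real.cos (γ t / 2) * Real.cosh (z t)) t
  deriv_y : ∀ t, HasDerivAt y (Real.cos (γ t / 2) * Real.sinh (z t)) t
  deriv_z : ∀ t, HasDerivAt z (Real.sin (γ t / 2)) t
  γ_zero : (γ 0 : AddCircle (4 * Real.pi)) = lam.1
  c_zero : c 0 = lam.2
  x_zero : x 0 = 0
  y_zero : y 0 = 0
  z_zero : z 0 = 0

/-- The pendulum vector field. -/
def pendulum (s : ℝ × ℝ) : ℝ × ℝ := (s.2, -Real.sin s.1)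

theorem lipschitz_pendulum : LipschitzWith 1 pendulum := by
  have h1 : LipschitzWith 1 (fun s : ℝ × ℝ => s.2) := LipschitzWith.prod_snd
  have h2 : LipschitzWith 1 (fun s : ℝ × ℝ => -Real.sin s.1) := by
    refine LipschitzWith.of_dist_le_mul fun s t => ?_
    rw [dist_neg_neg, Real.dist_eq, NNReal.coe_one, one_mul]
    refine le_trans ?_ (le_max_left _ _)
    rw [Real.dist_eq]
    have h := Real.lipschitzWith_sin.dist_le_mul s.1 t.1
    simpa [Real.dist_eq] using h
  simpa [pendulum] using! h1.prodMk h2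

theorem exists_pendulum (s₀ : ℝ × ℝ) :
    ∃ s : ℝ → ℝ × ℝ, s 0 = s₀ ∧ ∀ t, HasDerivAt s (pendulum (s t)) t := by
  have hsmooth : ContDiff ℝ 1 pendulum := by
    unfold pendulum
    fun_prop
  have hloc : ∀ x : ℝ × ℝ, ∃ s : ℝ → ℝ × ℝ, s 0 = x ∧
      IsMIntegralCurveOn (I := 𝓘(ℝ, ℝ × ℝ)) s (fun y => pendulum y) (Ioo (-(1 / 4)) (1 / 4)) := by
    intro x
    have h0 : (0 : ℝ) ∈ Icc (-(1 / 4) : ℝ) (1 / 4) := by constructor <;> norm_num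
    have hPL : IsPicardLindelof (fun _ => pendulum) ⟨0, h0⟩ x (‖x‖₊ + 1) 0 (2 * ‖x‖₊ + 2) 1 := by
      refine IsPicardLindelof.of_time_independent ?_ lipschitz_pendulum.lipschitzOnWith ?_
      · intro y hy
        have h1 : dist (pendulum y) (pendulum x) ≤ dist y x := by
          simpa using lipschitz_pendulum.dist_le_mul y x
        have h2 : dist y x ≤ ‖x‖ + 1 := by simpa using! hy
        have h3 : ‖pendulum x‖ ≤ ‖x‖ + 1 := by
          refine max_le ?_ ?_
          · exact (norm_snd_le x).trans (by linarith)
          · have := Real.abs_sin_le_one x.1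
            have h0 := norm_nonneg x
            change |-Real.sin x.1| ≤ _
            rw [abs_neg]
            linarith
        have h4 : ‖pendulum y‖ ≤ dist (pendulum y) (pendulum x) + ‖pendulum x‖ := by
          rw [dist_eq_norm]
          simpa using norm_add_le (pendulum y - pendulum x) (pendulum x)
        push_cast
        linarith
      · have h0 := norm_nonneg x
        push_cast
        norm_num
        linarith
    obtain ⟨s, hs0, hs⟩ := hPL.exists_eq_forall_mem_Icc_hasDerivWithinAt₀
    refine ⟨s, hs0, fun t ht => ?_⟩
    have h := (hs t (Ioo_subset_Icc_self ht)).hasDerivAt (Icc_mem_nhds ht.1 ht.2)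
    exact (hasMFDerivAt_iff_hasFDerivAt.2 h.hasFDerivAt).hasMFDerivWithinAt
  obtain ⟨s, hs0, hs⟩ := exists_isMIntegralCurve_of_isMIntegralCurveOn (I := 𝓘(ℝ, ℝ × ℝ))
    (v := fun y => pendulum y) (contMDiff_vectorSpace_iff_contDiff.2 hsmooth)
    (by norm_num : (0 : ℝ) < 1 / 4) hloc s₀
  refine ⟨s, hs0, fun t => ?_⟩
  exact hasDerivAt_iff_hasFDerivAt.2 (hasMFDerivAt_iff_hasFDerivAt.1 (hs t))

instance instNonemptyNormalExtremal (lam : PhaseCylinder) : Nonempty (NormalExtremal lam) := by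
  obtain ⟨s, hs0, hs⟩ := exists_pendulum (lam.1.out, lam.2)
  have hγ : ∀ t, HasDerivAt (fun t => (s t).1) (s t).2 t := fun t => by
    simpa [pendulum] using! (hasFDerivAt_fst.comp_hasDerivAt t (hs t))
  have hc : ∀ t, HasDerivAt (fun t => (s t).2) (-Real.sin (s t).1) t := fun t => by
    simpa [pendulum] using! (hasFDerivAt_snd.comp_hasDerivAt t (hs t))
  have hγc : Continuous fun t => (s t).1 :=
    continuous_iff_continuousAt.2 fun t => (hγ t).continuousAt
  have hint : ∀ f : ℝ → ℝ, Continuous f →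
      ∀ t, HasDerivAt (fun t => ∫ u in (0 : ℝ)..t, f u) (f t) t := fun f hf t =>
    intervalIntegral.integral_hasDerivAt_right (hf.intervalIntegrable _ _)
      hf.stronglyMeasurable.stronglyMeasurableAtFilter hf.continuousAt
  have hz := hint (fun u => Real.sin ((s u).1 / 2)) (by fun_prop)
  have hzc : Continuous fun t => ∫ u in (0 : ℝ)..t, Real.sin ((s u).1 / 2) :=
    continuous_iff_continuousAt.2 fun t => (hz t).continuousAt
  refine ⟨{ γ := fun t => (s t).1
            c := fun t => (s t).2
            z := fun t => ∫ u in (0 : ℝ)..t, Real.sin ((s u).1 / 2)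
            x := fun t => ∫ v in (0 : ℝ)..t, Real.cos ((s v).1 / 2) *
              Real.cosh (∫ u in (0 : ℝ)..v, Real.sin ((s u).1 / 2))
            y := fun t => ∫ v in (0 : ℝ)..t, Real.cos ((s v).1 / 2) *
              Real.sinh (∫ u in (0 : ℝ)..v, Real.sin ((s u).1 / 2))
            deriv_γ := hγ
            deriv_c := hc
            deriv_x := hint (fun v => Real.cos ((s v).1 / 2) *
              Real.cosh (∫ u in (0 : ℝ)..v, Real.sin ((s u).1 / 2)))
                ((by fun_prop : Continuous fun v => Real.cos ((s v).1 / 2)).mul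
                  (Real.continuous_cosh.comp hzc))
            deriv_y := hint (fun v => Real.cos ((s v).1 / 2) *
              Real.sinh (∫ u in (0 : ℝ)..v, Real.sin ((s u).1 / 2)))
                ((by fun_prop : Continuous fun v => Real.cos ((s v).1 / 2)).mul
                  (Real.continuous_sinh.comp hzc))
            deriv_z := hz
            γ_zero := ?_
            c_zero := by simp [hs0]
            x_zero := by simp
            y_zero := by simp
            z_zero := by simp }⟩
  simp only [hs0]
  exact Quotient.out_eq lam.1

/-- Two normal extremals with the same initial data have the same projection to `SH(2)`, and their
angles differ by a constant multiple of `4π`. -/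
theorem NormalExtremal.unique {lam : PhaseCylinder} (e f : NormalExtremal lam) :
    (∃ m : ℤ, ∀ t, e.γ t = f.γ t + m * (4 * Real.pi)) ∧
      e.c = f.c ∧ e.x = f.x ∧ e.y = f.y ∧ e.z = f.z := by
  obtain ⟨m, hm⟩ : ∃ m : ℤ, e.γ 0 = f.γ 0 + m * (4 * Real.pi) := by
    have h := e.γ_zero.trans f.γ_zero.symm
    rw [QuotientAddGroup.eq_iff_sub_mem] at h
    obtain ⟨m, hm⟩ := AddSubgroup.mem_zmultiples_iff.1 h
    refine ⟨m, ?_⟩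
    rw [zsmul_eq_mul] at hm
    linarith
  have hpend : (fun t => (e.γ t, e.c t)) = fun t => (f.γ t + m * (4 * Real.pi), f.c t) := by
    refine ODE_solution_unique_univ (t₀ := 0) (v := fun _ => pendulum) (s := fun _ => univ) (K := 1)
      (fun _ => lipschitz_pendulum.lipschitzOnWith)
      (fun t => ⟨(e.deriv_γ t).prodMk (e.deriv_c t), mem_univ _⟩)
      (fun t => ⟨?_, mem_univ _⟩) ?_
    · have h := ((f.deriv_γ t).add_const (m * (4 * Real.pi))).prodMk (f.deriv_c t)
      have hsin : Real.sin (f.γ t + m * (4 * Real.pi)) = Real.sin (f.γ t) := by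
        have := Real.sin_add_int_mul_two_pi (f.γ t) (2 * m)
        rw [← this]
        push_cast
        ring_nf
      simpa only [pendulum, hsin] using h
    · simp only [hm, e.c_zero, f.c_zero]
  have hγ : ∀ t, e.γ t = f.γ t + m * (4 * Real.pi) := fun t => congrArg Prod.fst (congrFun hpend t)
  have hc : e.c = f.c := funext fun t => congrArg Prod.snd (congrFun hpend t)
  have hhalf : ∀ t, e.γ t / 2 = f.γ t / 2 + m * (2 * Real.pi) := fun t => by rw [hγ]; ring
  have hsin : ∀ t, Real.sin (e.γ t / 2) = Real.sin (f.γ t / 2) := fun t => by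
    rw [hhalf, Real.sin_add_int_mul_two_pi]
  have hcos : ∀ t, Real.cos (e.γ t / 2) = Real.cos (f.γ t / 2) := fun t => by
    rw [hhalf, Real.cos_add_int_mul_two_pi]
  have key : ∀ (g h k : ℝ → ℝ), (∀ t, HasDerivAt g (k t) t) → (∀ t, HasDerivAt h (k t) t) →
      g 0 = h 0 → g = h := fun g h k hg hh h0 =>
    ODE_solution_unique_univ (t₀ := 0) (v := fun t _ => k t) (s := fun _ => univ) (K := 0)
      (fun t => (LipschitzWith.const (k t)).lipschitzOnWith)
      (fun t => ⟨hg t, mem_univ _⟩) (fun t => ⟨hh t, mem_univ _⟩) h0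
  have hz : e.z = f.z := key _ _ _ e.deriv_z (fun t => by rw [hsin]; exact f.deriv_z t)
    (e.z_zero.trans f.z_zero.symm)
  refine ⟨⟨m, hγ⟩, hc, ?_, ?_, hz⟩
  · exact key _ _ _ e.deriv_x (fun t => by rw [hcos, hz]; exact f.deriv_x t)
      (e.x_zero.trans f.x_zero.symm)
  · exact key _ _ _ e.deriv_y (fun t => by rw [hcos, hz]; exact f.deriv_y t)
      (e.y_zero.trans f.y_zero.symm)

/-- The normal extremal with initial covector `lam` (it exists, and it is unique up to the choice
of the lift of the angle). -/
def extremal (lam : PhaseCylinder) : NormalExtremal lam := Classical.choice inferInstance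

/-- The exponential mapping `Exp(lam, t) = (x_t, y_t, z_t)`. -/
def expMap (ν : PhaseCylinder × ℝ) : ℝ × ℝ × ℝ :=
  ((extremal ν.1).x ν.2, (extremal ν.1).y ν.2, (extremal ν.1).z ν.2)

/-! ### Stratification of the phase cylinder and the bound `𝐭` -/

theorem cos_periodic_four_pi : Function.Periodic Real.cos (4 * Real.pi) := fun x => by
  have h := Real.cos_add_nat_mul_two_pi x 2
  rw [← h]
  push_cast
  ring_nf

/-- The energy `E = c² / 2 - cos γ` of the pendulum. -/
def energy (lam : PhaseCylinder) : ℝ := lam.2 ^ 2 / 2 - cos_periodic_four_pi.lift lam.1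

theorem energy_coe (γ c : ℝ) :
    energy ((γ : AddCircle (4 * Real.pi)), c) = c ^ 2 / 2 - Real.cos γ := rfl

def C₁ : Set PhaseCylinder := {lam | energy lam ∈ Ioo (-1) 1}
def C₂ : Set PhaseCylinder := {lam | energy lam ∈ Ioi 1}
def C₃ : Set PhaseCylinder := {lam | energy lam = 1 ∧ lam.2 ≠ 0}
def C₄ : Set PhaseCylinder := {lam | energy lam = -1 ∧ lam.2 = 0}
def C₅ : Set PhaseCylinder := {lam | energy lam = 1 ∧ lam.2 = 0}

/-- The complete elliptic integral of the first kind `K(k)`. -/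
def ellipticK (k : ℝ) : ℝ :=
  ∫ θ in (0 : ℝ)..(Real.pi / 2), 1 / Real.sqrt (1 - k ^ 2 * Real.sin θ ^ 2)

/-- The modulus `k` of a point of `C₁`. -/
def modulusC₁ (lam : PhaseCylinder) : ℝ := Real.sqrt ((energy lam + 1) / 2)

/-- The modulus `k` of a point of `C₂`. -/
def modulusC₂ (lam : PhaseCylinder) : ℝ := Real.sqrt (2 / (energy lam + 1))

open Classical in
/-- The function `𝐭 : C → (0, +∞]`; the last case is `lam ∈ C₃ ∪ C₅`. -/
def tBound (lam : PhaseCylinder) : EReal :=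
  if lam ∈ C₁ then ((4 * ellipticK (modulusC₁ lam) : ℝ) : EReal)
  else if lam ∈ C₂ then ((4 * modulusC₂ lam * ellipticK (modulusC₂ lam) : ℝ) : EReal)
  else if lam ∈ C₄ then ((2 * Real.pi : ℝ) : EReal)
  else ⊤

/-! ### The open domains -/

/-- `Ñ ⊆ N = C × (0, +∞)`. -/
def NTilde : Set (PhaseCylinder × ℝ) :=
  {ν | 0 < ν.2 ∧ ν.1 ∈ C₁ ∪ C₂ ∪ C₃ ∧ (ν.2 : EReal) < tBound ν.1 ∧
      Real.sin ((extremal ν.1).γ (ν.2 / 2) / 2) ≠ 0} ∪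
    {ν | 0 < ν.2 ∧ ν.1 ∈ C₅}

/-- `M̃ = {q = (x, y, z) : z ≠ 0}`. -/
def MTilde : Set (ℝ × ℝ × ℝ) := {q | q.2.2 ≠ 0}

end SH2

end

/-!
Halving the angle turns the pendulum into the equation of Jacobi's elliptic functions: at the
midpoint of an extremal put `θ = γ / 2`, `p = c / 2`, `τ = t / 2` and `h = p ^ 2 + sin θ ^ 2`, which
is `(E + 1) / 2`. The addition formulas integrate the system symmetrically about the midpoint, and
in a global chart of `SH(2)` the exponential mapping becomes
`(θ, p, τ) ↦ (cos θ * f τ, p * g τ, sin θ * sn τ)`, where `sn`, `f` and `g` depend on `(h, τ)` only.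
In these variables `Ñ` says that `sin θ ≠ 0` and that `sn` has no zero in `(0, τ]`, while `M̃` says
that the last coordinate does not vanish, and a reflection reduces everything to `sin θ > 0`. There
the Jacobian has no zero: up to sign it is a concave quadratic polynomial in
`sin θ ^ 2`, nonnegative at `0` and positive at the largest possible value `min 1 h`. The mapping is
moreover proper and one of its fibres is a single point, so by connectedness of the target every
fibre is, and the inverse function theorem makes the inverse smooth.
-/

noncomputable section

namespace SH2

section Curves

variable {E F : Type*} [NormedAddCommGroup E] [NormedSpace ℝ E]
  [NormedAddCommGroup F] [NormedSpace ℝ F]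

theorem continuous_of_hasDerivAt {f f' : ℝ → E} (hf : ∀ t, HasDerivAt f (f' t) t) :
    Continuous f :=
  continuous_iff_continuousAt.2 fun t => (hf t).continuousAt

theorem eq_of_hasDerivAt_zero {f : ℝ → E} (hf : ∀ t, HasDerivAt f 0 t) (s t : ℝ) : f s = f t :=
  is_const_of_deriv_eq_zero (fun t => (hf t).differentiableAt) (fun t => (hf t).deriv) s t

theorem hasDerivAt_comp_fst {f : ℝ → E × F} {f' : E × F} {t : ℝ} (hf : HasDerivAt f f' t) :
    HasDerivAt (fun t => (f t).1) f'.1 t :=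
  (hasFDerivAt_fst (𝕜 := ℝ) (E := E) (F := F)).comp_hasDerivAt t hf

theorem hasDerivAt_comp_snd {f : ℝ → E × F} {f' : E × F} {t : ℝ} (hf : HasDerivAt f f' t) :
    HasDerivAt (fun t => (f t).2) f'.2 t :=
  (hasFDerivAt_snd (𝕜 := ℝ) (E := E) (F := F)).comp_hasDerivAt t hf

end Curves

/-! ### Smooth dependence of solutions of ordinary differential equations on initial values -/

universe u

section Composition

variable (K : Type*) [TopologicalSpace K] [CompactSpace K]

/-- Pointwise application of a continuous family of operators to a continuous function, as a
continuous bilinear map. -/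
def pointwiseApply (E F : Type*) [NormedAddCommGroup E] [NormedSpace ℝ E]
    [NormedAddCommGroup F] [NormedSpace ℝ F] :
    C(K, E →L[ℝ] F) →L[ℝ] C(K, E) →L[ℝ] C(K, F) :=
  LinearMap.mkContinuous₂
    (LinearMap.mk₂ ℝ (fun (A : C(K, E →L[ℝ] F)) (b : C(K, E)) =>
        (⟨fun r => A r (b r), by fun_prop⟩ : C(K, F)))
      (fun _ _ _ => by ext; simp) (fun _ _ _ => by ext; simp)
      (fun _ _ _ => by ext; simp) (fun _ _ _ => by ext; simp)) 1
    (fun A b => by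
      rw [one_mul]
      refine (ContinuousMap.norm_le _ (by positivity)).2 fun r => ?_
      exact ((A r).le_opNorm (b r)).trans
        (mul_le_mul (A.norm_coe_le_norm r) (b.norm_coe_le_norm r) (norm_nonneg _) (norm_nonneg A)))

variable {K}

@[simp]
theorem pointwiseApply_apply {E F : Type*} [NormedAddCommGroup E] [NormedSpace ℝ E]
    [NormedAddCommGroup F] [NormedSpace ℝ F] (A : C(K, E →L[ℝ] F)) (b : C(K, E)) (r : K) :
    pointwiseApply K E F A b r = A r (b r) := rfl

theorem hasFDerivAt_continuousMap_comp {E F : Type*} [NormedAddCommGroup E] [NormedSpace ℝ E]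
    [NormedAddCommGroup F] [NormedSpace ℝ F] {V : C(E, F)} {V' : C(E, E →L[ℝ] F)}
    (hV : ∀ x, HasFDerivAt V (V' x) x) (a : C(K, E)) :
    HasFDerivAt (fun a : C(K, E) => V.comp a) (pointwiseApply K E F (V'.comp a)) a := by
  rw [hasFDerivAt_iff_isLittleO_nhds_zero, Asymptotics.isLittleO_iff]
  intro ε hε
  have hcont : ContinuousAt (fun b : C(K, E) => V'.comp b) a :=
    (ContinuousMap.continuous_postcomp V').continuousAt
  obtain ⟨δ, hδ, hV'⟩ :=
    (Metric.continuousAt_iff (α := C(K, E)) (β := C(K, E →L[ℝ] F))).1 hcont ε hε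
  filter_upwards [Metric.ball_mem_nhds (0 : C(K, E)) hδ] with b hb
  rw [mem_ball_zero_iff] at hb
  refine (ContinuousMap.norm_le _ (by positivity)).2 fun r => ?_
  have hderiv : ∀ y ∈ segment ℝ (a r) (a r + b r), ‖V' y - V' (a r)‖ ≤ ε := by
    intro y hy
    obtain ⟨s, hs, rfl⟩ := (segment_eq_image' ℝ (a r) (a r + b r)) ▸ hy
    have hnear : dist (a + s • b) a < δ := by
      rw [dist_eq_norm, add_sub_cancel_left, norm_smul, Real.norm_of_nonneg hs.1]
      exact (mul_le_of_le_one_left (norm_nonneg _) hs.2).trans_lt hb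
    simpa [dist_eq_norm] using (ContinuousMap.dist_apply_le_dist r).trans (hV' hnear).le
  have hmean : ‖V (a r + b r) - V (a r) - V' (a r) (a r + b r - a r)‖ ≤
      ε * ‖a r + b r - a r‖ :=
    (convex_segment (a r) (a r + b r)).norm_image_sub_le_of_norm_hasFDerivWithin_le'
      (fun y _ => (hV y).hasFDerivWithinAt) hderiv
      (left_mem_segment ℝ _ _) (right_mem_segment ℝ _ _)
  simp only [add_sub_cancel_left] at hmean
  exact hmean.trans (mul_le_mul_of_nonneg_left (b.norm_coe_le_norm r) hε.le)

theorem contDiff_nat_continuousMap_comp {E : Type u} [NormedAddCommGroup E] [NormedSpace ℝ E]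
    (n : ℕ) : ∀ {F : Type u} [NormedAddCommGroup F] [NormedSpace ℝ F] (V : C(E, F)),
      ContDiff ℝ n V → ContDiff ℝ n (fun a : C(K, E) => V.comp a) := by
  induction n with
  | zero =>
    intro F _ _ V _
    exact contDiff_zero.2 (ContinuousMap.continuous_postcomp V)
  | succ n ih =>
    intro F _ _ V hV
    push_cast at hV ⊢
    obtain ⟨V', hV', hderiv⟩ := contDiff_succ_iff_hasFDerivAt.1 hV
    let W : C(E, E →L[ℝ] F) := ⟨V', hV'.continuous⟩
    have happly : ContDiff ℝ n (pointwiseApply K E F) := ContinuousLinearMap.contDiff _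
    have hW : ContDiff ℝ n fun a : C(K, E) => pointwiseApply K E F (W.comp a) :=
      happly.comp (ih W hV')
    exact contDiff_succ_iff_hasFDerivAt.2
      ⟨_, hW, fun a => hasFDerivAt_continuousMap_comp (V' := W) hderiv a⟩

theorem contDiff_continuousMap_comp {E F : Type u} [NormedAddCommGroup E] [NormedSpace ℝ E]
    [NormedAddCommGroup F] [NormedSpace ℝ F] {n : ℕ∞} {V : C(E, F)} (hV : ContDiff ℝ n V) :
    ContDiff ℝ n (fun a : C(K, E) => V.comp a) :=
  contDiff_iff_forall_nat_le.2 fun m hm =>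
    contDiff_nat_continuousMap_comp m V (contDiff_iff_forall_nat_le.1 hV m hm)

end Composition

section Volterra

variable (E : Type*) [NormedAddCommGroup E] [NormedSpace ℝ E]

/-- The primitive vanishing at `0` of a continuous function on the unit interval. -/
def primitive : C(unitInterval, E) →L[ℝ] C(unitInterval, E) :=
  LinearMap.mkContinuous
    { toFun := fun b => ⟨fun r => ∫ s in (0 : ℝ)..r, b (projIcc 0 1 zero_le_one s), by
        have h : Continuous fun s : ℝ => b (projIcc 0 1 zero_le_one s) := by fun_prop
        exact (intervalIntegral.continuous_primitive (fun _ _ => h.intervalIntegrable _ _) 0).comp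
          continuous_subtype_val⟩
      map_add' := fun a b => by
        ext r
        simp only [ContinuousMap.coe_mk, ContinuousMap.add_apply]
        exact intervalIntegral.integral_add
          (Continuous.intervalIntegrable (by fun_prop) _ _)
          (Continuous.intervalIntegrable (by fun_prop) _ _)
      map_smul' := fun c b => by
        ext r
        simp } 1
    (fun b => by
      rw [one_mul]
      refine (ContinuousMap.norm_le _ (norm_nonneg _)).2 fun r => ?_
      simp only [LinearMap.coe_mk, AddHom.coe_mk, ContinuousMap.coe_mk]
      refine (intervalIntegral.norm_integral_le_of_norm_le_const
        (C := ‖b‖) fun s _ => b.norm_coe_le_norm _).trans ?_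
      rw [sub_zero, abs_of_nonneg r.2.1]
      exact mul_le_of_le_one_right (norm_nonneg _) r.2.2)

variable {E}

theorem primitive_apply (b : C(unitInterval, E)) (r : unitInterval) :
    primitive E b r = ∫ s in (0 : ℝ)..r, b (projIcc 0 1 zero_le_one s) := rfl

theorem norm_volterra_pow_apply_le (A : C(unitInterval, E →L[ℝ] E)) (b : C(unitInterval, E))
    (n : ℕ) (r : unitInterval) :
    ‖((primitive E ∘L pointwiseApply unitInterval E E A) ^ n) b r‖ ≤
      ‖b‖ * ((‖A‖ * r) ^ n / n.factorial) := by
  induction n generalizing r with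
  | zero => simpa using b.norm_coe_le_norm r
  | succ n ih =>
    rw [pow_succ', mul_apply_eq_comp, ContinuousLinearMap.comp_apply, primitive_apply]
    have hint : ∫ s in (0 : ℝ)..r, ‖A‖ * (‖b‖ * ((‖A‖ * s) ^ n / n.factorial)) =
        ‖b‖ * ((‖A‖ * r) ^ (n + 1) / (n + 1).factorial) := by
      have : (fun s : ℝ => ‖A‖ * (‖b‖ * ((‖A‖ * s) ^ n / n.factorial))) =
          fun s => (‖b‖ * ‖A‖ ^ (n + 1) / n.factorial) * s ^ n := by
        ext s; rw [mul_pow]; ring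
      rw [this, intervalIntegral.integral_const_mul, integral_pow, Nat.factorial_succ]
      push_cast
      have : (n.factorial : ℝ) ≠ 0 := by positivity
      have : (n + 1 : ℝ) ≠ 0 := by positivity
      field_simp
      simp [mul_pow, mul_assoc]
    rw [← hint]
    refine intervalIntegral.norm_integral_le_of_norm_le r.2.1
      (Filter.Eventually.of_forall fun s hs => ?_) (Continuous.intervalIntegrable (by fun_prop) _ _)
    have hs' : s ∈ Icc (0 : ℝ) 1 := ⟨hs.1.le, hs.2.trans r.2.2⟩
    rw [projIcc_of_mem _ hs', pointwiseApply_apply]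
    exact ((A _).le_opNorm _).trans (mul_le_mul (A.norm_coe_le_norm _) (ih ⟨s, hs'⟩)
      (norm_nonneg _) (norm_nonneg A))

theorem exists_norm_volterra_pow_lt_one (A : C(unitInterval, E →L[ℝ] E)) :
    ∃ n : ℕ, ‖(primitive E ∘L pointwiseApply unitInterval E E A) ^ n‖ < 1 := by
  obtain ⟨n, hn⟩ : ∃ n : ℕ, ‖A‖ ^ n / n.factorial < 1 :=
    ((FloorSemiring.tendsto_pow_div_factorial_atTop ‖A‖).eventually
      (gt_mem_nhds one_pos)).exists
  refine ⟨n, (ContinuousLinearMap.opNorm_le_bound _ (by positivity) fun b => ?_).trans_lt hn⟩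
  refine (ContinuousMap.norm_le _ (by positivity)).2 fun r => ?_
  refine (norm_volterra_pow_apply_le A b n r).trans ?_
  rw [mul_comm]
  gcongr
  · exact mul_nonneg (norm_nonneg A) r.2.1
  · exact mul_le_of_le_one_right (norm_nonneg A) r.2.2

theorem isUnit_one_sub_of_norm_pow_lt_one {R : Type*} [NormedRing R] [HasSummableGeomSeries R]
    {a : R} {n : ℕ} (h : ‖a ^ n‖ < 1) : IsUnit (1 - a) := by
  have hpow := isUnit_one_sub_of_norm_lt_one h
  rw [← mul_neg_geom_sum] at hpow
  have hcomm : Commute (1 - a) (∑ i ∈ Finset.range n, a ^ i) :=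
    (Commute.one_left _).sub_left (Commute.sum_right _ _ _ fun i _ => (Commute.refl a).pow_right i)
  exact (hcomm.isUnit_mul_iff.1 hpow).1

theorem isUnit_one_sub_volterra [CompleteSpace E] (A : C(unitInterval, E →L[ℝ] E)) :
    IsUnit (1 - primitive E ∘L pointwiseApply unitInterval E E A) :=
  let ⟨_, hn⟩ := exists_norm_volterra_pow_lt_one A
  isUnit_one_sub_of_norm_pow_lt_one (R := C(unitInterval, E) →L[ℝ] C(unitInterval, E)) hn

end Volterra

section SmoothDependence

variable {E : Type u} [NormedAddCommGroup E] [NormedSpace ℝ E]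

/-- The defect of a curve `a` on the unit interval as a solution of the integral equation
`a r = x + T ∫₀ʳ V(a)`, whose solutions are the solutions of `b' = V b`, `b 0 = x` on `[0, T]`,
run at constant speed `T`. -/
def integralDefect (V : C(E, E)) (q : (E × ℝ) × C(unitInterval, E)) : C(unitInterval, E) :=
  q.2 - ContinuousLinearMap.const ℝ unitInterval q.1.1 - q.1.2 • primitive E (V.comp q.2)

theorem integralDefect_apply (V : C(E, E)) (x : E) (T : ℝ) (a : C(unitInterval, E))
    (r : unitInterval) : integralDefect V ((x, T), a) r =
      a r - (x + T • ∫ s in (0 : ℝ)..r, V (a (projIcc 0 1 zero_le_one s))) :=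
  sub_sub _ _ _

theorem contDiff_integralDefect {n : ℕ∞} {V : C(E, E)} (hV : ContDiff ℝ n V) :
    ContDiff ℝ n (integralDefect V) := by
  have hconst : ContDiff ℝ n (ContinuousLinearMap.const ℝ unitInterval : E →L[ℝ] _) :=
    ContinuousLinearMap.contDiff _
  have hprim : ContDiff ℝ n (primitive E) := ContinuousLinearMap.contDiff _
  have hinit : ContDiff ℝ n fun q : (E × ℝ) × C(unitInterval, E) =>
      ContinuousLinearMap.const ℝ unitInterval q.1.1 := hconst.comp contDiff_fst.fst
  have hintegral : ContDiff ℝ n fun q : (E × ℝ) × C(unitInterval, E) =>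
      primitive E (V.comp q.2) :=
    hprim.comp ((contDiff_continuousMap_comp hV).comp contDiff_snd)
  exact (contDiff_snd.sub hinit).sub (contDiff_fst.snd.smul hintegral)

theorem fderiv_integralDefect_comp_inr {V : C(E, E)} (hV : ContDiff ℝ 1 V)
    (q : (E × ℝ) × C(unitInterval, E)) :
    fderiv ℝ (integralDefect V) q ∘L ContinuousLinearMap.inr ℝ (E × ℝ) C(unitInterval, E) =
      1 - primitive E ∘L pointwiseApply unitInterval E E
        (q.1.2 • (ContinuousMap.mk _ (hV.continuous_fderiv one_ne_zero)).comp q.2) := by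
  obtain ⟨⟨x, T⟩, a⟩ := q
  have htotal : HasFDerivAt (fun a => integralDefect V ((x, T), a)) _ a :=
    ((contDiff_integralDefect (n := 1) hV).differentiable one_ne_zero
      ((x, T), a)).hasFDerivAt.comp a (hasFDerivAt_prodMk_right (x, T) a)
  refine htotal.unique ?_
  have hcomp := hasFDerivAt_continuousMap_comp (V := V)
    (V' := ⟨fderiv ℝ V, hV.continuous_fderiv one_ne_zero⟩)
    (fun y => (hV.differentiable one_ne_zero y).hasFDerivAt) a
  have hprim := ((primitive E).hasFDerivAt.comp a hcomp).const_smul T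
  convert! ((hasFDerivAt_id a).sub_const (ContinuousLinearMap.const ℝ unitInterval x)).sub hprim
    using 1
  ext b r
  simp

variable [CompleteSpace E]

theorem integralDefect_eq_zero {V : C(E, E)} {b : ℝ → E}
    (hb : ∀ t, HasDerivAt b (V (b t)) t) (T : ℝ) (a : C(unitInterval, E))
    (ha : ∀ r, a r = b (T * r)) : integralDefect V ((b 0, T), a) = 0 := by
  have hbc : Continuous b := continuous_of_hasDerivAt hb
  ext r
  have hint : ∫ s in (0 : ℝ)..r, T • V (b (T * s)) = b (T * r) - b (T * 0) := by
    refine intervalIntegral.integral_eq_sub_of_hasDerivAt (f := fun s => b (T * s)) (fun t _ => ?_)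
      (Continuous.intervalIntegrable (by fun_prop) _ _)
    simpa [Function.comp_def] using (hb (T * t)).scomp t ((hasDerivAt_id t).const_mul T)
  have hcongr : ∫ s in (0 : ℝ)..r, V (a (projIcc 0 1 zero_le_one s)) =
      ∫ s in (0 : ℝ)..r, V (b (T * s)) := by
    refine intervalIntegral.integral_congr fun s hs => ?_
    rw [uIcc_of_le r.2.1] at hs
    simp only [projIcc_of_mem zero_le_one (show s ∈ Icc (0 : ℝ) 1 from ⟨hs.1, hs.2.trans r.2.2⟩),
      ha]
  rw [integralDefect_apply, hcongr, ← intervalIntegral.integral_smul, hint, mul_zero, ha]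
  simp

theorem apply_one_eq_of_integralDefect_eq_zero {V : C(E, E)} (hV : ContDiff ℝ 1 V) {b : ℝ → E}
    (hb : ∀ t, HasDerivAt b (V (b t)) t) {T : ℝ} {a : C(unitInterval, E)}
    (ha : integralDefect V ((b 0, T), a) = 0) : a 1 = b T := by
  set c : ℝ → E := fun t => b 0 + T • ∫ s in (0 : ℝ)..t, V (a (projIcc 0 1 zero_le_one s)) with hc
  have hca : ∀ r : unitInterval, c r = a r := fun r => by
    have := integralDefect_apply V (b 0) T a r
    rw [ha, ContinuousMap.zero_apply] at this
    exact (sub_eq_zero.1 this.symm).symm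
  have hVa : Continuous fun s : ℝ => V (a (projIcc 0 1 zero_le_one s)) := by fun_prop
  have hc' : ∀ t ∈ Icc (0 : ℝ) 1, HasDerivAt c (T • V (c t)) t := fun t ht => by
    rw [hca ⟨t, ht⟩, ← projIcc_of_mem zero_le_one ht]
    exact ((hVa.integral_hasStrictDerivAt 0 t).hasDerivAt.const_smul T).const_add _
  have hbT : ∀ t : ℝ, HasDerivAt (fun t => b (T * t)) (T • V (b (T * t))) t := fun t => by
    simpa [Function.comp_def] using (hb (T * t)).scomp t ((hasDerivAt_id t).const_mul T)
  have hcc : ContinuousOn c (Icc 0 1) := fun t ht => (hc' t ht).continuousAt.continuousWithinAt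
  have hbc : Continuous fun t => b (T * t) := continuous_of_hasDerivAt hbT
  obtain ⟨L, hL⟩ := hV.locallyLipschitz.locallyLipschitzOn.exists_lipschitzOnWith_of_compact
    ((isCompact_Icc.image_of_continuousOn hcc).union (isCompact_Icc.image hbc))
  have hunique := ODE_solution_unique_of_mem_Icc_right (v := fun _ x => T • V x)
    (fun t _ => (lipschitzWith_smul T).comp_lipschitzOnWith hL) hcc
    (fun t ht => (hc' t (Ico_subset_Icc_self ht)).hasDerivWithinAt)
    (fun t ht => Or.inl ⟨t, Ico_subset_Icc_self ht, rfl⟩) hbc.continuousOn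
    (fun t _ => (hbT t).hasDerivWithinAt)
    (fun t ht => Or.inr ⟨t, Ico_subset_Icc_self ht, rfl⟩)
    (by simp [hc]) (right_mem_Icc.2 zero_le_one)
  exact (hca 1).symm.trans (hunique.trans (congrArg b (mul_one T)))

/-- The implicit function theorem applies to `integralDefect V = 0` because its derivative in the
curve is the identity minus a Volterra operator. -/
theorem exists_contDiffAt_eq_solution {n : ℕ∞} (hn : 1 ≤ n) {V : E → E} (hV : ContDiff ℝ n V)
    {b₀ : ℝ → E} (hb₀ : ∀ t, HasDerivAt b₀ (V (b₀ t)) t) (T : ℝ) :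
    ∃ Ψ : E × ℝ → E, ContDiffAt ℝ n Ψ (b₀ 0, T) ∧ ∀ᶠ q in 𝓝 (b₀ 0, T),
      ∀ b : ℝ → E, b 0 = q.1 → (∀ t, HasDerivAt b (V (b t)) t) → b q.2 = Ψ q := by
  have hV1 : ContDiff ℝ 1 V := hV.of_le (mod_cast hn)
  have hn0 : (n : WithTop ℕ∞) ≠ 0 := by exact_mod_cast (zero_lt_one.trans_le hn).ne'
  let W : C(E, E) := ⟨V, hV.continuous⟩
  have hb₀c : Continuous b₀ := continuous_of_hasDerivAt hb₀
  let a₀ : C(unitInterval, E) := ⟨fun r => b₀ (T * r), by fun_prop⟩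
  have hzero : integralDefect W ((b₀ 0, T), a₀) = 0 :=
    integralDefect_eq_zero hb₀ T a₀ fun _ => rfl
  have hG : ContDiffAt ℝ n (integralDefect W) ((b₀ 0, T), a₀) :=
    (contDiff_integralDefect (V := W) hV).contDiffAt
  have hinv : (fderiv ℝ (integralDefect W) ((b₀ 0, T), a₀) ∘L
      ContinuousLinearMap.inr ℝ (E × ℝ) C(unitInterval, E)).IsInvertible := by
    rw [fderiv_integralDefect_comp_inr (V := W) hV1]
    obtain ⟨w, hw⟩ := isUnit_one_sub_volterra
      (T • (ContinuousMap.mk _ (hV1.continuous_fderiv one_ne_zero)).comp a₀)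
    exact ⟨ContinuousLinearEquiv.unitsEquiv ℝ _ w, hw⟩
  refine ⟨fun q => hG.implicitFunction hn0 hinv q 1, ?_, ?_⟩
  · exact (ContinuousMap.evalCLM ℝ (1 : unitInterval)).contDiff.contDiffAt.comp _
      (hG.contDiffAt_implicitFunction hn0 hinv)
  · filter_upwards [hG.eventually_apply_implicitFunction hn0 hinv] with ⟨x, t⟩ hq b hbx hb
    obtain rfl : b 0 = x := hbx
    rw [hzero] at hq
    exact (apply_one_eq_of_integralDefect_eq_zero (V := W) hV1 hb hq).symm

theorem contDiffAt_solution {P : Type*} [NormedAddCommGroup P] [NormedSpace ℝ P] {n : ℕ∞}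
    (hn : 1 ≤ n) {V : E → E} (hV : ContDiff ℝ n V) {φ : P → ℝ → E} {p : P}
    (hφ0 : ContDiffAt ℝ n (fun p => φ p 0) p)
    (hφ : ∀ᶠ p in 𝓝 p, ∀ t, HasDerivAt (φ p) (V (φ p t)) t) (T : ℝ) :
    ContDiffAt ℝ n (fun q : P × ℝ => φ q.1 q.2) (p, T) := by
  obtain ⟨Ψ, hΨ, hsol⟩ := exists_contDiffAt_eq_solution hn hV hφ.self_of_nhds T
  have hinit : ContDiffAt ℝ n (fun q : P × ℝ => (φ q.1 0, q.2)) (p, T) :=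
    (hφ0.comp (p, T) contDiffAt_fst).prodMk contDiffAt_snd
  refine (ContDiffAt.comp (p, T) hΨ hinit).congr_of_eventuallyEq ?_
  filter_upwards [hinit.continuousAt.eventually hsol, continuousAt_fst.eventually hφ]
    with q hq hqφ
  exact hq (φ q.1) rfl hqφ

end SmoothDependence

/-! ### The flow of the pendulum -/

/-- The flow of the pendulum. -/
def pendulumFlow (s : ℝ × ℝ) : ℝ → ℝ × ℝ := Classical.choose (exists_pendulum s)

theorem pendulumFlow_zero (s : ℝ × ℝ) : pendulumFlow s 0 = s :=
  (Classical.choose_spec (exists_pendulum s)).1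

theorem hasDerivAt_pendulumFlow (s : ℝ × ℝ) (t : ℝ) :
    HasDerivAt (pendulumFlow s) (pendulum (pendulumFlow s t)) t :=
  (Classical.choose_spec (exists_pendulum s)).2 t

theorem contDiff_pendulumFlow : ContDiff ℝ ∞ fun q : (ℝ × ℝ) × ℝ => pendulumFlow q.1 q.2 := by
  have hpendulum : ContDiff ℝ ∞ pendulum := by unfold pendulum; fun_prop
  refine contDiff_iff_contDiffAt.2 fun q => contDiffAt_solution le_top hpendulum ?_
    (Filter.Eventually.of_forall hasDerivAt_pendulumFlow) q.2
  simpa only [pendulumFlow_zero] using! contDiffAt_id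

theorem hasDerivAt_pendulumFlow_fst (s : ℝ × ℝ) (t : ℝ) :
    HasDerivAt (fun t => (pendulumFlow s t).1) (pendulumFlow s t).2 t :=
  hasDerivAt_comp_fst (hasDerivAt_pendulumFlow s t)

theorem hasDerivAt_pendulumFlow_snd (s : ℝ × ℝ) (t : ℝ) :
    HasDerivAt (fun t => (pendulumFlow s t).2) (-Real.sin (pendulumFlow s t).1) t :=
  hasDerivAt_comp_snd (hasDerivAt_pendulumFlow s t)

theorem pendulum_unique {a b : ℝ → ℝ × ℝ} (ha : ∀ t, HasDerivAt a (pendulum (a t)) t)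
    (hb : ∀ t, HasDerivAt b (pendulum (b t)) t) {t₀ : ℝ} (h : a t₀ = b t₀) : a = b :=
  ODE_solution_unique_univ (v := fun _ => pendulum) (s := fun _ => univ) (K := 1)
    (fun _ => lipschitz_pendulum.lipschitzOnWith) (fun t => ⟨ha t, mem_univ _⟩)
    (fun t => ⟨hb t, mem_univ _⟩) h

theorem hasDerivAt_sin_half {γ : ℝ → ℝ} {c t : ℝ} (hγ : HasDerivAt γ c t) :
    HasDerivAt (fun t => Real.sin (γ t / 2)) (Real.cos (γ t / 2) * (c / 2)) t :=
  (hγ.div_const 2).sin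

theorem hasDerivAt_cos_half {γ : ℝ → ℝ} {c t : ℝ} (hγ : HasDerivAt γ c t) :
    HasDerivAt (fun t => Real.cos (γ t / 2)) (-(Real.sin (γ t / 2) * (c / 2))) t :=
  (hγ.div_const 2).cos.congr_deriv (neg_mul _ _)

theorem hasDerivAt_half_of_neg_sin {c : ℝ → ℝ} {γ t : ℝ} (hc : HasDerivAt c (-Real.sin γ) t) :
    HasDerivAt (fun t => c t / 2) (-(Real.sin (γ / 2) * Real.cos (γ / 2))) t := by
  refine (hc.div_const 2).congr_deriv ?_
  rw [← mul_div_cancel₀ γ two_ne_zero, mul_div_assoc, Real.sin_two_mul]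
  ring_nf

/-! ### Jacobi's elliptic functions -/

theorem exists_linear_solution {E : Type*} [NormedAddCommGroup E] [NormedSpace ℝ E]
    [CompleteSpace E] {a : ℝ → ℝ} {b : ℝ → E} (ha : Continuous a) (hb : Continuous b) :
    ∃ y : ℝ → E, y 0 = 0 ∧ ∀ t, HasDerivAt y (b t + a t • y t) t := by
  set A : ℝ → ℝ := fun t => ∫ u in (0 : ℝ)..t, a u
  have hA : ∀ t, HasDerivAt A (a t) t := fun t => (ha.integral_hasStrictDerivAt 0 t).hasDerivAt
  have hAb : Continuous fun t => Real.exp (-A t) • b t :=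
    (Real.continuous_exp.comp (continuous_of_hasDerivAt hA).neg).smul hb
  refine ⟨fun t => Real.exp (A t) • ∫ u in (0 : ℝ)..t, Real.exp (-A u) • b u, by simp, fun t => ?_⟩
  refine ((hA t).exp.smul (hAb.integral_hasStrictDerivAt 0 t).hasDerivAt).congr_deriv ?_
  rw [smul_smul, ← Real.exp_add, add_neg_cancel, Real.exp_zero, one_smul, smul_smul, mul_comm]

/-- The polynomial system satisfied by `(h, sn, cn, dn, ef, eg)`, in which the parameter `h` is
itself a constant solution. -/
def jacobiField (s : ℝ × ℝ × ℝ × ℝ × ℝ × ℝ) : ℝ × ℝ × ℝ × ℝ × ℝ × ℝ :=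
  (0, s.2.2.1 * s.2.2.2.1, -(s.2.1 * s.2.2.2.1), -(s.1 * s.2.1 * s.2.2.1),
    s.2.2.2.1 + s.1 * s.2.1 * s.2.2.2.2.2, s.2.1 * s.2.2.2.2.1)

/-- Along the pendulum trajectory with `γ 0 = 0` and `c 0 = 2 k`, the functions `sin (γ / 2) / k`,
`c / (2 k)` and `cos (γ / 2)` are `sn`, `cn` and `dn`; the combinations `ef ± k eg` solve scalar
linear equations. -/
theorem exists_jacobi {h : ℝ} (hh : 0 < h) : ∃ X : ℝ → ℝ × ℝ × ℝ × ℝ × ℝ × ℝ,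
    X 0 = (h, 0, 1, 1, 0, 0) ∧ ∀ t, HasDerivAt X (jacobiField (X t)) t := by
  obtain ⟨k, hk, rfl⟩ : ∃ k, k ≠ 0 ∧ k ^ 2 = h :=
    ⟨Real.sqrt h, (Real.sqrt_pos.2 hh).ne', Real.sq_sqrt hh.le⟩
  obtain ⟨γ, c, hγ0, hc0, hγ, hc⟩ : ∃ γ c : ℝ → ℝ, γ 0 = 0 ∧ c 0 = 2 * k ∧
      (∀ t, HasDerivAt γ (c t) t) ∧ ∀ t, HasDerivAt c (-Real.sin (γ t)) t :=
    ⟨_, _, congrArg Prod.fst (pendulumFlow_zero (0, 2 * k)),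
      congrArg Prod.snd (pendulumFlow_zero (0, 2 * k)),
      hasDerivAt_pendulumFlow_fst _, hasDerivAt_pendulumFlow_snd _⟩
  have hγc : Continuous γ := continuous_of_hasDerivAt hγ
  obtain ⟨α, hα0, hα⟩ := exists_linear_solution (a := fun t => -Real.sin (γ t / 2))
    (b := fun t => Real.cos (γ t / 2)) (by fun_prop) (by fun_prop)
  obtain ⟨β, hβ0, hβ⟩ := exists_linear_solution (a := fun t => Real.sin (γ t / 2))
    (b := fun t => Real.cos (γ t / 2)) (by fun_prop) (by fun_prop)
  simp only [smul_eq_mul] at hα hβ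
  refine ⟨fun t => (k ^ 2, Real.sin (γ t / 2) / k, c t / 2 / k, Real.cos (γ t / 2),
    (α t + β t) / 2, (β t - α t) / (2 * k)), by simp [hγ0, hc0, hα0, hβ0, hk], fun t => ?_⟩
  have hsn := ((hasDerivAt_sin_half (hγ t)).div_const k).congr_deriv
    (g' := c t / 2 / k * Real.cos (γ t / 2)) (by ring)
  have hcn := ((hasDerivAt_half_of_neg_sin (hc t)).div_const k).congr_deriv
    (g' := -(Real.sin (γ t / 2) / k * Real.cos (γ t / 2))) (by ring)
  have hdn := (hasDerivAt_cos_half (hγ t)).congr_deriv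
    (g' := -(k ^ 2 * (Real.sin (γ t / 2) / k) * (c t / 2 / k))) (by field_simp)
  have hef := (((hα t).add (hβ t)).div_const 2).congr_deriv
    (g' := Real.cos (γ t / 2) + k ^ 2 * (Real.sin (γ t / 2) / k) * ((β t - α t) / (2 * k)))
    (by field_simp; ring)
  have heg := (((hβ t).sub (hα t)).div_const (2 * k)).congr_deriv
    (g' := Real.sin (γ t / 2) / k * ((α t + β t) / 2)) (by field_simp; ring)
  exact (hasDerivAt_const t (k ^ 2)).prodMk (hsn.prodMk (hcn.prodMk (hdn.prodMk (hef.prodMk heg))))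

/-- The solution of the Jacobi system with parameter `h > 0` (junk value `0` for `h ≤ 0`). -/
def jacobi (h : ℝ) : ℝ → ℝ × ℝ × ℝ × ℝ × ℝ × ℝ :=
  if hh : 0 < h then Classical.choose (exists_jacobi hh) else 0

/-- Jacobi's sine amplitude, as a function of the parameter `h = k ^ 2` and of the argument; the
values `h > 1` are allowed. -/
def sn (h t : ℝ) : ℝ := (jacobi h t).2.1

/-- Jacobi's cosine amplitude. -/
def cn (h t : ℝ) : ℝ := (jacobi h t).2.2.1

/-- Jacobi's delta amplitude. -/
def dn (h t : ℝ) : ℝ := (jacobi h t).2.2.2.1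

/-- The function `(E dn - h sn cn) / (1 - h)`, where `E` is the integral of `dn ^ 2`, continued
smoothly to `h = 1`. -/
def ef (h t : ℝ) : ℝ := (jacobi h t).2.2.2.2.1

/-- The function `(sn dn - E cn) / (1 - h)`, where `E` is the integral of `dn ^ 2`, continued
smoothly to `h = 1`. -/
def eg (h t : ℝ) : ℝ := (jacobi h t).2.2.2.2.2

/-- Jacobi's epsilon function `∫ dn ^ 2`, the incomplete elliptic integral of the second kind. -/
def ee (h t : ℝ) : ℝ := ef h t * dn h t + h * eg h t * cn h t

section Jacobi

variable {h : ℝ}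

theorem jacobi_zero (hh : 0 < h) : jacobi h 0 = (h, 0, 1, 1, 0, 0) := by
  rw [jacobi, dif_pos hh]
  exact (Classical.choose_spec (exists_jacobi hh)).1

theorem hasDerivAt_jacobi (hh : 0 < h) (t : ℝ) :
    HasDerivAt (jacobi h) (jacobiField (jacobi h t)) t := by
  rw [jacobi, dif_pos hh]
  exact (Classical.choose_spec (exists_jacobi hh)).2 t

theorem contDiffAt_jacobi (hh : 0 < h) (t : ℝ) :
    ContDiffAt ℝ ∞ (fun q : ℝ × ℝ => jacobi q.1 q.2) (h, t) := by
  have hfield : ContDiff ℝ ∞ jacobiField := by unfold jacobiField; fun_prop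
  have hpos : ∀ᶠ h' in 𝓝 h, 0 < h' := lt_mem_nhds hh
  refine contDiffAt_solution le_top hfield ?_ (hpos.mono fun _ => hasDerivAt_jacobi) t
  refine ContDiffAt.congr_of_eventuallyEq ?_ (hpos.mono fun _ => jacobi_zero)
  fun_prop

theorem jacobi_fst (hh : 0 < h) (t : ℝ) : (jacobi h t).1 = h := by
  rw [eq_of_hasDerivAt_zero (fun t => hasDerivAt_comp_fst (hasDerivAt_jacobi hh t)) t 0,
    jacobi_zero hh]

theorem hasDerivAt_sn (hh : 0 < h) (t : ℝ) : HasDerivAt (sn h) (cn h t * dn h t) t :=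
  hasDerivAt_comp_fst (hasDerivAt_comp_snd (hasDerivAt_jacobi hh t))

theorem hasDerivAt_cn (hh : 0 < h) (t : ℝ) : HasDerivAt (cn h) (-(sn h t * dn h t)) t :=
  hasDerivAt_comp_fst (hasDerivAt_comp_snd (hasDerivAt_comp_snd (hasDerivAt_jacobi hh t)))

theorem hasDerivAt_dn (hh : 0 < h) (t : ℝ) : HasDerivAt (dn h) (-(h * sn h t * cn h t)) t := by
  have := hasDerivAt_comp_fst (hasDerivAt_comp_snd (hasDerivAt_comp_snd
    (hasDerivAt_comp_snd (hasDerivAt_jacobi hh t))))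
  simpa only [jacobiField, jacobi_fst hh] using! this

theorem hasDerivAt_ef (hh : 0 < h) (t : ℝ) :
    HasDerivAt (ef h) (dn h t + h * sn h t * eg h t) t := by
  have := hasDerivAt_comp_fst (hasDerivAt_comp_snd (hasDerivAt_comp_snd
    (hasDerivAt_comp_snd (hasDerivAt_comp_snd (hasDerivAt_jacobi hh t)))))
  simpa only [jacobiField, jacobi_fst hh] using! this

theorem hasDerivAt_eg (hh : 0 < h) (t : ℝ) : HasDerivAt (eg h) (sn h t * ef h t) t :=
  hasDerivAt_comp_snd (hasDerivAt_comp_snd (hasDerivAt_comp_snd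
    (hasDerivAt_comp_snd (hasDerivAt_comp_snd (hasDerivAt_jacobi hh t)))))

theorem hasDerivAt_ee (hh : 0 < h) (t : ℝ) : HasDerivAt (ee h) (dn h t ^ 2) t :=
  (((hasDerivAt_ef hh t).mul (hasDerivAt_dn hh t)).add
    (((hasDerivAt_eg hh t).const_mul h).mul (hasDerivAt_cn hh t))).congr_deriv (by ring)

theorem sn_zero (hh : 0 < h) : sn h 0 = 0 := by simp [sn, jacobi_zero hh]
theorem cn_zero (hh : 0 < h) : cn h 0 = 1 := by simp [cn, jacobi_zero hh]
theorem dn_zero (hh : 0 < h) : dn h 0 = 1 := by simp [dn, jacobi_zero hh]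
theorem ef_zero (hh : 0 < h) : ef h 0 = 0 := by simp [ef, jacobi_zero hh]
theorem eg_zero (hh : 0 < h) : eg h 0 = 0 := by simp [eg, jacobi_zero hh]
theorem ee_zero (hh : 0 < h) : ee h 0 = 0 := by simp [ee, ef_zero hh, eg_zero hh]

theorem contDiffAt_sn (hh : 0 < h) (t : ℝ) : ContDiffAt ℝ ∞ (fun q : ℝ × ℝ => sn q.1 q.2) (h, t) :=
  (contDiffAt_jacobi hh t).snd.fst

theorem contDiffAt_cn (hh : 0 < h) (t : ℝ) : ContDiffAt ℝ ∞ (fun q : ℝ × ℝ => cn q.1 q.2) (h, t) :=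
  (contDiffAt_jacobi hh t).snd.snd.fst

theorem contDiffAt_dn (hh : 0 < h) (t : ℝ) : ContDiffAt ℝ ∞ (fun q : ℝ × ℝ => dn q.1 q.2) (h, t) :=
  (contDiffAt_jacobi hh t).snd.snd.snd.fst

theorem contDiffAt_ef (hh : 0 < h) (t : ℝ) : ContDiffAt ℝ ∞ (fun q : ℝ × ℝ => ef q.1 q.2) (h, t) :=
  (contDiffAt_jacobi hh t).snd.snd.snd.snd.fst

theorem contDiffAt_eg (hh : 0 < h) (t : ℝ) : ContDiffAt ℝ ∞ (fun q : ℝ × ℝ => eg q.1 q.2) (h, t) :=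
  (contDiffAt_jacobi hh t).snd.snd.snd.snd.snd

theorem sn_sq_add_cn_sq (hh : 0 < h) (t : ℝ) : sn h t ^ 2 + cn h t ^ 2 = 1 := by
  have := eq_of_hasDerivAt_zero (f := fun t => sn h t ^ 2 + cn h t ^ 2) (fun t =>
    (((hasDerivAt_sn hh t).pow 2).add ((hasDerivAt_cn hh t).pow 2)).congr_deriv (by simp; ring)) t 0
  simpa [sn_zero hh, cn_zero hh] using this

theorem dn_sq_add_sn_sq (hh : 0 < h) (t : ℝ) : dn h t ^ 2 + h * sn h t ^ 2 = 1 := by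
  have := eq_of_hasDerivAt_zero (f := fun t => dn h t ^ 2 + h * sn h t ^ 2) (fun t =>
    (((hasDerivAt_dn hh t).pow 2).add (((hasDerivAt_sn hh t).pow 2).const_mul h)).congr_deriv
      (by simp; ring)) t 0
  simpa [sn_zero hh, dn_zero hh] using this

theorem ef_mul_cn_add_eg_mul_dn (hh : 0 < h) (t : ℝ) :
    ef h t * cn h t + eg h t * dn h t = sn h t := by
  have := eq_of_hasDerivAt_zero (f := fun t => ef h t * cn h t + eg h t * dn h t - sn h t)
    (fun t => ((((hasDerivAt_ef hh t).mul (hasDerivAt_cn hh t)).add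
      ((hasDerivAt_eg hh t).mul (hasDerivAt_dn hh t))).sub (hasDerivAt_sn hh t)).congr_deriv
      (by ring)) t 0
  simpa [ef_zero hh, eg_zero hh, sn_zero hh, sub_eq_zero] using this

theorem one_sub_mul_ef (hh : 0 < h) (t : ℝ) :
    (1 - h) * ef h t = ee h t * dn h t - h * sn h t * cn h t := by
  rw [ee]
  linear_combination (-h * cn h t) * ef_mul_cn_add_eg_mul_dn hh t
    - ef h t * dn_sq_add_sn_sq hh t + h * ef h t * sn_sq_add_cn_sq hh t

theorem one_sub_mul_eg (hh : 0 < h) (t : ℝ) :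
    (1 - h) * eg h t = sn h t * dn h t - ee h t * cn h t := by
  rw [ee]
  linear_combination dn h t * ef_mul_cn_add_eg_mul_dn hh t
    - eg h t * dn_sq_add_sn_sq hh t + h * eg h t * sn_sq_add_cn_sq hh t

theorem abs_sn_le_one (hh : 0 < h) (t : ℝ) : |sn h t| ≤ 1 := by
  rw [← sq_le_one_iff_abs_le_one]
  linarith [sn_sq_add_cn_sq hh t, sq_nonneg (cn h t)]

theorem abs_cn_le_one (hh : 0 < h) (t : ℝ) : |cn h t| ≤ 1 := by
  rw [← sq_le_one_iff_abs_le_one]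
  linarith [sn_sq_add_cn_sq hh t, sq_nonneg (sn h t)]

theorem abs_dn_le_one (hh : 0 < h) (t : ℝ) : |dn h t| ≤ 1 := by
  rw [← sq_le_one_iff_abs_le_one]
  linarith [dn_sq_add_sn_sq hh t, mul_nonneg hh.le (sq_nonneg (sn h t))]

end Jacobi

/-! ### Derivatives with respect to the parameter -/

/-- Symmetry of second derivatives, read as the equation of variations. -/
theorem hasDerivAt_deriv_fst {E : Type*} [NormedAddCommGroup E] [NormedSpace ℝ E]
    {y y' : ℝ → ℝ → E} {h t : ℝ} {w : E}
    (hy : ContDiffAt ℝ 2 (fun q : ℝ × ℝ => y q.1 q.2) (h, t))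
    (hy' : ∀ᶠ h in 𝓝 h, HasDerivAt (y h) (y' h t) t) (hw : HasDerivAt (fun h => y' h t) w h) :
    HasDerivAt (fun t => deriv (fun h => y h t) h) w t := by
  have hfst : ∀ a b : ℝ, HasDerivAt (fun s => (s, b)) ((1 : ℝ), (0 : ℝ)) a := fun a b =>
    (hasDerivAt_id a).prodMk (hasDerivAt_const a b)
  have hsnd : ∀ a b : ℝ, HasDerivAt (fun s => (a, s)) ((0 : ℝ), (1 : ℝ)) b := fun a b =>
    (hasDerivAt_const b a).prodMk (hasDerivAt_id b)
  set D := fderiv ℝ fun q : ℝ × ℝ => y q.1 q.2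
  have hD : ∀ᶠ q in 𝓝 (h, t), HasFDerivAt (fun q : ℝ × ℝ => y q.1 q.2) (D q) q := by
    filter_upwards [hy.eventually (by simp)] with q hq
    exact (hq.differentiableAt two_ne_zero).hasFDerivAt
  obtain ⟨D', hD'⟩ : ∃ D', HasFDerivAt D D' (h, t) :=
    ((hy.fderiv_right (m := 1) (by norm_num)).differentiableAt one_ne_zero)
  have hsymm : D' (1, 0) (0, 1) = D' (0, 1) (1, 0) :=
    second_derivative_symmetric_of_eventually_of_real hD hD' (1, 0) (0, 1)
  have hderiv_fst : (fun s => deriv (fun h => y h s) h) =ᶠ[𝓝 t] fun s => D (h, s) (1, 0) := by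
    filter_upwards [(hsnd h t).continuousAt.eventually hD] with s hs
    exact (HasFDerivAt.comp_hasDerivAt (f := fun a => (a, s)) h hs (hfst h s)).deriv
  have hderiv_snd : (fun s => y' s t) =ᶠ[𝓝 h] fun s => D (s, t) (0, 1) := by
    filter_upwards [(hfst h t).continuousAt.eventually hD, hy'] with s hs hs'
    exact hs'.unique (HasFDerivAt.comp_hasDerivAt (f := fun a => (s, a)) t hs (hsnd s t))
  have hDfst : HasDerivAt (fun s => D (h, s) (1, 0)) (D' (0, 1) (1, 0)) t :=
    ((HasFDerivAt.comp_hasDerivAt (f := fun s => (h, s)) t hD' (hsnd h t)).clm_apply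
      (hasDerivAt_const t ((1 : ℝ), (0 : ℝ)))).congr_deriv (by simp)
  have hDsnd : HasDerivAt (fun s => D (s, t) (0, 1)) (D' (1, 0) (0, 1)) h :=
    ((HasFDerivAt.comp_hasDerivAt (f := fun s => (s, t)) h hD' (hfst h t)).clm_apply
      (hasDerivAt_const h ((0 : ℝ), (1 : ℝ)))).congr_deriv (by simp)
  rw [(hw.unique (hDsnd.congr_of_eventuallyEq hderiv_snd)).trans hsymm]
  exact hDfst.congr_of_eventuallyEq hderiv_fst

theorem hasDerivAt_fst_of_contDiffAt {E : Type*} [NormedAddCommGroup E] [NormedSpace ℝ E]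
    {y : ℝ → ℝ → E} {h t : ℝ} (hy : ContDiffAt ℝ 1 (fun q : ℝ × ℝ => y q.1 q.2) (h, t)) :
    HasDerivAt (fun h => y h t) (deriv (fun h => y h t) h) h := by
  have hpath : ContDiffAt ℝ 1 (fun s : ℝ => (s, t)) h := by fun_prop
  exact ((hy.comp h hpath).differentiableAt one_ne_zero).hasDerivAt

theorem eq_zero_of_hasDerivAt_mul {a b p q : ℝ → ℝ} {K : ℝ} (hp : ∀ t, |p t| ≤ K)
    (hq : ∀ t, |q t| ≤ K) (ha : ∀ t, HasDerivAt a (p t * b t) t)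
    (hb : ∀ t, HasDerivAt b (q t * a t) t) (ha0 : a 0 = 0) (hb0 : b 0 = 0) (t : ℝ) :
    a t = 0 ∧ b t = 0 := by
  have hmul : ∀ {r : ℝ}, |r| ≤ K → LipschitzWith K.toNNReal (r * ·) := fun hr =>
    LipschitzWith.of_dist_le_mul fun x y => by
      rw [Real.dist_eq, ← mul_sub, abs_mul, Real.coe_toNNReal _ ((abs_nonneg _).trans hr),
        Real.dist_eq]
      gcongr
  have hfield (t : ℝ) :
      LipschitzWith K.toNNReal fun x : ℝ × ℝ => (p t * x.2, q t * x.1) := by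
    simpa using ((hmul (hp t)).comp LipschitzWith.prod_snd).prodMk
      ((hmul (hq t)).comp LipschitzWith.prod_fst)
  have hsol := ODE_solution_unique_univ (t₀ := 0) (f := fun t => (a t, b t)) (g := fun _ => 0)
    (s := fun _ => univ) (fun t => (hfield t).lipschitzOnWith)
    (fun t => ⟨(ha t).prodMk (hb t), mem_univ _⟩)
    (fun t => ⟨(hasDerivAt_const t 0).congr_deriv (by ext <;> simp), mem_univ _⟩)
    (by simp [ha0, hb0])
  exact Prod.mk_eq_zero.1 (congrFun hsol t)

/-- The derivative of `sn` with respect to the parameter. -/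
def snParam (h t : ℝ) : ℝ := deriv (fun h => sn h t) h

/-- The derivative of `cn` with respect to the parameter. -/
def cnParam (h t : ℝ) : ℝ := deriv (fun h => cn h t) h

/-- The derivative of `dn` with respect to the parameter. -/
def dnParam (h t : ℝ) : ℝ := deriv (fun h => dn h t) h

/-- The derivative of `ef` with respect to the parameter. -/
def efParam (h t : ℝ) : ℝ := deriv (fun h => ef h t) h

/-- The derivative of `eg` with respect to the parameter. -/
def egParam (h t : ℝ) : ℝ := deriv (fun h => eg h t) h

section Param

variable {h : ℝ}

theorem hasDerivAt_sn_param (hh : 0 < h) (t : ℝ) : HasDerivAt (fun h => sn h t) (snParam h t) h :=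
  hasDerivAt_fst_of_contDiffAt ((contDiffAt_sn hh t).of_le (mod_cast le_top))

theorem hasDerivAt_cn_param (hh : 0 < h) (t : ℝ) : HasDerivAt (fun h => cn h t) (cnParam h t) h :=
  hasDerivAt_fst_of_contDiffAt ((contDiffAt_cn hh t).of_le (mod_cast le_top))

theorem hasDerivAt_dn_param (hh : 0 < h) (t : ℝ) : HasDerivAt (fun h => dn h t) (dnParam h t) h :=
  hasDerivAt_fst_of_contDiffAt ((contDiffAt_dn hh t).of_le (mod_cast le_top))

theorem hasDerivAt_ef_param (hh : 0 < h) (t : ℝ) : HasDerivAt (fun h => ef h t) (efParam h t) h :=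
  hasDerivAt_fst_of_contDiffAt ((contDiffAt_ef hh t).of_le (mod_cast le_top))

theorem hasDerivAt_eg_param (hh : 0 < h) (t : ℝ) : HasDerivAt (fun h => eg h t) (egParam h t) h :=
  hasDerivAt_fst_of_contDiffAt ((contDiffAt_eg hh t).of_le (mod_cast le_top))

theorem deriv_param_eq_zero (hh : 0 < h) {y : ℝ → ℝ} {a : ℝ} (hy : ∀ {h}, 0 < h → y h = a) :
    deriv y h = 0 := by
  have : y =ᶠ[𝓝 h] fun _ => a := (lt_mem_nhds hh).mono fun _ => hy
  rw [this.deriv_eq, deriv_const]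

theorem snParam_zero (hh : 0 < h) : snParam h 0 = 0 := deriv_param_eq_zero hh sn_zero
theorem dnParam_zero (hh : 0 < h) : dnParam h 0 = 0 := deriv_param_eq_zero hh dn_zero
theorem efParam_zero (hh : 0 < h) : efParam h 0 = 0 := deriv_param_eq_zero hh ef_zero
theorem egParam_zero (hh : 0 < h) : egParam h 0 = 0 := deriv_param_eq_zero hh eg_zero

theorem hasDerivAt_deriv_param (hh : 0 < h) {y y' : ℝ → ℝ → ℝ} {t w : ℝ}
    (hy : ContDiffAt ℝ ∞ (fun q : ℝ × ℝ => y q.1 q.2) (h, t))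
    (hy' : ∀ {h}, 0 < h → ∀ t, HasDerivAt (y h) (y' h t) t)
    (hw : HasDerivAt (fun h => y' h t) w h) :
    HasDerivAt (fun t => deriv (fun h => y h t) h) w t :=
  hasDerivAt_deriv_fst (hy.of_le (by norm_cast))
    ((lt_mem_nhds hh).mono fun _ hpos => hy' hpos t) hw

theorem hasDerivAt_snParam (hh : 0 < h) (t : ℝ) :
    HasDerivAt (snParam h) (cnParam h t * dn h t + cn h t * dnParam h t) t :=
  hasDerivAt_deriv_param hh (contDiffAt_sn hh t) hasDerivAt_sn
    ((hasDerivAt_cn_param hh t).mul (hasDerivAt_dn_param hh t))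

theorem hasDerivAt_cnParam (hh : 0 < h) (t : ℝ) :
    HasDerivAt (cnParam h) (-(snParam h t * dn h t + sn h t * dnParam h t)) t :=
  hasDerivAt_deriv_param hh (contDiffAt_cn hh t) hasDerivAt_cn
    ((hasDerivAt_sn_param hh t).mul (hasDerivAt_dn_param hh t)).neg

theorem hasDerivAt_dnParam (hh : 0 < h) (t : ℝ) : HasDerivAt (dnParam h)
    (-((1 * sn h t + h * snParam h t) * cn h t + h * sn h t * cnParam h t)) t :=
  hasDerivAt_deriv_param hh (contDiffAt_dn hh t) hasDerivAt_dn
    (((hasDerivAt_id h).mul (hasDerivAt_sn_param hh t)).mul (hasDerivAt_cn_param hh t)).neg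

theorem hasDerivAt_efParam (hh : 0 < h) (t : ℝ) : HasDerivAt (efParam h)
    (dnParam h t + ((1 * sn h t + h * snParam h t) * eg h t + h * sn h t * egParam h t)) t :=
  hasDerivAt_deriv_param hh (contDiffAt_ef hh t) hasDerivAt_ef
    ((hasDerivAt_dn_param hh t).add
      (((hasDerivAt_id h).mul (hasDerivAt_sn_param hh t)).mul (hasDerivAt_eg_param hh t)))

theorem hasDerivAt_egParam (hh : 0 < h) (t : ℝ) :
    HasDerivAt (egParam h) (snParam h t * ef h t + sn h t * efParam h t) t :=
  hasDerivAt_deriv_param hh (contDiffAt_eg hh t) hasDerivAt_eg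
    ((hasDerivAt_sn_param hh t).mul (hasDerivAt_ef_param hh t))

theorem sn_mul_snParam_add_cn_mul_cnParam (hh : 0 < h) (t : ℝ) :
    sn h t * snParam h t + cn h t * cnParam h t = 0 := by
  have hconst : HasDerivAt (fun h => sn h t ^ 2 + cn h t ^ 2) 0 h :=
    (hasDerivAt_const h 1).congr_of_eventuallyEq
      ((lt_mem_nhds hh).mono fun _ hpos => sn_sq_add_cn_sq hpos t)
  have := hconst.unique (((hasDerivAt_sn_param hh t).pow 2).add ((hasDerivAt_cn_param hh t).pow 2))
  norm_num at this
  linarith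

/-- By `sn ^ 2 + cn ^ 2 = 1`, the parameter derivatives of `sn` and `cn` are those of
`sin` and `cos` of an angle, whose derivative is `u = cn * snParam - sn * cnParam`. The deviations
of `u` and `dnParam` from their asserted values solve a homogeneous linear system. -/
theorem two_mul_phase_param (hh : 0 < h) (t : ℝ) :
    2 * h * (cn h t * snParam h t - sn h t * cnParam h t) = t * dn h t - ef h t ∧
      2 * dnParam h t = -(sn h t * (eg h t + t * cn h t)) := by
  have hS := hasDerivAt_sn hh
  have hC := hasDerivAt_cn hh
  have hp := fun s => sn_mul_snParam_add_cn_mul_cnParam hh s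
  set w := fun s => 2 * h * (cn h s * snParam h s - sn h s * cnParam h s) -
    (s * dn h s - ef h s) with hw
  set v := fun s => 2 * dnParam h s + sn h s * (eg h s + s * cn h s) with hv
  have hw' : ∀ s, HasDerivAt w (h * v s) s := fun s => by
    refine (((((hC s).mul (hasDerivAt_snParam hh s)).sub
      ((hS s).mul (hasDerivAt_cnParam hh s))).const_mul (2 * h)).sub
      (((hasDerivAt_id s).mul (hasDerivAt_dn hh s)).sub (hasDerivAt_ef hh s))).congr_deriv ?_
    simp only [id, hv]
    linear_combination 2 * h * dnParam h s * sn_sq_add_cn_sq hh s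
  have hv' : ∀ s, HasDerivAt v ((sn h s ^ 2 - cn h s ^ 2) * w s) s := fun s => by
    refine (((hasDerivAt_dnParam hh s).const_mul 2).add ((hS s).mul
      ((hasDerivAt_eg hh s).add ((hasDerivAt_id s).mul (hC s))))).congr_deriv ?_
    simp only [Pi.add_apply, Pi.mul_apply, id, hw]
    linear_combination (cn h s * ef_mul_cn_add_eg_mul_dn hh s - 4 * h * sn h s * cn h s * hp s +
      2 * h * (cn h s * snParam h s + sn h s * cnParam h s) * sn_sq_add_cn_sq hh s)
  have hbound : ∀ s, |sn h s ^ 2 - cn h s ^ 2| ≤ h + 1 := fun s => by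
    have := sn_sq_add_cn_sq hh s
    rw [abs_le]
    constructor <;> nlinarith [sq_nonneg (sn h s), sq_nonneg (cn h s)]
  obtain ⟨hwt, hvt⟩ := eq_zero_of_hasDerivAt_mul (p := fun _ => h)
    (fun _ => by rw [abs_of_pos hh]; linarith) hbound hw' hv'
    (by simp [hw, sn_zero hh, ef_zero hh, snParam_zero hh])
    (by simp [hv, sn_zero hh, dnParam_zero hh]) t
  exact ⟨sub_eq_zero.1 hwt, eq_neg_of_add_eq_zero_left hvt⟩

theorem two_mul_snParam (hh : 0 < h) (t : ℝ) :
    2 * h * snParam h t = cn h t * (t * dn h t - ef h t) := by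
  linear_combination cn h t * (two_mul_phase_param hh t).1 -
    2 * h * snParam h t * sn_sq_add_cn_sq hh t +
    2 * h * sn h t * sn_mul_snParam_add_cn_mul_cnParam hh t

theorem two_mul_dnParam (hh : 0 < h) (t : ℝ) :
    2 * dnParam h t = -(sn h t * (eg h t + t * cn h t)) :=
  (two_mul_phase_param hh t).2

theorem two_mul_efParam_and_egParam (hh : 0 < h) (t : ℝ) :
    2 * h * (1 - h) * efParam h t = h * ef h t - h * eg h t * cn h t * dn h t - t * dn h t
      - h * sn h t * eg h t * ee h t + (1 - h) * t * (dn h t + h * sn h t * eg h t) ∧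
    2 * h * (1 - h) * egParam h t = h * eg h t - cn h t * dn h t * ef h t + t * cn h t
      - sn h t * ef h t * ee h t + (1 - h) * t * (sn h t * ef h t) := by
  have hS := hasDerivAt_sn hh
  have hC := hasDerivAt_cn hh
  have hD := hasDerivAt_dn hh
  have hf := hasDerivAt_ef hh
  have hg := hasDerivAt_eg hh
  have hE := hasDerivAt_ee hh
  set a := fun s => 2 * h * (1 - h) * efParam h s - (h * ef h s - h * eg h s * cn h s * dn h s
      - s * dn h s - h * sn h s * eg h s * ee h s
      + (1 - h) * s * (dn h s + h * sn h s * eg h s)) with ha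
  set b := fun s => 2 * h * (1 - h) * egParam h s - (h * eg h s - cn h s * dn h s * ef h s
      + s * cn h s - sn h s * ef h s * ee h s + (1 - h) * s * (sn h s * ef h s)) with hb
  have ha' : ∀ s, HasDerivAt a (h * sn h s * b s) s := fun s => by
    refine (((hasDerivAt_efParam hh s).const_mul (2 * h * (1 - h))).sub
      (((((((hf s).const_mul h).sub ((((hg s).const_mul h).mul (hC s)).mul (hD s))).sub
        ((hasDerivAt_id s).mul (hD s))).sub ((((hS s).const_mul h).mul (hg s)).mul (hE s))).add
        (((hasDerivAt_id s).const_mul (1 - h)).mul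
          ((hD s).add (((hS s).const_mul h).mul (hg s))))))).congr_deriv ?_
    simp only [Pi.mul_apply, Pi.add_apply, id, hb]
    linear_combination h * (1 - h) * two_mul_dnParam hh s
      + h * (1 - h) * eg h s * two_mul_snParam hh s - h * cn h s * eg h s * one_sub_mul_ef hh s
  have hb' : ∀ s, HasDerivAt b (sn h s * a s) s := fun s => by
    refine (((hasDerivAt_egParam hh s).const_mul (2 * h * (1 - h))).sub
      (((((((hg s).const_mul h).sub (((hC s).mul (hD s)).mul (hf s))).add
        ((hasDerivAt_id s).mul (hC s))).sub (((hS s).mul (hf s)).mul (hE s))).add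
        (((hasDerivAt_id s).const_mul (1 - h)).mul ((hS s).mul (hf s)))))).congr_deriv ?_
    simp only [Pi.mul_apply, id, ha]
    linear_combination (1 - h) * ef h s * two_mul_snParam hh s
      - (cn h s * ef h s + sn h s) * one_sub_mul_ef hh s + cn h s * dn_sq_add_sn_sq hh s
  obtain ⟨hat, hbt⟩ := eq_zero_of_hasDerivAt_mul (K := h + 1)
    (fun s => by rw [abs_mul, abs_of_pos hh]; nlinarith [abs_sn_le_one hh s])
    (fun s => (abs_sn_le_one hh s).trans (by linarith)) ha' hb'
    (by simp [ha, efParam_zero hh, eg_zero hh, ef_zero hh, sn_zero hh])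
    (by simp [hb, egParam_zero hh, eg_zero hh, ef_zero hh, sn_zero hh]) t
  exact ⟨sub_eq_zero.1 hat, sub_eq_zero.1 hbt⟩

theorem two_mul_efParam (hh : 0 < h) (t : ℝ) :
    2 * h * (1 - h) * efParam h t = h * ef h t - h * eg h t * cn h t * dn h t - t * dn h t
      - h * sn h t * eg h t * ee h t + (1 - h) * t * (dn h t + h * sn h t * eg h t) :=
  (two_mul_efParam_and_egParam hh t).1

theorem two_mul_egParam (hh : 0 < h) (t : ℝ) :
    2 * h * (1 - h) * egParam h t = h * eg h t - cn h t * dn h t * ef h t + t * cn h t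
      - sn h t * ef h t * ee h t + (1 - h) * t * (sn h t * ef h t) :=
  (two_mul_efParam_and_egParam hh t).2

end Param

/-! ### Signs before the first zero of `sn` -/

theorem le_of_hasDerivAt_nonneg {f f' : ℝ → ℝ} {a b : ℝ} (hab : a ≤ b)
    (hc : ContinuousOn f (Icc a b)) (hf : ∀ s ∈ Ioo a b, HasDerivAt f (f' s) s)
    (hnonneg : ∀ s ∈ Ioo a b, 0 ≤ f' s) : f a ≤ f b :=
  monotoneOn_of_hasDerivWithinAt_nonneg (convex_Icc a b) hc
    (by simpa only [interior_Icc] using fun s hs => (hf s hs).hasDerivWithinAt)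
    (by simpa only [interior_Icc] using hnonneg) (left_mem_Icc.2 hab) (right_mem_Icc.2 hab) hab

theorem lt_of_hasDerivAt_pos {f f' : ℝ → ℝ} {a b : ℝ} (hab : a < b)
    (hf : ∀ s ∈ Icc a b, HasDerivAt f (f' s) s) (hpos : ∀ s ∈ Ioo a b, 0 < f' s) : f a < f b :=
  strictMonoOn_of_hasDerivWithinAt_pos (convex_Icc a b)
    (fun s hs => (hf s hs).continuousAt.continuousWithinAt)
    (by simpa only [interior_Icc] using
      fun s hs => (hf s (Ioo_subset_Icc_self hs)).hasDerivWithinAt)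
    (by simpa only [interior_Icc] using hpos) (left_mem_Icc.2 hab.le) (right_mem_Icc.2 hab.le) hab

theorem pos_of_continuous_of_ne_zero {X : Type*} [TopologicalSpace X] [PreconnectedSpace X]
    {f : X → ℝ} (hf : Continuous f) (hne : ∀ x, f x ≠ 0) {a : X} (ha : 0 < f a) (x : X) :
    0 < f x := by
  by_contra! hle
  obtain ⟨y, hy⟩ := mem_range_of_exists_le_of_exists_ge hf ⟨x, hle⟩ ⟨a, ha.le⟩
  exact hne y hy

theorem continuousAt_div_of_hasDerivAt_zero {f g : ℝ → ℝ} {a β : ℝ} (hf : HasDerivAt f 0 a)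
    (hg : HasDerivAt g β a) (hfa : f a = 0) (hga : g a = 0) (hβ : β ≠ 0) :
    ContinuousAt (fun s => f s / g s) a := by
  rw [continuousAt_iff_punctured_nhds, hfa, zero_div, ← zero_div β]
  refine ((hasDerivAt_iff_tendsto_slope.1 hf).div
    (hasDerivAt_iff_tendsto_slope.1 hg) hβ).congr' ?_
  filter_upwards [self_mem_nhdsWithin] with s hs
  have hsa : s - a ≠ 0 := sub_ne_zero.2 hs
  simp only [slope_def_field, hfa, hga, sub_zero, Pi.div_apply]
  field_simp

section Sign

variable {h t : ℝ}

theorem dn_pos_of_le_one (hh : 0 < h) (hh1 : h ≤ 1) (t : ℝ) : 0 < dn h t := by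
  refine pos_of_continuous_of_ne_zero (continuous_of_hasDerivAt (hasDerivAt_dn hh))
    (fun s hs => ?_) (dn_zero hh ▸ one_pos) t
  have hunit := sn_sq_add_cn_sq hh s
  have henergy := dn_sq_add_sn_sq hh s
  have hwronskian := ef_mul_cn_add_eg_mul_dn hh s
  rw [hs] at henergy hwronskian
  have hcn : cn h s = 0 := sq_eq_zero_iff.1 (by nlinarith [sq_nonneg (cn h s)])
  simp only [hcn, mul_zero, add_zero] at hunit hwronskian
  simp [← hwronskian] at hunit

theorem cn_pos_of_one_le (hh1 : 1 ≤ h) (t : ℝ) : 0 < cn h t := by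
  have hh : 0 < h := one_pos.trans_le hh1
  refine pos_of_continuous_of_ne_zero (continuous_of_hasDerivAt (hasDerivAt_cn hh))
    (fun s hs => ?_) (cn_zero hh ▸ one_pos) t
  have hunit := sn_sq_add_cn_sq hh s
  have henergy := dn_sq_add_sn_sq hh s
  have hwronskian := ef_mul_cn_add_eg_mul_dn hh s
  rw [hs] at hunit hwronskian
  have hdn : dn h s = 0 := sq_eq_zero_iff.1 (by nlinarith [sq_nonneg (dn h s)])
  simp only [hdn, mul_zero, add_zero] at hwronskian
  simp [← hwronskian] at hunit

theorem one_sub_mul_le_ee (hh : 0 < h) (ht : 0 ≤ t) : (1 - h) * t ≤ ee h t := by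
  have hmono := le_of_hasDerivAt_nonneg (f := fun s => ee h s - (1 - h) * s) ht
    ((continuous_of_hasDerivAt (hasDerivAt_ee hh)).sub (by fun_prop)).continuousOn
    (fun s _ => (hasDerivAt_ee hh s).sub ((hasDerivAt_id s).const_mul (1 - h)))
    (fun s _ => by
      have hderiv : dn h s ^ 2 - (1 - h) * 1 = h * cn h s ^ 2 := by
        linear_combination dn_sq_add_sn_sq hh s - h * sn_sq_add_cn_sq hh s
      rw [hderiv]
      positivity)
  simpa [ee_zero hh] using hmono

theorem ee_monotone (hh : 0 < h) : Monotone (ee h) :=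
  monotone_of_hasDerivAt_nonneg (hasDerivAt_ee hh) fun _ => sq_nonneg _

theorem ee_pos (hh : 0 < h) (ht : 0 < t) : 0 < ee h t := by
  have hdn := (continuous_of_hasDerivAt (hasDerivAt_dn hh)).tendsto 0
  rw [dn_zero hh] at hdn
  obtain ⟨δ, hδ, hdn_pos⟩ :=
    Metric.eventually_nhds_iff.1 (hdn.eventually (lt_mem_nhds one_pos))
  have hs : 0 < min δ t := lt_min hδ ht
  refine lt_of_lt_of_le ?_ (ee_monotone hh (min_le_right δ t))
  rw [← ee_zero hh]
  refine lt_of_hasDerivAt_pos hs (fun r _ => hasDerivAt_ee hh r) fun r hr => ?_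
  have := hdn_pos (y := r) (by
    rw [Real.dist_eq, sub_zero, abs_of_pos hr.1]
    exact hr.2.trans_le (min_le_left _ _))
  positivity

theorem ee_sq_sub_nonneg (hh : 0 < h) (ht : 0 < t) :
    0 ≤ ee h t ^ 2 - h * sn h t ^ 2 - (1 - h) * t * ee h t := by
  set f := fun s => ee h s - (1 - h) * s - h * (sn h s ^ 2 / ee h s) with hf
  have hderiv : ∀ s, 0 < s →
      HasDerivAt f (h * (cn h s - sn h s * dn h s / ee h s) ^ 2) s := fun s hs => by
    have hne := (ee_pos hh hs).ne'
    refine (((hasDerivAt_ee hh s).sub ((hasDerivAt_id s).const_mul (1 - h))).sub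
      ((((hasDerivAt_sn hh s).pow 2).div (hasDerivAt_ee hh s) hne).const_mul h)).congr_deriv ?_
    simp only [Pi.pow_apply]
    field_simp
    push_cast
    linear_combination ee h s ^ 2 * dn_sq_add_sn_sq hh s - h * ee h s ^ 2 * sn_sq_add_cn_sq hh s
  have hcont_zero : ContinuousAt f 0 := by
    refine ((continuous_of_hasDerivAt (hasDerivAt_ee hh)).continuousAt.sub
      (by fun_prop)).sub (continuousAt_const.mul ?_)
    exact continuousAt_div_of_hasDerivAt_zero (f := fun s => sn h s ^ 2) (β := 1)
      (((hasDerivAt_sn hh 0).pow 2).congr_deriv (by simp [sn_zero hh]))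
      ((hasDerivAt_ee hh 0).congr_deriv (by simp [dn_zero hh])) (by simp [sn_zero hh])
      (ee_zero hh) one_ne_zero
  have hf_nonneg : f 0 ≤ f t := by
    refine le_of_hasDerivAt_nonneg ht.le (fun s hs => ContinuousAt.continuousWithinAt ?_)
      (fun s hs => hderiv s hs.1) (fun s _ => by positivity)
    rcases hs.1.eq_or_lt with rfl | hs
    exacts [hcont_zero, (hderiv s hs).continuousAt]
  have hee := ee_pos hh ht
  calc 0 ≤ f t * ee h t :=
        mul_nonneg (by simpa [hf, ee_zero hh, sn_zero hh] using hf_nonneg) hee.le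
    _ = ee h t ^ 2 - h * sn h t ^ 2 - (1 - h) * t * ee h t := by
        simp only [hf]
        field_simp
        ring

theorem hasDerivAt_ef_div_dn (hh : 0 < h) (hdn : dn h t ≠ 0) :
    HasDerivAt (fun s => ef h s / dn h s) (1 / dn h t ^ 2) t := by
  refine ((hasDerivAt_ef hh t).div (hasDerivAt_dn hh t) hdn).congr_deriv ?_
  field_simp
  linear_combination dn_sq_add_sn_sq hh t + h * sn h t * ef_mul_cn_add_eg_mul_dn hh t

theorem hasDerivAt_eg_div_cn (hh : 0 < h) (hcn : cn h t ≠ 0) :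
    HasDerivAt (fun s => eg h s / cn h s) (sn h t ^ 2 / cn h t ^ 2) t := by
  refine ((hasDerivAt_eg hh t).div (hasDerivAt_cn hh t) hcn).congr_deriv ?_
  field_simp
  linear_combination sn h t * ef_mul_cn_add_eg_mul_dn hh t

/-- The time `t` is positive and precedes the first positive zero of `sn h`; for the extremal with
midpoint parameter `h` this says that `2 * t` is below its first Maxwell time. -/
structure BeforeZero (h t : ℝ) : Prop where
  param_pos : 0 < h
  time_pos : 0 < t
  sn_pos : ∀ s ∈ Ioc 0 t, 0 < sn h s

namespace BeforeZero

theorem mono (H : BeforeZero h t) {s : ℝ} (hs : s ∈ Ioc 0 t) : BeforeZero h s :=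
  ⟨H.param_pos, hs.1, fun r hr => H.sn_pos r ⟨hr.1, hr.2.trans hs.2⟩⟩

theorem sn_time_pos (H : BeforeZero h t) : 0 < sn h t := H.sn_pos t ⟨H.time_pos, le_rfl⟩

theorem sn_nonneg (H : BeforeZero h t) {s : ℝ} (hs : s ∈ Icc 0 t) : 0 ≤ sn h s := by
  rcases hs.1.eq_or_lt with rfl | hs0
  · exact (sn_zero H.param_pos).ge
  · exact (H.sn_pos s ⟨hs0, hs.2⟩).le

theorem ef_pos_of_dn_pos (H : BeforeZero h t) (hdn : ∀ s ∈ Icc 0 t, 0 < dn h s) :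
    0 < ef h t := by
  have hlt := lt_of_hasDerivAt_pos H.time_pos
    (fun s hs => hasDerivAt_ef_div_dn H.param_pos (hdn s hs).ne') fun s hs => by
      have := hdn s (Ioo_subset_Icc_self hs)
      positivity
  simp only [ef_zero H.param_pos, zero_div] at hlt
  exact (div_pos_iff_of_pos_right (hdn t ⟨H.time_pos.le, le_rfl⟩)).1 hlt

theorem dn_antitoneOn (H : BeforeZero h t) (hh1 : 1 ≤ h) : AntitoneOn (dn h) (Icc 0 t) := by
  refine antitoneOn_of_hasDerivWithinAt_nonpos (convex_Icc 0 t)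
    (continuous_of_hasDerivAt (hasDerivAt_dn H.param_pos)).continuousOn
    (fun s _ => (hasDerivAt_dn H.param_pos s).hasDerivWithinAt) fun s hs => ?_
  have := H.sn_nonneg (interior_subset hs)
  have := cn_pos_of_one_le hh1 s
  have := H.param_pos
  exact neg_nonpos.2 (by positivity)

theorem cn_antitoneOn (H : BeforeZero h t) (hh1 : h ≤ 1) : AntitoneOn (cn h) (Icc 0 t) := by
  refine antitoneOn_of_hasDerivWithinAt_nonpos (convex_Icc 0 t)
    (continuous_of_hasDerivAt (hasDerivAt_cn H.param_pos)).continuousOn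
    (fun s _ => (hasDerivAt_cn H.param_pos s).hasDerivWithinAt) fun s hs => ?_
  have := H.sn_nonneg (interior_subset hs)
  have := dn_pos_of_le_one H.param_pos hh1 s
  exact neg_nonpos.2 (by positivity)

theorem dn_pos_of_dn_time_pos (H : BeforeZero h t) (hh1 : 1 ≤ h) (hdn : 0 < dn h t) {s : ℝ}
    (hs : s ∈ Icc 0 t) : 0 < dn h s :=
  hdn.trans_le (H.dn_antitoneOn hh1 hs (right_mem_Icc.2 H.time_pos.le) hs.2)

theorem eg_pos (H : BeforeZero h t) : 0 < eg h t := by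
  rcases le_total h 1 with hh1 | hh1
  · rw [← eg_zero H.param_pos]
    refine lt_of_hasDerivAt_pos H.time_pos (fun s _ => hasDerivAt_eg H.param_pos s) fun s hs => ?_
    have Hs := H.mono (Ioo_subset_Ioc_self hs)
    exact mul_pos Hs.sn_time_pos
      (Hs.ef_pos_of_dn_pos fun r _ => dn_pos_of_le_one H.param_pos hh1 r)
  · have hcn := cn_pos_of_one_le hh1
    have hlt := lt_of_hasDerivAt_pos H.time_pos
      (fun s _ => hasDerivAt_eg_div_cn H.param_pos (hcn s).ne') fun s hs => by
        have := hcn s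
        have := H.sn_pos s (Ioo_subset_Ioc_self hs)
        positivity
    simp only [eg_zero H.param_pos, zero_div] at hlt
    exact (div_pos_iff_of_pos_right (hcn t)).1 hlt

theorem ef_pos (H : BeforeZero h t) : 0 < ef h t := by
  rcases le_total h 1 with hh1 | hh1
  · exact H.ef_pos_of_dn_pos fun s _ => dn_pos_of_le_one H.param_pos hh1 s
  rcases le_or_gt (dn h t) 0 with hdn | hdn
  · have : 0 < ef h t * cn h t := by
      nlinarith [ef_mul_cn_add_eg_mul_dn H.param_pos t, H.sn_time_pos, H.eg_pos]
    exact (mul_pos_iff_of_pos_right (cn_pos_of_one_le hh1 t)).1 this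
  · exact H.ef_pos_of_dn_pos fun s => H.dn_pos_of_dn_time_pos hh1 hdn

theorem ef_sub_mul_dn_pos (H : BeforeZero h t) (hh1 : 1 ≤ h) : 0 < ef h t - t * dn h t := by
  rcases le_or_gt (dn h t) 0 with hdn | hdn
  · nlinarith [H.ef_pos, H.time_pos]
  have hdn' := fun s => H.dn_pos_of_dn_time_pos hh1 hdn (s := s)
  have hlt := lt_of_hasDerivAt_pos (f := fun s => ef h s / dn h s - s) H.time_pos
    (fun s hs => (hasDerivAt_ef_div_dn H.param_pos (hdn' s hs).ne').sub (hasDerivAt_id s))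
    fun s hs => by
      have hdns := hdn' s (Ioo_subset_Icc_self hs)
      have hsn := H.sn_pos s (Ioo_subset_Ioc_self hs)
      rw [sub_pos, lt_div_iff₀ (by positivity), one_mul]
      nlinarith [dn_sq_add_sn_sq H.param_pos s, pow_pos hsn 2]
  rw [ef_zero H.param_pos, zero_div, sub_zero, sub_pos, lt_div_iff₀ hdn] at hlt
  exact sub_pos.2 hlt

theorem eg_add_mul_cn_pos (H : BeforeZero h t) (hh1 : h < 1) : 0 < eg h t + t * cn h t := by
  rcases le_or_gt 0 (cn h t) with hcn | hcn
  · have := H.eg_pos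
    have := H.time_pos
    positivity
  · have hsn_dn := mul_pos H.sn_time_pos (dn_pos_of_le_one H.param_pos hh1.le t)
    have : 0 < (1 - h) * (eg h t + t * cn h t) := by
      nlinarith [one_sub_mul_eg H.param_pos t, one_sub_mul_le_ee H.param_pos H.time_pos.le]
    exact (mul_pos_iff_of_pos_left (sub_pos.2 hh1)).1 this

end BeforeZero

end Sign

section Ez

variable {h t : ℝ}

/-- The factor `sn E + cn dn`, where `E = ee` is the elliptic integral of the second kind, through
which the Jacobian of the exponential map is expressed at `sin θ = 0`. -/
def ez (h t : ℝ) : ℝ := sn h t * ee h t + cn h t * dn h t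

theorem ez_zero (hh : 0 < h) : ez h 0 = 1 := by simp [ez, sn_zero hh, cn_zero hh, dn_zero hh]

theorem hasDerivAt_ez (hh : 0 < h) (t : ℝ) :
    HasDerivAt (ez h) ((1 - h) * (cn h t * ef h t)) t := by
  refine (((hasDerivAt_sn hh t).mul (hasDerivAt_ee hh t)).add
    ((hasDerivAt_cn hh t).mul (hasDerivAt_dn hh t))).congr_deriv ?_
  linear_combination (-cn h t) * one_sub_mul_ef hh t

theorem sn_mul_ee_le_one_add_ez (hh : 0 < h) (t : ℝ) : sn h t * ee h t ≤ 1 + ez h t := by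
  have habs : |cn h t * dn h t| ≤ 1 := by
    rw [abs_mul]
    exact mul_le_one₀ (abs_cn_le_one hh t) (abs_nonneg _) (abs_dn_le_one hh t)
  rw [ez]
  linarith [neg_le_of_abs_le habs]

theorem hasDerivAt_one_sub_ez_sq_div (hh : 0 < h) (hsn : sn h t ≠ 0) (hez : ez h t ≠ 0) :
    HasDerivAt (fun s => (1 - ez h s ^ 2) / (sn h s * ez h s) + (1 - h) * s)
      (((1 - h) * ef h t / ez h t) ^ 2) t := by
  have hprod := mul_ne_zero hsn hez
  refine (((((hasDerivAt_ez hh t).pow 2).const_sub 1).div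
    ((hasDerivAt_sn hh t).mul (hasDerivAt_ez hh t)) hprod).add
    ((hasDerivAt_id t).const_mul (1 - h))).congr_deriv ?_
  have hsn_ef : sn h t * ((1 - h) * ef h t) = ez h t * dn h t - cn h t := by
    rw [ez]
    linear_combination sn h t * one_sub_mul_ef hh t - cn h t * dn_sq_add_sn_sq hh t
  have hsquare : ((1 - h) * ef h t / ez h t) ^ 2 =
      (sn h t * ((1 - h) * ef h t)) ^ 2 / (sn h t * ez h t) ^ 2 := by field_simp
  simp only [Pi.pow_apply, Pi.mul_apply]
  rw [hsquare, div_add' _ _ _ (pow_ne_zero 2 hprod)]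
  congr 1
  push_cast
  linear_combination (-(1 + ez h t ^ 2) * cn h t -
    (sn h t * ((1 - h) * ef h t) + ez h t * dn h t - cn h t)) * hsn_ef +
    ez h t ^ 2 * sn_sq_add_cn_sq hh t - ez h t ^ 2 * dn_sq_add_sn_sq hh t

namespace BeforeZero

theorem ez_pos_of_ez_time_pos (H : BeforeZero h t) (hez : 0 < ez h t) {s : ℝ}
    (hs : s ∈ Icc 0 t) : 0 < ez h s := by
  have hcont := continuous_of_hasDerivAt (hasDerivAt_ez H.param_pos)
  have hef : ∀ r ∈ Ioc 0 t, 0 < ef h r := fun r hr => (H.mono hr).ef_pos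
  by_cases hincr : h ≤ 1 ∧ 0 ≤ cn h s
  · have hle : ez h 0 ≤ ez h s := le_of_hasDerivAt_nonneg hs.1 hcont.continuousOn
      (fun r _ => hasDerivAt_ez H.param_pos r) fun r hr => by
        have hr' : r ∈ Icc 0 t := ⟨hr.1.le, hr.2.le.trans hs.2⟩
        exact mul_nonneg (sub_nonneg.2 hincr.1)
          (mul_nonneg (hincr.2.trans (H.cn_antitoneOn hincr.1 hr' hs hr.2.le))
            (hef r ⟨hr.1, hr'.2⟩).le)
    rw [ez_zero H.param_pos] at hle
    exact one_pos.trans_le hle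
  · have hderiv : ∀ r ∈ Ioo s t, (1 - h) * (cn h r * ef h r) ≤ 0 := fun r hr => by
      have hefr := hef r ⟨hs.1.trans_lt hr.1, hr.2.le⟩
      rcases le_total h 1 with hh1 | hh1
      · have hcns : cn h s < 0 := not_le.1 fun hcns => hincr ⟨hh1, hcns⟩
        have hcnr : cn h r ≤ cn h s :=
          H.cn_antitoneOn hh1 hs ⟨hs.1.trans hr.1.le, hr.2.le⟩ hr.1.le
        exact mul_nonpos_of_nonneg_of_nonpos (sub_nonneg.2 hh1)
          (mul_nonpos_of_nonpos_of_nonneg (hcnr.trans hcns.le) hefr.le)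
      · exact mul_nonpos_of_nonpos_of_nonneg (sub_nonpos.2 hh1)
          (mul_nonneg (cn_pos_of_one_le hh1 r).le hefr.le)
    have hle : -ez h s ≤ -ez h t := le_of_hasDerivAt_nonneg (f := fun s => -ez h s) hs.2
      hcont.neg.continuousOn (fun r _ => (hasDerivAt_ez H.param_pos r).neg)
      fun r hr => neg_nonneg.2 (hderiv r hr)
    exact hez.trans_le (neg_le_neg_iff.1 hle)

theorem one_sub_ez_sq_nonneg_of_pos (H : BeforeZero h t) (hez : 0 < ez h t) :
    0 ≤ 1 - ez h t ^ 2 + (1 - h) * t * (sn h t * ez h t) := by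
  have hh := H.param_pos
  set f := fun s => (1 - ez h s ^ 2) / (sn h s * ez h s) + (1 - h) * s with hf
  have hderiv : ∀ s ∈ Ioc 0 t, HasDerivAt f (((1 - h) * ef h s / ez h s) ^ 2) s := fun s hs =>
    hasDerivAt_one_sub_ez_sq_div hh (H.sn_pos s hs).ne'
      (H.ez_pos_of_ez_time_pos hez (Ioc_subset_Icc_self hs)).ne'
  have hcont_zero : ContinuousAt f 0 := by
    refine ContinuousAt.add ?_ (by fun_prop)
    exact continuousAt_div_of_hasDerivAt_zero (f := fun s => 1 - ez h s ^ 2)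
      (g := fun s => sn h s * ez h s) (β := 1)
      ((((hasDerivAt_ez hh 0).pow 2).const_sub 1).congr_deriv (by simp [ef_zero hh]))
      (((hasDerivAt_sn hh 0).mul (hasDerivAt_ez hh 0)).congr_deriv
        (by simp [ez_zero hh, sn_zero hh, cn_zero hh, dn_zero hh]))
      (by simp [ez_zero hh]) (by simp [sn_zero hh]) one_ne_zero
  have hf_nonneg : f 0 ≤ f t := by
    refine le_of_hasDerivAt_nonneg H.time_pos.le (fun s hs => ContinuousAt.continuousWithinAt ?_)
      (fun s hs => hderiv s (Ioo_subset_Ioc_self hs)) (fun s _ => sq_nonneg _)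
    rcases hs.1.eq_or_lt with rfl | hs0
    exacts [hcont_zero, (hderiv s ⟨hs0, hs.2⟩).continuousAt]
  have hsn := H.sn_time_pos
  calc 0 ≤ f t * (sn h t * ez h t) :=
        mul_nonneg (by simpa [hf, sn_zero hh] using hf_nonneg) (mul_pos hsn hez).le
    _ = 1 - ez h t ^ 2 + (1 - h) * t * (sn h t * ez h t) := by
        simp only [hf]
        field_simp

theorem one_sub_ez_sq_nonneg (H : BeforeZero h t) :
    0 ≤ 1 - ez h t ^ 2 + (1 - h) * t * (sn h t * ez h t) := by
  rcases le_or_gt (ez h t) 0 with hez | hez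
  · have hsn := H.sn_time_pos
    have hle := sn_mul_ee_le_one_add_ez H.param_pos t
    have hle' : sn h t * ((1 - h) * t) ≤ 1 + ez h t :=
      (mul_le_mul_of_nonneg_left (one_sub_mul_le_ee H.param_pos H.time_pos.le) hsn.le).trans hle
    have hnonneg : 0 ≤ 1 + ez h t := (mul_pos hsn (ee_pos H.param_pos H.time_pos)).le.trans hle
    nlinarith [mul_nonneg (neg_nonneg.2 hez) (sub_nonneg.2 hle')]
  · exact H.one_sub_ez_sq_nonneg_of_pos hez

end BeforeZero

theorem eventually_sn_pos_nhds_zero (hh : 0 < h) :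
    ∀ᶠ q : ℝ × ℝ in 𝓝 (h, 0), 0 < q.2 → 0 < sn q.1 q.2 := by
  have hcn : ∀ᶠ q : ℝ × ℝ in 𝓝 (h, 0), 0 < cn q.1 q.2 :=
    (contDiffAt_cn hh 0).continuousAt.eventually (lt_mem_nhds (by simp [cn_zero hh]))
  have hdn : ∀ᶠ q : ℝ × ℝ in 𝓝 (h, 0), 0 < dn q.1 q.2 :=
    (contDiffAt_dn hh 0).continuousAt.eventually (lt_mem_nhds (by simp [dn_zero hh]))
  have hparam : ∀ᶠ q : ℝ × ℝ in 𝓝 (h, 0), 0 < q.1 := continuousAt_fst.eventually (lt_mem_nhds hh)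
  obtain ⟨δ, hδ, hball⟩ := Metric.eventually_nhds_iff.1 (hcn.and (hdn.and hparam))
  refine Metric.eventually_nhds_iff.2 ⟨δ, hδ, fun q hq hpos => ?_⟩
  have hq1 : 0 < q.1 := (hball hq).2.2
  rw [Prod.dist_eq, max_lt_iff, Real.dist_0_eq_abs, abs_of_pos hpos] at hq
  rw [← sn_zero hq1]
  refine lt_of_hasDerivAt_pos hpos (fun s _ => hasDerivAt_sn hq1 s) fun s hs => ?_
  have hs_ball : dist (q.1, s) (h, 0) < δ := by
    rw [Prod.dist_eq, max_lt_iff, Real.dist_0_eq_abs, abs_of_pos hs.1]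
    exact ⟨hq.1, hs.2.trans hq.2⟩
  exact mul_pos (hball hs_ball).1 (hball hs_ball).2.1

theorem BeforeZero.eventually (H : BeforeZero h t) :
    ∀ᶠ q : ℝ × ℝ in 𝓝 (h, t), BeforeZero q.1 q.2 := by
  have hlocal : ∀ r ∈ Icc (0 : ℝ) 1, ∀ᶠ z : (ℝ × ℝ) × ℝ in 𝓝 ((h, t), r),
      0 < z.2 * z.1.2 → 0 < sn z.1.1 (z.2 * z.1.2) := by
    intro r hr
    have hscale : ContinuousAt (fun z : (ℝ × ℝ) × ℝ => (z.1.1, z.2 * z.1.2)) ((h, t), r) := by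
      fun_prop
    rcases hr.1.eq_or_lt with rfl | hr0
    · have hnear : ∀ᶠ q : ℝ × ℝ in 𝓝 (h, 0 * t), 0 < q.2 → 0 < sn q.1 q.2 := by
        rw [zero_mul]
        exact eventually_sn_pos_nhds_zero H.param_pos
      exact hscale.eventually hnear
    · have hsn : 0 < sn h (r * t) :=
        H.sn_pos _ ⟨mul_pos hr0 H.time_pos, mul_le_of_le_one_left H.time_pos.le hr.2⟩
      have hnear : ∀ᶠ q : ℝ × ℝ in 𝓝 (h, r * t), 0 < sn q.1 q.2 :=
        (contDiffAt_sn H.param_pos (r * t)).continuousAt.eventually (lt_mem_nhds hsn)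
      exact (hscale.eventually hnear).mono fun z hz _ => hz
  have huniform := isCompact_Icc.eventually_forall_of_forall_eventually
    (P := fun (q : ℝ × ℝ) (r : ℝ) => 0 < r * q.2 → 0 < sn q.1 (r * q.2)) hlocal
  filter_upwards [huniform, continuousAt_fst.eventually (lt_mem_nhds H.param_pos),
    continuousAt_snd.eventually (lt_mem_nhds H.time_pos)] with q hq hparam htime
  refine ⟨hparam, htime, fun s hs => ?_⟩
  have hsn := hq (s / q.2) ⟨div_nonneg hs.1.le htime.le, (div_le_one htime).2 hs.2⟩
  rw [div_mul_cancel₀ _ htime.ne'] at hsn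
  exact hsn hs.1

end Ez

/-! ### The Jacobian -/

/-- Minus the Jacobian determinant of `(θ, p, t) ↦ (cos θ * ef h t, p * eg h t, sin θ * sn h t)`,
where `h = p ^ 2 + sin θ ^ 2`, as a function of `x = sin θ ^ 2`. -/
def jacobian (h t x : ℝ) : ℝ :=
  eg h t * (x * ef h t * (cn h t * dn h t) + (1 - x) * sn h t * (dn h t + h * sn h t * eg h t)) +
  2 * (h - x) *
    (x * ef h t * (egParam h t * (cn h t * dn h t) - snParam h t * (sn h t * ef h t)) -
     (1 - x) * sn h t * (efParam h t * (sn h t * ef h t) -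
        egParam h t * (dn h t + h * sn h t * eg h t))) -
  2 * x * (1 - x) * eg h t *
    (efParam h t * (cn h t * dn h t) - snParam h t * (dn h t + h * sn h t * eg h t))

/-- The coefficient of `x ^ 2` in `jacobian h t x`. -/
def jacobianQuad (h t : ℝ) : ℝ :=
  2 * eg h t *
    (efParam h t * (cn h t * dn h t) - snParam h t * (dn h t + h * sn h t * eg h t)) -
  2 * (ef h t * (egParam h t * (cn h t * dn h t) - snParam h t * (sn h t * ef h t)) +
     sn h t * (efParam h t * (sn h t * ef h t) -
        egParam h t * (dn h t + h * sn h t * eg h t)))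

theorem mul_jacobian_eq_interpolation (h t x m : ℝ) : m * jacobian h t x =
    (m - x) * jacobian h t 0 + x * jacobian h t m - jacobianQuad h t * (x * (m - x)) * m := by
  simp only [jacobian, jacobianQuad]
  ring

theorem mul_jacobianQuad (h t : ℝ) : h * (1 - h) * jacobianQuad h t =
    (1 - h) * jacobian h t 0 + h * jacobian h t 1 - jacobian h t h := by
  simp only [jacobian, jacobianQuad]
  ring

section Jacobian

variable {h : ℝ}

theorem mul_jacobian_one (hh : 0 < h) (t : ℝ) :
    h * jacobian h t 1 = ef h t * cn h t ^ 2 * (ef h t - t * dn h t) := by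
  simp only [jacobian]
  linear_combination (-ef h t * cn h t * dn h t) * two_mul_egParam hh t +
    (1 - h) * ef h t ^ 2 * sn h t * two_mul_snParam hh t +
    ef h t ^ 2 * cn h t * (-sn h t * one_sub_mul_ef hh t + cn h t * dn_sq_add_sn_sq hh t)

theorem jacobian_self (hh : 0 < h) (t : ℝ) :
    jacobian h t h = eg h t * dn h t ^ 2 * (eg h t + t * cn h t) := by
  simp only [jacobian]
  linear_combination eg h t * (-cn h t * dn h t * two_mul_efParam hh t +
    (1 - h) * (dn h t + h * sn h t * eg h t) * two_mul_snParam hh t -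
    (1 - h) * (dn h t + h * sn h t * eg h t) * ef_mul_cn_add_eg_mul_dn hh t +
    h * dn h t * eg h t * (sn h t * one_sub_mul_eg hh t + dn h t * sn_sq_add_cn_sq hh t))

theorem one_sub_mul_jacobian_zero (hh : 0 < h) (t : ℝ) : (1 - h) * jacobian h t 0 =
    sn h t * (eg h t * dn h t + h * sn h t * eg h t ^ 2 - h * sn h t * ef h t ^ 2 -
      ef h t * dn h t * ez h t) + t * (sn h t * ez h t) := by
  have hee : ee h t = ef h t * dn h t + h * eg h t * cn h t := rfl
  simp only [jacobian, ez]
  linear_combination (-sn h t ^ 2 * ef h t) * two_mul_efParam hh t +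
    sn h t * (dn h t + h * sn h t * eg h t) * two_mul_egParam hh t - t * sn h t ^ 2 * hee

theorem one_sub_mul_eq_one_sub_ez_sq (hh : 0 < h) (hh1 : h ≠ 1) (t : ℝ) :
    (1 - h) * (sn h t * (eg h t * dn h t + h * sn h t * eg h t ^ 2 -
      h * sn h t * ef h t ^ 2 - ef h t * dn h t * ez h t)) = 1 - ez h t ^ 2 := by
  refine mul_left_cancel₀ (sub_ne_zero.2 hh1.symm) ?_
  simp only [ez]
  linear_combination sn h t * ((1 - h) * dn h t +
      h * sn h t * ((1 - h) * eg h t + sn h t * dn h t - ee h t * cn h t)) *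
        one_sub_mul_eg hh t -
    sn h t * (h * sn h t * ((1 - h) * ef h t + ee h t * dn h t - h * sn h t * cn h t) +
      (1 - h) * dn h t * (sn h t * ee h t + cn h t * dn h t)) * one_sub_mul_ef hh t +
    ((1 - h) * sn h t ^ 2 + h * sn h t ^ 4 - h * sn h t ^ 2 * ee h t ^ 2 +
      (1 - h) * (-sn h t ^ 2 * ee h t ^ 2 - ee h t * cn h t * dn h t * sn h t +
      (1 + h * sn h t ^ 2) * cn h t ^ 2)) * dn_sq_add_sn_sq hh t +
    (-h ^ 3 * sn h t ^ 4 + h * sn h t ^ 2 * ee h t ^ 2 +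
      (1 - h) * (1 + h * sn h t ^ 2) * (1 - h * sn h t ^ 2)) * sn_sq_add_cn_sq hh t

theorem one_sub_sq_mul_jacobian_zero (hh : 0 < h) (hh1 : h ≠ 1) (t : ℝ) :
    (1 - h) ^ 2 * jacobian h t 0 =
    1 - ez h t ^ 2 + (1 - h) * t * (sn h t * ez h t) := by
  linear_combination (1 - h) * one_sub_mul_jacobian_zero hh t +
    one_sub_mul_eq_one_sub_ez_sq hh hh1 t

theorem mul_one_sub_sq_mul_jacobianQuad (hh : 0 < h) (hh1 : h ≠ 1) (t : ℝ) :
    h * (1 - h) ^ 2 * jacobianQuad h t =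
      -(sn h t ^ 2 * (ee h t ^ 2 - h * sn h t ^ 2 - (1 - h) * t * ee h t)) := by
  have hzero := one_sub_sq_mul_jacobian_zero hh hh1 t
  simp only [ez] at hzero
  linear_combination (1 - h) * mul_jacobianQuad h t + hzero + (1 - h) * mul_jacobian_one hh t -
    (1 - h) * jacobian_self hh t +
    (1 - h) * (ef h t * cn h t - eg h t * dn h t - t * cn h t * dn h t) *
      ef_mul_cn_add_eg_mul_dn hh t +
    sn h t * (cn h t * one_sub_mul_ef hh t - dn h t * one_sub_mul_eg hh t) -
    (dn h t ^ 2 + h * sn h t ^ 2) * sn_sq_add_cn_sq hh t - dn_sq_add_sn_sq hh t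

end Jacobian

section JacobianSign

variable {h t : ℝ}

theorem continuousAt_fst_of_contDiffAt {E : Type*} [NormedAddCommGroup E] [NormedSpace ℝ E]
    {y : ℝ → ℝ → E} (hy : ContDiffAt ℝ 1 (fun q : ℝ × ℝ => y q.1 q.2) (h, t)) :
    ContinuousAt (fun h => y h t) h :=
  (hasDerivAt_fst_of_contDiffAt hy).continuousAt

theorem continuousAt_deriv_fst {E : Type*} [NormedAddCommGroup E] [NormedSpace ℝ E]
    {y : ℝ → ℝ → E} (hy : ContDiffAt ℝ 1 (fun q : ℝ × ℝ => y q.1 q.2) (h, t)) :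
    ContinuousAt (fun h => deriv (fun h => y h t) h) h := by
  have hpath : ContDiffAt ℝ 1 (fun s : ℝ => (s, t)) h := by fun_prop
  exact ((hy.comp h hpath).fderiv_right (m := 0) (by simp)).continuousAt.clm_apply
    continuousAt_const

theorem continuousAt_jacobian_and_jacobianQuad (hh : 0 < h) (t x : ℝ) :
    ContinuousAt (fun h => jacobian h t x) h ∧ ContinuousAt (fun h => jacobianQuad h t) h := by
  have hsn := (contDiffAt_sn hh t).of_le (m := 1) (mod_cast le_top)
  have hcn := (contDiffAt_cn hh t).of_le (m := 1) (mod_cast le_top)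
  have hdn := (contDiffAt_dn hh t).of_le (m := 1) (mod_cast le_top)
  have hef := (contDiffAt_ef hh t).of_le (m := 1) (mod_cast le_top)
  have heg := (contDiffAt_eg hh t).of_le (m := 1) (mod_cast le_top)
  have := continuousAt_fst_of_contDiffAt hsn
  have := continuousAt_fst_of_contDiffAt hcn
  have := continuousAt_fst_of_contDiffAt hdn
  have := continuousAt_fst_of_contDiffAt hef
  have := continuousAt_fst_of_contDiffAt heg
  have : ContinuousAt (fun h => snParam h t) h := continuousAt_deriv_fst hsn
  have : ContinuousAt (fun h => efParam h t) h := continuousAt_deriv_fst hef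
  have : ContinuousAt (fun h => egParam h t) h := continuousAt_deriv_fst heg
  unfold jacobian jacobianQuad
  constructor <;> fun_prop

namespace BeforeZero

theorem jacobian_zero_nonneg_of_ne_one (H : BeforeZero h t) (hh1 : h ≠ 1) :
    0 ≤ jacobian h t 0 := by
  have hsq : 0 < (1 - h) ^ 2 := pow_two_pos_of_ne_zero (sub_ne_zero.2 hh1.symm)
  have hprod := H.one_sub_ez_sq_nonneg
  rw [← one_sub_sq_mul_jacobian_zero H.param_pos hh1] at hprod
  exact nonneg_of_mul_nonneg_right hprod hsq

theorem jacobianQuad_nonpos_of_ne_one (H : BeforeZero h t) (hh1 : h ≠ 1) :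
    jacobianQuad h t ≤ 0 := by
  have hcoeff : 0 < h * (1 - h) ^ 2 :=
    mul_pos H.param_pos (pow_two_pos_of_ne_zero (sub_ne_zero.2 hh1.symm))
  refine nonpos_of_mul_nonpos_right ?_ hcoeff
  rw [mul_one_sub_sq_mul_jacobianQuad H.param_pos hh1]
  exact neg_nonpos.2 (mul_nonneg (sq_nonneg _) (ee_sq_sub_nonneg H.param_pos H.time_pos))

/-- At the separatrix `h = 1` the sign is inherited from the nearby parameters. -/
theorem jacobian_zero_nonneg_and_jacobianQuad_nonpos (H : BeforeZero h t) :
    0 ≤ jacobian h t 0 ∧ jacobianQuad h t ≤ 0 := by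
  rcases eq_or_ne h 1 with rfl | hh1
  · have hpath : ContinuousAt (fun s : ℝ => (s, t)) 1 := by fun_prop
    have hnear : ∀ᶠ s in 𝓝[≠] (1 : ℝ), BeforeZero s t ∧ s ≠ 1 :=
      ((hpath.eventually H.eventually).filter_mono nhdsWithin_le_nhds).and self_mem_nhdsWithin
    obtain ⟨hzero, hquad⟩ := continuousAt_jacobian_and_jacobianQuad one_pos t 0
    exact ⟨ge_of_tendsto (hzero.tendsto.mono_left nhdsWithin_le_nhds)
        (hnear.mono fun _ hs => hs.1.jacobian_zero_nonneg_of_ne_one hs.2),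
      le_of_tendsto (hquad.tendsto.mono_left nhdsWithin_le_nhds)
        (hnear.mono fun _ hs => hs.1.jacobianQuad_nonpos_of_ne_one hs.2)⟩
  · exact ⟨H.jacobian_zero_nonneg_of_ne_one hh1, H.jacobianQuad_nonpos_of_ne_one hh1⟩

theorem jacobian_pos_of_le (H : BeforeZero h t) {x m : ℝ} (hx : 0 < x) (hxm : x ≤ m)
    (hm : 0 < jacobian h t m) : 0 < jacobian h t x := by
  obtain ⟨hzero, hquad⟩ := H.jacobian_zero_nonneg_and_jacobianQuad_nonpos
  have hm0 : 0 < m := hx.trans_le hxm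
  have hchord : 0 ≤ (m - x) * jacobian h t 0 := mul_nonneg (sub_nonneg.2 hxm) hzero
  have hconcave : 0 ≤ -jacobianQuad h t * (x * (m - x)) * m :=
    mul_nonneg (mul_nonneg (neg_nonneg.2 hquad) (mul_nonneg hx.le (sub_nonneg.2 hxm))) hm0.le
  have : 0 < m * jacobian h t x := by
    linarith [mul_jacobian_eq_interpolation h t x m, mul_pos hx hm]
  exact (mul_pos_iff_of_pos_left hm0).1 this

theorem jacobian_pos (H : BeforeZero h t) {x : ℝ} (hx : 0 < x) (hx1 : x ≤ 1) (hxh : x ≤ h) :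
    0 < jacobian h t x := by
  rcases lt_or_ge h 1 with hh1 | hh1
  · refine H.jacobian_pos_of_le hx hxh ?_
    rw [jacobian_self H.param_pos]
    have := H.eg_pos
    have := dn_pos_of_le_one H.param_pos hh1.le t
    have := H.eg_add_mul_cn_pos hh1
    positivity
  · refine H.jacobian_pos_of_le hx hx1 ((mul_pos_iff_of_pos_left H.param_pos).1 ?_)
    rw [mul_jacobian_one H.param_pos]
    have := H.ef_pos
    have := cn_pos_of_one_le hh1 t
    have := H.ef_sub_mul_dn_pos hh1
    positivity

end BeforeZero

end JacobianSign

/-! ### The exponential mapping in midpoint coordinates -/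

/-- The modulus squared `(E + 1) / 2` of the pendulum trajectory through `(2 θ, 2 p)`, as a function
of the midpoint coordinates `m = (θ, p, τ)`. -/
def param (m : ℝ × ℝ × ℝ) : ℝ := m.2.1 ^ 2 + Real.sin m.1 ^ 2

/-- The exponential mapping in the midpoint coordinates `(θ, p, τ)`: the half-angle and half its
velocity at the midpoint of the extremal, and half its length. The values
are coordinates on `SH(2)` in the chart `targetChart`. -/
def midExp (m : ℝ × ℝ × ℝ) : ℝ × ℝ × ℝ :=
  (Real.cos m.1 * ef (param m) m.2.2, m.2.1 * eg (param m) m.2.2, Real.sin m.1 * sn (param m) m.2.2)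

/-- The domain of `midExp`: extremals that stop before their first Maxwell time, with midpoint
off the line `sin θ = 0`. -/
def midDomain : Set (ℝ × ℝ × ℝ) := {m | Real.sin m.1 ≠ 0 ∧ BeforeZero (param m) m.2.2}

section MidExp

variable {m : ℝ × ℝ × ℝ}

theorem contDiff_param : ContDiff ℝ ∞ param := by unfold param; fun_prop

theorem contDiffAt_comp_param {y : ℝ → ℝ → ℝ} {n : ℕ∞}
    (hy : ContDiffAt ℝ n (fun q : ℝ × ℝ => y q.1 q.2) (param m, m.2.2)) :
    ContDiffAt ℝ n (fun m => y (param m) m.2.2) m :=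
  ContDiffAt.comp (f := fun m => (param m, m.2.2)) m hy
    ((contDiff_param.contDiffAt.of_le (mod_cast le_top)).prodMk (by fun_prop))

theorem contDiffAt_midExp (hm : 0 < param m) : ContDiffAt ℝ ∞ midExp m := by
  have := contDiffAt_comp_param (contDiffAt_sn hm m.2.2)
  have := contDiffAt_comp_param (contDiffAt_ef hm m.2.2)
  have := contDiffAt_comp_param (contDiffAt_eg hm m.2.2)
  unfold midExp
  fun_prop

theorem isOpen_midDomain : IsOpen midDomain := by
  rw [isOpen_iff_mem_nhds]
  rintro m ⟨hsin, H⟩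
  have hsin_cont : ContinuousAt (fun m : ℝ × ℝ × ℝ => Real.sin m.1) m := by fun_prop
  have hparam_cont : ContinuousAt (fun m : ℝ × ℝ × ℝ => (param m, m.2.2)) m :=
    contDiff_param.continuous.continuousAt.prodMk (by fun_prop)
  exact (hsin_cont.eventually_ne hsin).and (hparam_cont.eventually H.eventually)

theorem hasFDerivAt_of_hasDerivAt_fst_snd {E : Type*} [NormedAddCommGroup E] [NormedSpace ℝ E]
    {f : ℝ × ℝ → E} {f₁ f₂ : E} {h t : ℝ} (hf : DifferentiableAt ℝ f (h, t))
    (h₁ : HasDerivAt (fun h => f (h, t)) f₁ h) (h₂ : HasDerivAt (fun t => f (h, t)) f₂ t) :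
    HasFDerivAt f ((ContinuousLinearMap.fst ℝ ℝ ℝ).smulRight f₁ +
      (ContinuousLinearMap.snd ℝ ℝ ℝ).smulRight f₂) (h, t) := by
  have hf' := hf.hasFDerivAt
  have hf₁ := h₁.unique (HasFDerivAt.comp_hasDerivAt (f := fun s => (s, t)) h hf'
    ((hasDerivAt_id h).prodMk (hasDerivAt_const h t)))
  have hf₂ := h₂.unique (HasFDerivAt.comp_hasDerivAt (f := fun s => (h, s)) t hf'
    ((hasDerivAt_const t h).prodMk (hasDerivAt_id t)))
  convert! hf' using 1
  ext
  · simp [hf₁]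
  · simp [hf₂]

theorem hasFDerivAt_param (θ p τ : ℝ) : HasFDerivAt param
    ((2 * Real.sin θ * Real.cos θ) • ContinuousLinearMap.fst ℝ ℝ (ℝ × ℝ) +
      (2 * p) • (ContinuousLinearMap.fst ℝ ℝ ℝ).comp (ContinuousLinearMap.snd ℝ ℝ (ℝ × ℝ)))
    (θ, p, τ) := by
  have hθ : HasFDerivAt (fun m : ℝ × ℝ × ℝ => m.1) _ (θ, p, τ) :=
    (ContinuousLinearMap.fst ℝ ℝ (ℝ × ℝ)).hasFDerivAt
  have hp : HasFDerivAt (fun m : ℝ × ℝ × ℝ => m.2.1) _ (θ, p, τ) :=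
    ((ContinuousLinearMap.fst ℝ ℝ ℝ).comp (ContinuousLinearMap.snd ℝ ℝ (ℝ × ℝ))).hasFDerivAt
  refine ((hp.pow 2).add (hθ.sin.pow 2)).congr_fderiv ?_
  ext <;> simp

theorem hasFDerivAt_comp_param {y : ℝ → ℝ → ℝ} {θ p τ y₁ y₂ : ℝ}
    (hy : ContDiffAt ℝ ∞ (fun q : ℝ × ℝ => y q.1 q.2) (param (θ, p, τ), τ))
    (h₁ : HasDerivAt (fun h => y h τ) y₁ (param (θ, p, τ)))
    (h₂ : HasDerivAt (y (param (θ, p, τ))) y₂ τ) :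
    HasFDerivAt (fun m : ℝ × ℝ × ℝ => y (param m) m.2.2)
      (y₁ • ((2 * Real.sin θ * Real.cos θ) • ContinuousLinearMap.fst ℝ ℝ (ℝ × ℝ) +
        (2 * p) • (ContinuousLinearMap.fst ℝ ℝ ℝ).comp (ContinuousLinearMap.snd ℝ ℝ (ℝ × ℝ))) +
        y₂ • (ContinuousLinearMap.snd ℝ ℝ ℝ).comp (ContinuousLinearMap.snd ℝ ℝ (ℝ × ℝ)))
      (θ, p, τ) := by
  have hτ : HasFDerivAt (fun m : ℝ × ℝ × ℝ => m.2.2) _ (θ, p, τ) :=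
    ((ContinuousLinearMap.snd ℝ ℝ ℝ).comp (ContinuousLinearMap.snd ℝ ℝ (ℝ × ℝ))).hasFDerivAt
  have hy' := hasFDerivAt_of_hasDerivAt_fst_snd (hy.differentiableAt (by simp)) h₁ h₂
  refine (HasFDerivAt.comp (f := fun m : ℝ × ℝ × ℝ => (param m, m.2.2)) (θ, p, τ) hy'
    ((hasFDerivAt_param θ p τ).prodMk hτ)).congr_fderiv ?_
  ext <;> simp <;> ring

/-- The Jacobian matrix of `midExp`. -/
def midExpMatrix (θ p τ : ℝ) : Matrix (Fin 3) (Fin 3) ℝ :=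
  let h := param (θ, p, τ)
  !![-Real.sin θ * ef h τ + 2 * Real.sin θ * Real.cos θ ^ 2 * efParam h τ,
      2 * p * Real.cos θ * efParam h τ,
      Real.cos θ * (dn h τ + h * sn h τ * eg h τ);
    2 * Real.sin θ * Real.cos θ * p * egParam h τ,
      eg h τ + 2 * p ^ 2 * egParam h τ,
      p * (sn h τ * ef h τ);
    Real.cos θ * sn h τ + 2 * Real.sin θ ^ 2 * Real.cos θ * snParam h τ,
      2 * p * Real.sin θ * snParam h τ,
      Real.sin θ * (cn h τ * dn h τ)]

theorem det_midExpMatrix (θ p τ : ℝ) :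
    (midExpMatrix θ p τ).det = -jacobian (param (θ, p, τ)) τ (Real.sin θ ^ 2) := by
  have hcos : 1 - Real.sin θ ^ 2 = Real.cos θ ^ 2 := (Real.cos_sq' θ).symm
  have hp : param (θ, p, τ) - Real.sin θ ^ 2 = p ^ 2 := add_sub_cancel_right _ _
  rw [midExpMatrix, Matrix.det_fin_three, jacobian, hcos, hp]
  simp
  ring

theorem fderiv_midExp_apply {θ p τ : ℝ} (hm : 0 < param (θ, p, τ)) (v : ℝ × ℝ × ℝ) :
    ![(fderiv ℝ midExp (θ, p, τ) v).1, (fderiv ℝ midExp (θ, p, τ) v).2.1,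
      (fderiv ℝ midExp (θ, p, τ) v).2.2] =
      (midExpMatrix θ p τ).mulVec ![v.1, v.2.1, v.2.2] := by
  have hθ : HasFDerivAt (fun m : ℝ × ℝ × ℝ => m.1) _ (θ, p, τ) :=
    (ContinuousLinearMap.fst ℝ ℝ (ℝ × ℝ)).hasFDerivAt
  have hp : HasFDerivAt (fun m : ℝ × ℝ × ℝ => m.2.1) _ (θ, p, τ) :=
    ((ContinuousLinearMap.fst ℝ ℝ ℝ).comp (ContinuousLinearMap.snd ℝ ℝ (ℝ × ℝ))).hasFDerivAt
  have hef := hasFDerivAt_comp_param (contDiffAt_ef hm τ) (hasDerivAt_ef_param hm τ)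
    (hasDerivAt_ef hm τ)
  have heg := hasFDerivAt_comp_param (contDiffAt_eg hm τ) (hasDerivAt_eg_param hm τ)
    (hasDerivAt_eg hm τ)
  have hsn := hasFDerivAt_comp_param (contDiffAt_sn hm τ) (hasDerivAt_sn_param hm τ)
    (hasDerivAt_sn hm τ)
  have hmid : HasFDerivAt midExp _ (θ, p, τ) :=
    (hθ.cos.mul hef).prodMk ((hp.mul heg).prodMk (hθ.sin.mul hsn))
  rw [hmid.fderiv]
  ext i
  fin_cases i <;> simp [midExpMatrix, Matrix.mulVec, dotProduct, Fin.sum_univ_three] <;> ring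

theorem injective_fderiv_midExp (hm : m ∈ midDomain) :
    Function.Injective (fderiv ℝ midExp m) := by
  obtain ⟨θ, p, τ⟩ := m
  obtain ⟨hsin, H⟩ := hm
  have hsin_sq : 0 < Real.sin θ ^ 2 := pow_two_pos_of_ne_zero hsin
  have hdet : (midExpMatrix θ p τ).det ≠ 0 := by
    rw [det_midExpMatrix]
    exact neg_ne_zero.2 (H.jacobian_pos hsin_sq (Real.sin_sq_le_one θ)
      (le_add_of_nonneg_left (sq_nonneg p))).ne'
  rw [injective_iff_map_eq_zero]
  rintro v hv
  have hmul := fderiv_midExp_apply H.param_pos v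
  have hv0 := Matrix.eq_zero_of_mulVec_eq_zero hdet (hmul.symm.trans (by simp [hv]))
  exact Prod.ext (congrFun hv0 0) (Prod.ext (congrFun hv0 1) (congrFun hv0 2))

theorem exists_equiv_hasStrictFDerivAt_midExp (hm : m ∈ midDomain) :
    ∃ e : (ℝ × ℝ × ℝ) ≃L[ℝ] (ℝ × ℝ × ℝ),
      HasStrictFDerivAt midExp (e : (ℝ × ℝ × ℝ) →L[ℝ] _) m := by
  let e := (LinearEquiv.ofInjectiveEndo (fderiv ℝ midExp m : (ℝ × ℝ × ℝ) →ₗ[ℝ] _)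
    (injective_fderiv_midExp hm)).toContinuousLinearEquiv
  refine ⟨e, ?_⟩
  have hmid := (contDiffAt_midExp hm.2.param_pos).hasStrictFDerivAt (by simp)
  convert! hmid using 1

end MidExp

/-! ### Growth before the first zero of `sn` -/

section Growth

variable {h t : ℝ}

namespace BeforeZero

theorem concaveOn_sn (H : BeforeZero h t) : ConcaveOn ℝ (Icc 0 t) (sn h) := by
  have hderiv : deriv (sn h) = fun s => cn h s * dn h s :=
    funext fun s => (hasDerivAt_sn H.param_pos s).deriv
  refine AntitoneOn.concaveOn_of_deriv (convex_Icc 0 t)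
    (continuous_of_hasDerivAt (hasDerivAt_sn H.param_pos)).continuousOn
    (fun s _ => (hasDerivAt_sn H.param_pos s).differentiableAt.differentiableWithinAt) ?_
  rw [hderiv]
  have hcn_dn := fun s => (hasDerivAt_cn H.param_pos s).mul (hasDerivAt_dn H.param_pos s)
  refine antitoneOn_of_hasDerivWithinAt_nonpos (convex_Icc 0 t).interior
    (continuous_of_hasDerivAt hcn_dn).continuousOn
    (fun s _ => (hcn_dn s).hasDerivWithinAt) fun s hs => ?_
  have := H.param_pos
  have := H.sn_nonneg (interior_subset (interior_subset hs))
  have : 0 ≤ sn h s * (dn h s ^ 2 + h * cn h s ^ 2) := by positivity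
  linarith

theorem mul_cn_mul_dn_le_sn (H : BeforeZero h t) : t * (cn h t * dn h t) ≤ sn h t := by
  have hslope := H.concaveOn_sn.le_slope_of_hasDerivAt (left_mem_Icc.2 H.time_pos.le)
    (right_mem_Icc.2 H.time_pos.le) H.time_pos (hasDerivAt_sn H.param_pos t)
  rw [slope_def_field, sn_zero H.param_pos, sub_zero, sub_zero, le_div_iff₀ H.time_pos] at hslope
  linarith

theorem sn_div_mul_le_sn (H : BeforeZero h t) {s : ℝ} (hs : s ∈ Icc 0 t) :
    sn h t / t * s ≤ sn h s := by
  have ht := H.time_pos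
  have hchord := H.concaveOn_sn.2 (left_mem_Icc.2 ht.le) (right_mem_Icc.2 ht.le)
    (sub_nonneg.2 (div_le_one_of_le₀ hs.2 ht.le)) (div_nonneg hs.1 ht.le) (sub_add_cancel 1 (s / t))
  simp only [sn_zero H.param_pos, smul_eq_mul, mul_zero, zero_add, div_mul_cancel₀ s ht.ne']
    at hchord
  rwa [div_mul_comm]

theorem sn_le_ef (H : BeforeZero h t) : sn h t ≤ ef h t := by
  rcases le_or_gt 0 (dn h t) with hdn | hdn
  · have hdn' : ∀ s ∈ Icc 0 t, 0 ≤ dn h s := fun s hs => by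
      rcases le_total h 1 with hh1 | hh1
      · exact (dn_pos_of_le_one H.param_pos hh1 s).le
      · exact hdn.trans (H.dn_antitoneOn hh1 hs (right_mem_Icc.2 H.time_pos.le) hs.2)
    have hmono := le_of_hasDerivAt_nonneg (f := fun s => ef h s - sn h s) H.time_pos.le
      ((continuous_of_hasDerivAt (hasDerivAt_ef H.param_pos)).sub
        (continuous_of_hasDerivAt (hasDerivAt_sn H.param_pos))).continuousOn
      (fun s _ => (hasDerivAt_ef H.param_pos s).sub (hasDerivAt_sn H.param_pos s)) fun s hs => by
        have Hs := H.mono (Ioo_subset_Ioc_self hs)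
        have hcn_le : 0 ≤ dn h s * (1 - cn h s) := mul_nonneg (hdn' s (Ioo_subset_Icc_self hs))
          (sub_nonneg.2 (le_of_abs_le (abs_cn_le_one H.param_pos s)))
        have := mul_pos (mul_pos H.param_pos Hs.sn_time_pos) Hs.eg_pos
        linarith
    simpa [sn_zero H.param_pos, ef_zero H.param_pos] using hmono
  · have hcn_le : 0 ≤ ef h t * (1 - cn h t) :=
      mul_nonneg H.ef_pos.le (sub_nonneg.2 (le_of_abs_le (abs_cn_le_one H.param_pos t)))
    linarith [ef_mul_cn_add_eg_mul_dn H.param_pos t, mul_neg_of_pos_of_neg H.eg_pos hdn]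

theorem sn_sq_mul_le_eg (H : BeforeZero h t) : sn h t ^ 2 * t / 3 ≤ eg h t := by
  set σ := sn h t / t with hσ
  have hσ_nonneg : 0 ≤ σ := div_nonneg H.sn_time_pos.le H.time_pos.le
  have hmono := le_of_hasDerivAt_nonneg (f := fun s => eg h s - σ ^ 2 / 3 * s ^ 3)
    H.time_pos.le ((continuous_of_hasDerivAt (hasDerivAt_eg H.param_pos)).sub
      (by fun_prop)).continuousOn
    (fun s _ => (hasDerivAt_eg H.param_pos s).sub ((hasDerivAt_pow 3 s).const_mul _))
    fun s hs => by
      have Hs := H.mono (Ioo_subset_Ioc_self hs)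
      have hline := H.sn_div_mul_le_sn (Ioo_subset_Icc_self hs)
      have hprod : (σ * s) * (σ * s) ≤ sn h s * ef h s :=
        mul_le_mul hline (hline.trans Hs.sn_le_ef) (mul_nonneg hσ_nonneg hs.1.le)
          Hs.sn_time_pos.le
      simp only [Nat.cast_ofNat, Nat.add_one_sub_one]
      linarith
  have hend : σ ^ 2 / 3 * t ^ 3 = sn h t ^ 2 * t / 3 := by
    have := H.time_pos.ne'
    rw [hσ]
    field_simp
  simp only [eg_zero H.param_pos] at hmono
  linarith

theorem mul_sn_pow_mul_sub_le_ef (H : BeforeZero h t) :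
    h * sn h t ^ 3 * t ^ 2 / 15 - t ≤ ef h t := by
  set σ := sn h t / t with hσ
  have hσ_nonneg : 0 ≤ σ := div_nonneg H.sn_time_pos.le H.time_pos.le
  have hmono := le_of_hasDerivAt_nonneg
    (f := fun s => ef h s - (h * σ ^ 3 / 15 * s ^ 5 - s)) H.time_pos.le
    ((continuous_of_hasDerivAt (hasDerivAt_ef H.param_pos)).sub (by fun_prop)).continuousOn
    (fun s _ => (hasDerivAt_ef H.param_pos s).sub (((hasDerivAt_pow 5 s).const_mul _).sub
      (hasDerivAt_id s))) fun s hs => by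
      have Hs := H.mono (Ioo_subset_Ioc_self hs)
      have hs0 := hs.1
      have hline := H.sn_div_mul_le_sn (Ioo_subset_Icc_self hs)
      have heg : (σ * s) ^ 2 * s / 3 ≤ eg h s := by
        refine le_trans ?_ Hs.sn_sq_mul_le_eg
        gcongr
      have hprod : (σ * s) * ((σ * s) ^ 2 * s / 3) ≤ sn h s * eg h s :=
        mul_le_mul hline heg (by positivity) Hs.sn_time_pos.le
      have := mul_le_mul_of_nonneg_left hprod H.param_pos.le
      have := neg_le_of_abs_le (abs_dn_le_one H.param_pos s)
      simp only [Nat.cast_ofNat, Nat.add_one_sub_one]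
      linarith
  have hend : h * σ ^ 3 / 15 * t ^ 5 = h * sn h t ^ 3 * t ^ 2 / 15 := by
    have := H.time_pos.ne'
    rw [hσ]
    field_simp
  simp only [ef_zero H.param_pos] at hmono
  linarith

theorem sq_mul_param_le_one (H : BeforeZero h t) {w : ℝ} (hw : 0 ≤ w) (hw_sn : w ≤ sn h t) :
    w ^ 2 * h ≤ 1 := by
  have hsq := mul_le_mul_of_nonneg_left (pow_le_pow_left₀ hw hw_sn 2) H.param_pos.le
  linarith [dn_sq_add_sn_sq H.param_pos t, sq_nonneg (dn h t)]

theorem lt_eg_of_lt_time (H : BeforeZero h t) {w b : ℝ} (hw : 0 < w) (hw_sn : w ≤ sn h t)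
    (ht : 3 * b / w ^ 2 < t) : b < eg h t := by
  refine lt_of_lt_of_le ?_ H.sn_sq_mul_le_eg
  rw [div_lt_iff₀ (by positivity)] at ht
  linarith [mul_le_mul_of_nonneg_right (pow_le_pow_left₀ hw.le hw_sn 2) H.time_pos.le]

theorem lt_ef_of_lt_time (H : BeforeZero h t) {w b : ℝ} (hb : 0 ≤ b) (hw : 0 < w)
    (hw_sn : w ≤ sn h t) (hw_param : w ^ 2 ≤ h) (ht : 15 * (b + 1) / w ^ 5 + 1 < t) :
    b < ef h t := by
  refine lt_of_lt_of_le ?_ H.mul_sn_pow_mul_sub_le_ef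
  have ht1 : 1 < t := lt_of_le_of_lt (le_add_of_nonneg_left (by positivity)) ht
  have hgrowth : 15 * (b + 1) < w ^ 5 * t := by
    have := (div_lt_iff₀' (c := w ^ 5) (by positivity)).1 (lt_sub_iff_add_lt.2 ht)
    linarith [pow_pos hw 5]
  have hcoeff : w ^ 5 * t ^ 2 ≤ h * sn h t ^ 3 * t ^ 2 :=
    calc w ^ 5 * t ^ 2 = w ^ 2 * w ^ 3 * t ^ 2 := by ring
      _ ≤ h * sn h t ^ 3 * t ^ 2 := by gcongr; exact H.param_pos.le
  linarith [mul_lt_mul_of_pos_right hgrowth H.time_pos, le_mul_of_one_le_right hb ht1.le]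

theorem cn_pos_of_sq_lt (H : BeforeZero h t) (hh1 : h ≤ 1)
    (hlt : ((1 - h) * ef h t) ^ 2 < (h * sn h t * cn h t) ^ 2) : 0 < cn h t := by
  by_contra! hcn
  have hnonneg : 0 ≤ -(h * sn h t * cn h t) :=
    neg_nonneg.2 (mul_nonpos_of_nonneg_of_nonpos (mul_pos H.param_pos H.sn_time_pos).le hcn)
  have hle : -(h * sn h t * cn h t) ≤ (1 - h) * ef h t := by
    linarith [one_sub_mul_ef H.param_pos t,
      mul_pos (ee_pos H.param_pos H.time_pos) (dn_pos_of_le_one H.param_pos hh1 t)]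
  exact absurd hlt (not_lt.2 (neg_sq (h * sn h t * cn h t) ▸ pow_le_pow_left₀ hnonneg hle 2))

theorem dn_pos_of_sq_lt (H : BeforeZero h t) (hh1 : 1 ≤ h)
    (hlt : ((h - 1) * eg h t) ^ 2 < (sn h t * dn h t) ^ 2) : 0 < dn h t := by
  by_contra! hdn
  have hnonneg : 0 ≤ -(sn h t * dn h t) :=
    neg_nonneg.2 (mul_nonpos_of_nonneg_of_nonpos H.sn_time_pos.le hdn)
  have hle : -(sn h t * dn h t) ≤ (h - 1) * eg h t := by
    linarith [one_sub_mul_eg H.param_pos t,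
      mul_pos (ee_pos H.param_pos H.time_pos) (cn_pos_of_one_le hh1 t)]
  exact absurd hlt (not_lt.2 (neg_sq (sn h t * dn h t) ▸ pow_le_pow_left₀ hnonneg hle 2))

theorem mul_time_le_one (H : BeforeZero h t) {q : ℝ} (hq : 0 ≤ q) (hcn_sq : q ≤ cn h t ^ 2)
    (hdn_sq : q ≤ dn h t ^ 2) (hcn : 0 < cn h t) (hdn : 0 < dn h t) : q * t ≤ 1 := by
  have hle : q ≤ cn h t * dn h t := by
    refine le_of_sq_le_sq ?_ (mul_pos hcn hdn).le
    rw [mul_pow, sq q]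
    exact mul_le_mul hcn_sq hdn_sq hq (sq_nonneg _)
  calc q * t ≤ cn h t * dn h t * t := mul_le_mul_of_nonneg_right hle H.time_pos.le
    _ ≤ sn h t := by linarith [H.mul_cn_mul_dn_le_sn]
    _ ≤ 1 := le_of_abs_le (abs_sn_le_one H.param_pos t)

end BeforeZero

theorem le_cn_sq_and_le_dn_sq (hh : 0 < h) {u q ε : ℝ} (hu : u ^ 2 ≤ 1)
    (hε : 0 ≤ ε) (hεq : 4 * ε ≤ q) (huε : 1 - ε ≤ u ^ 2) (hhε : h ≤ 1 + ε)
    (hsn : (u * sn h t) ^ 2 ≤ 1 - 2 * q) : q ≤ cn h t ^ 2 ∧ q ≤ dn h t ^ 2 := by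
  have hcn_u : u ^ 2 * cn h t ^ 2 = u ^ 2 - (u * sn h t) ^ 2 := by
    linear_combination u ^ 2 * sn_sq_add_cn_sq hh t
  have hdn_u : u ^ 2 * dn h t ^ 2 = u ^ 2 - h * (u * sn h t) ^ 2 := by
    linear_combination u ^ 2 * dn_sq_add_sn_sq hh t
  have hprod : h * (u * sn h t) ^ 2 ≤ (1 + ε) * (1 - 2 * q) :=
    mul_le_mul hhε hsn (sq_nonneg _) (by linarith)
  constructor
  · linarith [mul_le_mul_of_nonneg_right hu (sq_nonneg (cn h t))]
  · linarith [mul_le_mul_of_nonneg_right hu (sq_nonneg (dn h t)),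
      mul_nonneg hε (by linarith : 0 ≤ q)]

theorem mul_sq_le_of_le_sq {k v f a ε : ℝ} (hk : 0 ≤ k) (hkv : k ≤ v ^ 2) (hvε : v ^ 2 ≤ ε)
    (hf : |v * f| ≤ a) : (k * f) ^ 2 ≤ ε * a ^ 2 := by
  have hkf : k * f ^ 2 ≤ a ^ 2 :=
    calc k * f ^ 2 ≤ v ^ 2 * f ^ 2 := mul_le_mul_of_nonneg_right hkv (sq_nonneg f)
      _ = |v * f| ^ 2 := by rw [sq_abs, mul_pow]
      _ ≤ a ^ 2 := pow_le_pow_left₀ (abs_nonneg _) hf 2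
  calc (k * f) ^ 2 = k * (k * f ^ 2) := by ring
    _ ≤ ε * a ^ 2 :=
      mul_le_mul (hkv.trans hvε) hkf (mul_nonneg hk (sq_nonneg f)) ((sq_nonneg v).trans hvε)

theorem sq_le_of_abs_mul_le {x f a ε : ℝ} (hε : 0 < ε) (ha : 0 ≤ a) (hf : a / √ε < f)
    (hx : |x * f| ≤ a) : x ^ 2 ≤ ε := by
  have hf_pos : 0 < f := (div_nonneg ha (Real.sqrt_nonneg ε)).trans_lt hf
  rw [abs_mul, abs_of_pos hf_pos, ← le_div_iff₀ hf_pos] at hx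
  rw [← sq_abs, ← Real.le_sqrt (abs_nonneg x) hε.le]
  exact hx.trans ((div_lt_comm₀ (Real.sqrt_pos.2 hε) hf_pos).1 hf).le

end Growth

/-- The half of `midDomain` where the half-angle at the midpoint lies in `(0, π)`. -/
def midUpper : Set (ℝ × ℝ × ℝ) := {m | m.1 ∈ Ioo 0 Real.pi ∧ BeforeZero (param m) m.2.2}

section TimeBound

variable {m : ℝ × ℝ × ℝ}

theorem sin_pos_of_mem_midUpper (hm : m ∈ midUpper) : 0 < Real.sin m.1 :=
  Real.sin_pos_of_mem_Ioo hm.1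

theorem le_sin_of_mem_midUpper (hm : m ∈ midUpper) {w : ℝ} (hw : w ≤ (midExp m).2.2) :
    w ≤ Real.sin m.1 :=
  hw.trans (mul_le_of_le_one_right (sin_pos_of_mem_midUpper hm).le
    (le_of_abs_le (abs_sn_le_one hm.2.param_pos _)))

theorem le_sn_of_mem_midUpper (hm : m ∈ midUpper) {w : ℝ} (hw : w ≤ (midExp m).2.2) :
    w ≤ sn (param m) m.2.2 :=
  hw.trans (mul_le_of_le_one_left hm.2.sn_time_pos.le (Real.sin_le_one _))

theorem sq_le_param_of_mem_midUpper (hm : m ∈ midUpper) {w : ℝ} (hw0 : 0 ≤ w)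
    (hw : w ≤ (midExp m).2.2) : w ^ 2 ≤ param m :=
  le_add_of_nonneg_of_le (sq_nonneg _) (pow_le_pow_left₀ hw0 (le_sin_of_mem_midUpper hm hw) 2)

/-- Near the fixed point `(θ, p) = (π / 2, 0)` of the pendulum `cn` and `dn` stay away from zero,
while `sn ≤ 1` is concave with derivative `cn * dn`. -/
theorem mul_time_le_one_of_near_fixedPoint (hm : m ∈ midUpper) {a w q ε : ℝ} (hw : 0 < w)
    (hq : 0 < q) (hεq : 4 * ε ≤ q) (hεa : 4 * (ε * a ^ 2) < w ^ 2 * q)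
    (hcos : Real.cos m.1 ^ 2 ≤ ε) (hp : m.2.1 ^ 2 ≤ ε) (hfst : |(midExp m).1| ≤ a)
    (hsnd : |(midExp m).2.1| ≤ a) (hw_le : w ≤ (midExp m).2.2)
    (hle : (midExp m).2.2 ^ 2 ≤ 1 - 2 * q) : q * m.2.2 ≤ 1 := by
  have H := hm.2
  set h := param m
  have hε : 0 ≤ ε := (sq_nonneg _).trans hp
  have hsin := Real.sin_sq_add_cos_sq m.1
  have hparam : h = m.2.1 ^ 2 + Real.sin m.1 ^ 2 := rfl
  obtain ⟨hcn_sq, hdn_sq⟩ := le_cn_sq_and_le_dn_sq H.param_pos (Real.sin_sq_le_one m.1) hε hεq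
    (by linarith) (by linarith [Real.sin_sq_le_one m.1]) hle
  have hsn_sq : w ^ 2 * q ≤ sn h m.2.2 ^ 2 * q := by
    gcongr
    exact le_sn_of_mem_midUpper hm hw_le
  rcases le_total h 1 with hh1 | hh1
  · have hsmall : ((1 - h) * ef h m.2.2) ^ 2 ≤ ε * a ^ 2 := mul_sq_le_of_le_sq (sub_nonneg.2 hh1)
      (by linarith [sq_nonneg m.2.1]) hcos hfst
    have hh_sq : 1 / 2 ≤ h ^ 2 := by
      nlinarith [sq_nonneg m.2.1, sq_nonneg (midExp m).2.2]
    have hlarge : 1 / 2 * (sn h m.2.2 ^ 2 * q) ≤ (h * sn h m.2.2 * cn h m.2.2) ^ 2 :=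
      calc 1 / 2 * (sn h m.2.2 ^ 2 * q) ≤ h ^ 2 * (sn h m.2.2 ^ 2 * cn h m.2.2 ^ 2) := by gcongr
        _ = (h * sn h m.2.2 * cn h m.2.2) ^ 2 := by ring
    have hwq := mul_pos (pow_pos hw 2) hq
    exact H.mul_time_le_one hq.le hcn_sq hdn_sq (H.cn_pos_of_sq_lt hh1 (by linarith))
      (dn_pos_of_le_one H.param_pos hh1 _)
  · have hsmall : ((h - 1) * eg h m.2.2) ^ 2 ≤ ε * a ^ 2 := mul_sq_le_of_le_sq (sub_nonneg.2 hh1)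
      (by linarith [Real.sin_sq_le_one m.1]) hp hsnd
    have hlarge : sn h m.2.2 ^ 2 * q ≤ (sn h m.2.2 * dn h m.2.2) ^ 2 := by
      rw [mul_pow]
      gcongr
    have hwq := mul_pos (pow_pos hw 2) hq
    exact H.mul_time_le_one hq.le hcn_sq hdn_sq (cn_pos_of_one_le hh1 _)
      (H.dn_pos_of_sq_lt hh1 (by linarith))

/-- The only way for the time to blow up while `midExp` stays bounded would be to approach the
fixed point `(θ, p) = (π / 2, 0)`, because `ef` and `eg` grow with the time. -/
theorem exists_time_bound (a : ℝ) {w w' : ℝ} (hw : 0 < w) (hw' : w' < 1) :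
    ∃ T, ∀ m ∈ midUpper, |(midExp m).1| ≤ a → |(midExp m).2.1| ≤ a →
      (midExp m).2.2 ∈ Icc w w' → m.2.2 ≤ T := by
  set q := (1 - w') / 2 with hq_def
  have hq : 0 < q := half_pos (sub_pos.2 hw')
  obtain ⟨ε, hε, hεq, hεa⟩ : ∃ ε : ℝ, 0 < ε ∧ 4 * ε ≤ q ∧ 4 * (ε * a ^ 2) < w ^ 2 * q := by
    have hcont : ContinuousAt (fun ε : ℝ => 4 * ε) 0 := by fun_prop
    have hcont' : ContinuousAt (fun ε : ℝ => 4 * (ε * a ^ 2)) 0 := by fun_prop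
    have hev := (hcont.tendsto.eventually_lt_const (u := q) (by simpa using hq)).and
      (hcont'.tendsto.eventually_lt_const (u := w ^ 2 * q) (by simpa using by positivity))
    obtain ⟨ε, hε', hε⟩ :=
      ((hev.filter_mono (nhdsWithin_le_nhds (s := Ioi 0))).and self_mem_nhdsWithin).exists
    exact ⟨ε, hε, hε'.1.le, hε'.2⟩
  set b := a / √ε
  refine ⟨max (1 / q) (max (3 * b / w ^ 2) (15 * (b + 1) / w ^ 5 + 1)), ?_⟩
  intro m hm hfst hsnd hthd
  by_contra! hlt
  obtain ⟨hlt_q, hlt⟩ := max_lt_iff.1 hlt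
  obtain ⟨hlt_eg, hlt_ef⟩ := max_lt_iff.1 hlt
  have ha : 0 ≤ a := (abs_nonneg _).trans hfst
  have hsn := le_sn_of_mem_midUpper hm hthd.1
  have hcos := sq_le_of_abs_mul_le hε ha (hm.2.lt_ef_of_lt_time (by positivity) hw hsn
    (sq_le_param_of_mem_midUpper hm hw.le hthd.1) hlt_ef) hfst
  have hp := sq_le_of_abs_mul_le hε ha (hm.2.lt_eg_of_lt_time hw hsn hlt_eg) hsnd
  have hsq : (midExp m).2.2 ^ 2 ≤ 1 - 2 * q := by
    have hpos : 0 ≤ (midExp m).2.2 := hw.le.trans hthd.1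
    nlinarith [mul_nonneg hpos (sub_nonneg.2 hthd.2), hthd.2]
  have hbound := mul_time_le_one_of_near_fixedPoint hm hw hq hεq hεa hcos hp hfst hsnd hthd.1 hsq
  rw [div_lt_iff₀' hq] at hlt_q
  exact absurd hlt_q (not_lt.2 hbound)

end TimeBound

/-! ### Bijectivity of proper local homeomorphisms -/

section Proper

variable {X Y : Type*} [TopologicalSpace X] [TopologicalSpace Y] {F : X → Y} {U W : Set X}

theorem eventually_forall_mem_of_isCompact [T2Space Y] (hF : ContinuousOn F U) {y : Y}
    {L : Set Y} (hL : L ∈ 𝓝 y) {K : Set X} (hK : IsCompact K) (hKU : K ⊆ U)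
    (hLK : U ∩ F ⁻¹' L ⊆ K) (hW : IsOpen W) (hfiber : ∀ x ∈ U, F x = y → x ∈ W) :
    ∀ᶠ z in 𝓝 y, ∀ x ∈ U, F x = z → x ∈ W := by
  have hclosed : IsClosed (F '' (K \ W)) :=
    ((hK.diff hW).image_of_continuousOn (hF.mono (sdiff_subset.trans hKU))).isClosed
  have hy : y ∉ F '' (K \ W) := by
    rintro ⟨x, ⟨hxK, hxW⟩, hxy⟩
    exact hxW (hfiber x (hKU hxK) hxy)
  filter_upwards [hL, hclosed.isOpen_compl.mem_nhds hy] with z hzL hz x hx hxz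
  by_contra hxW
  exact hz ⟨x, ⟨hLK ⟨hx, mem_preimage.2 (hxz.symm ▸ hzL)⟩, hxW⟩, hxz⟩

theorem eventually_exists_mem_inter (hU : IsOpen U) {x : X} (hx : x ∈ U)
    (hopen : 𝓝 (F x) ≤ Filter.map F (𝓝 x)) (hW : W ∈ 𝓝 x) :
    ∀ᶠ z in 𝓝 (F x), ∃ x' ∈ W ∩ U, F x' = z :=
  hopen (Filter.image_mem_map (Filter.inter_mem hW (hU.mem_nhds hx)))

theorem eventually_not_existsUnique [T2Space X] (hU : IsOpen U)
    (hopen : ∀ x ∈ U, 𝓝 (F x) ≤ Filter.map F (𝓝 x)) {x x' : X} (hx : x ∈ U) (hx' : x' ∈ U)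
    (hne : x ≠ x') (heq : F x' = F x) : ∀ᶠ z in 𝓝 (F x), ¬∃! x, x ∈ U ∧ F x = z := by
  obtain ⟨W, W', hW, hW', hxW, hxW', hdisj⟩ := t2_separation hne
  filter_upwards [eventually_exists_mem_inter hU hx (hopen x hx) (hW.mem_nhds hxW),
    heq ▸ eventually_exists_mem_inter hU hx' (hopen x' hx') (hW'.mem_nhds hxW')]
  rintro z ⟨a, ha, haz⟩ ⟨b, hb, hbz⟩ hunique
  exact hdisj.ne_of_mem ha.1 hb.1 (hunique.unique ⟨ha.2, haz⟩ ⟨hb.2, hbz⟩)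

/-- By properness and local injectivity, the set of points with exactly one preimage is open;
so is its complement, and the base is connected. -/
theorem existsUnique_of_proper [T2Space X] [T2Space Y] {V : Set Y} (hU : IsOpen U)
    (hV : IsOpen V) (hVc : IsPreconnected V) (hF : ContinuousOn F U)
    (hopen : ∀ x ∈ U, 𝓝 (F x) ≤ Filter.map F (𝓝 x)) (hinj : ∀ x ∈ U, ∃ W ∈ 𝓝 x, InjOn F W)
    (hproper : ∀ y ∈ V, ∃ L ∈ 𝓝 y, ∃ K ⊆ U, IsCompact K ∧ U ∩ F ⁻¹' L ⊆ K)
    {y₀ : Y} (hy₀ : y₀ ∈ V) (hx₀ : ∃! x, x ∈ U ∧ F x = y₀) {y : Y} (hy : y ∈ V) :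
    ∃! x, x ∈ U ∧ F x = y := by
  have hnear : ∀ y ∈ V, ∀ W : Set X, IsOpen W → (∀ x ∈ U, F x = y → x ∈ W) →
      ∀ᶠ z in 𝓝 y, ∀ x ∈ U, F x = z → x ∈ W := fun y hy W hW hfiber => by
    obtain ⟨L, hL, K, hKU, hK, hLK⟩ := hproper y hy
    exact eventually_forall_mem_of_isCompact hF hL hK hKU hLK hW hfiber
  set P : Set Y := {y | ∃! x, x ∈ U ∧ F x = y}
  have hP : IsOpen (V ∩ P) := by
    rw [isOpen_iff_mem_nhds]
    rintro y ⟨hy, x, ⟨hx, rfl⟩, hunique⟩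
    obtain ⟨W, hW, hinjW⟩ := hinj x hx
    obtain ⟨W', hW'W, hW', hxW'⟩ := mem_nhds_iff.1 hW
    filter_upwards [hV.mem_nhds hy,
      eventually_exists_mem_inter hU hx (hopen x hx) (hW'.mem_nhds hxW'),
      hnear _ hy W' hW' fun x' hx' he => hunique x' ⟨hx', he⟩ ▸ hxW'] with z hz hexists hfiber
    obtain ⟨x', hx', rfl⟩ := hexists
    exact ⟨hz, x', ⟨hx'.2, rfl⟩, fun x'' hx'' =>
      hinjW (hW'W (hfiber x'' hx''.1 hx''.2)) (hW'W hx'.1) hx''.2⟩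
  have hPc : IsOpen (V ∩ Pᶜ) := by
    rw [isOpen_iff_mem_nhds]
    rintro y ⟨hy, hyP⟩
    refine Filter.inter_mem (hV.mem_nhds hy) ?_
    by_cases hfiber : ∃ x ∈ U, F x = y
    · obtain ⟨x, hx, rfl⟩ := hfiber
      obtain ⟨x', hx', heq, hne⟩ : ∃ x' ∈ U, F x' = F x ∧ x' ≠ x := by
        by_contra! hunique
        exact hyP ⟨x, ⟨hx, rfl⟩, fun x' hx' => hunique x' hx'.1 hx'.2⟩
      exact eventually_not_existsUnique hU hopen hx hx' hne.symm heq
    · push Not at hfiber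
      filter_upwards [hnear y hy ∅ isOpen_empty fun x hx h => hfiber x hx h] with z hz
      exact fun ⟨x, hx, _⟩ => hz x hx.1 hx.2
  by_contra hyP
  obtain ⟨z, -, hzP, hzPc⟩ := hVc (V ∩ P) (V ∩ Pᶜ) hP hPc
    (fun z hz => (em (z ∈ P)).imp (⟨hz, ·⟩) (⟨hz, ·⟩)) ⟨y₀, hy₀, hy₀, hx₀⟩ ⟨y, hy, hy, hyP⟩
  exact hzPc.2 hzP.2

end Proper

/-! ### Bijectivity of the exponential mapping in midpoint coordinates -/

section MidUpper

variable {m : ℝ × ℝ × ℝ}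

theorem midUpper_subset : midUpper ⊆ midDomain := fun _ hm =>
  ⟨(sin_pos_of_mem_midUpper hm).ne', hm.2⟩

theorem isOpen_midUpper : IsOpen midUpper := by
  have : midUpper = midDomain ∩ Prod.fst ⁻¹' Ioo 0 Real.pi :=
    Subset.antisymm (fun m hm => ⟨midUpper_subset hm, hm.1⟩) (fun m hm => ⟨hm.2, hm.1.2⟩)
  rw [this]
  exact isOpen_midDomain.inter (isOpen_Ioo.preimage continuous_fst)

theorem beforeZero_of_forall_nonneg {h t : ℝ} (hh : 0 < h) (ht : 0 ≤ t) (hsn : 0 < sn h t)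
    (hnonneg : ∀ r ∈ Icc (0 : ℝ) 1, 0 ≤ sn h (r * t)) : BeforeZero h t := by
  have ht0 : 0 < t := ht.lt_of_ne fun h0 => by simp [← h0, sn_zero hh] at hsn
  have hnonneg' : ∀ s ∈ Icc 0 t, 0 ≤ sn h s := fun s hs => by
    have := hnonneg (s / t) ⟨div_nonneg hs.1 ht, (div_le_one ht0).2 hs.2⟩
    rwa [div_mul_cancel₀ _ ht0.ne'] at this
  refine ⟨hh, ht0, fun s hs => (hnonneg' s (Ioc_subset_Icc_self hs)).lt_of_ne fun hs0 => ?_⟩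
  rcases hs.2.eq_or_lt with rfl | hst
  · exact hsn.ne hs0
  -- an interior zero of the nonnegative function `sn` is a critical point, but zeros are simple
  have hmin : IsLocalMin (sn h) s := by
    filter_upwards [Icc_mem_nhds hs.1 hst] with r hr
    exact hs0 ▸ hnonneg' r hr
  have hunit := sn_sq_add_cn_sq hh s
  have henergy := dn_sq_add_sn_sq hh s
  rw [← hs0] at hunit henergy
  rcases mul_eq_zero.1 (hmin.hasDerivAt_eq_zero (hasDerivAt_sn hh s)) with h0 | h0 <;>
    simp [h0] at hunit henergy

theorem sn_one_strictMono : StrictMono (sn 1) :=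
  strictMono_of_hasDerivAt_pos (fun t => hasDerivAt_sn one_pos t) fun t =>
    mul_pos (cn_pos_of_one_le le_rfl t) (dn_pos_of_le_one one_pos le_rfl t)

theorem continuousOn_midExp : ContinuousOn midExp midUpper := fun _ hm =>
  (contDiffAt_midExp hm.2.param_pos).continuousAt.continuousWithinAt

theorem midExp_mem (hm : m ∈ midUpper) : (midExp m).2.2 ∈ Ioo (0 : ℝ) 1 := by
  refine ⟨mul_pos (sin_pos_of_mem_midUpper hm) hm.2.sn_time_pos, lt_of_not_ge fun hle => ?_⟩
  have hsin : Real.sin m.1 = 1 := (Real.sin_le_one m.1).antisymm (le_sin_of_mem_midUpper hm hle)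
  have hsn : 1 ≤ sn (param m) m.2.2 := le_sn_of_mem_midUpper hm hle
  have hcn := cn_pos_of_one_le (h := param m) (by simp [param, hsin, sq_nonneg]) m.2.2
  nlinarith [sn_sq_add_cn_sq hm.2.param_pos m.2.2]

/-- The midpoint coordinates in `midUpper` with a bounded time and `w ≤ (midExp m).2.2`, written
with non-strict inequalities. It witnesses that `midExp` is proper. -/
def midCompact (w T : ℝ) : Set (ℝ × ℝ × ℝ) :=
  {m | m ∈ Icc 0 Real.pi ×ˢ Icc (-(1 / w)) (1 / w) ×ˢ Icc 0 T ∧ w ^ 2 ≤ param m ∧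
    w ≤ (midExp m).2.2 ∧ ∀ r ∈ Icc (0 : ℝ) 1, 0 ≤ sn (param m) (r * m.2.2)}

theorem isCompact_midCompact {w : ℝ} (hw : 0 < w) (T : ℝ) : IsCompact (midCompact w T) := by
  set B : Set (ℝ × ℝ × ℝ) := (Icc 0 Real.pi ×ˢ Icc (-(1 / w)) (1 / w) ×ˢ Icc 0 T) ∩
    {m | w ^ 2 ≤ param m}
  have hB : IsCompact B := (isCompact_Icc.prod (isCompact_Icc.prod isCompact_Icc)).inter_right
    (isClosed_le continuous_const contDiff_param.continuous)
  have hpos : ∀ m ∈ B, 0 < param m := fun m hm => (pow_pos hw 2).trans_le hm.2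
  have hthd : ContinuousOn (fun m => (midExp m).2.2) B := fun m hm =>
    (contDiffAt_midExp (hpos m hm)).continuousAt.continuousWithinAt.snd.snd
  have hsn : ∀ r : ℝ, ContinuousOn (fun m => sn (param m) (r * m.2.2)) B := fun r m hm =>
    (ContinuousAt.comp (g := fun q : ℝ × ℝ => sn q.1 q.2)
      (f := fun m : ℝ × ℝ × ℝ => (param m, r * m.2.2))
      (contDiffAt_sn (hpos m hm) (r * m.2.2)).continuousAt
      (contDiff_param.continuous.prodMk (by fun_prop)).continuousAt).continuousWithinAt
  have heq : midCompact w T = (B ∩ (fun m => (midExp m).2.2) ⁻¹' Ici w) ∩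
      ⋂ r : Icc (0 : ℝ) 1, B ∩ (fun m => sn (param m) (r * m.2.2)) ⁻¹' Ici 0 := by
    ext m
    rw [mem_inter_iff, mem_iInter]
    exact ⟨fun ⟨hbox, hparam, hle, hnonneg⟩ =>
        ⟨⟨⟨hbox, hparam⟩, hle⟩, fun r => ⟨⟨hbox, hparam⟩, hnonneg r r.2⟩⟩,
      fun ⟨⟨⟨hbox, hparam⟩, hle⟩, hnonneg⟩ =>
        ⟨hbox, hparam, hle, fun r hr => (hnonneg ⟨r, hr⟩).2⟩⟩
  rw [heq]
  exact (hB.of_isClosed_subset (hthd.preimage_isClosed_of_isClosed hB.isClosed isClosed_Ici)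
    inter_subset_left).inter_right (isClosed_iInter fun r =>
      (hsn r).preimage_isClosed_of_isClosed hB.isClosed isClosed_Ici)

theorem midCompact_subset {w : ℝ} (hw : 0 < w) (T : ℝ) : midCompact w T ⊆ midUpper := by
  rintro m ⟨⟨hθ, -, ht⟩, hparam, hle, hnonneg⟩
  have hmul : 0 < Real.sin m.1 * sn (param m) m.2.2 := hw.trans_le hle
  have hsn := pos_of_mul_pos_right hmul (Real.sin_nonneg_of_mem_Icc hθ)
  have hsin : 0 < Real.sin m.1 := pos_of_mul_pos_left hmul hsn.le
  refine ⟨⟨hθ.1.lt_of_ne fun h0 => ?_, hθ.2.lt_of_ne fun hπ => ?_⟩,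
    beforeZero_of_forall_nonneg ((pow_pos hw 2).trans_le hparam) ht.1 hsn hnonneg⟩
  · simp [← h0] at hsin
  · simp [hπ] at hsin

theorem mem_midCompact (hm : m ∈ midUpper) {w T : ℝ} (hw : 0 < w) (hle : w ≤ (midExp m).2.2)
    (hT : m.2.2 ≤ T) : m ∈ midCompact w T := by
  have ht := hm.2.time_pos.le
  refine ⟨⟨Ioo_subset_Icc_self hm.1, abs_le.1 ?_, ht, hT⟩, sq_le_param_of_mem_midUpper hm hw.le hle,
    hle, fun r hr => hm.2.sn_nonneg ⟨mul_nonneg hr.1 ht, mul_le_of_le_one_left ht hr.2⟩⟩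
  have hsq : (w * |m.2.1|) ^ 2 ≤ 1 :=
    calc (w * |m.2.1|) ^ 2 = w ^ 2 * m.2.1 ^ 2 := by rw [mul_pow, sq_abs]
      _ ≤ w ^ 2 * param m := by
        gcongr
        exact le_add_of_nonneg_right (sq_nonneg _)
      _ ≤ 1 := hm.2.sq_mul_param_le_one hw.le (le_sn_of_mem_midUpper hm hle)
  exact (le_div_iff₀' hw).2 ((sq_le_one_iff₀ (by positivity)).1 hsq)

theorem midExp_proper {y : ℝ × ℝ × ℝ} (hy : y.2.2 ∈ Ioo (0 : ℝ) 1) :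
    ∃ L ∈ 𝓝 y, ∃ K ⊆ midUpper, IsCompact K ∧ midUpper ∩ midExp ⁻¹' L ⊆ K := by
  obtain ⟨w, hw, hwy⟩ := exists_between hy.1
  obtain ⟨w', hyw', hw'⟩ := exists_between hy.2
  obtain ⟨T, hT⟩ := exists_time_bound (max |y.1| |y.2.1| + 1) hw hw'
  set a := max |y.1| |y.2.1| + 1
  have hfst : y.1 ∈ Ioo (-a) a := abs_lt.1 ((le_max_left _ _).trans_lt (lt_add_one _))
  have hsnd : y.2.1 ∈ Ioo (-a) a := abs_lt.1 ((le_max_right _ _).trans_lt (lt_add_one _))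
  refine ⟨Icc (-a) a ×ˢ Icc (-a) a ×ˢ Icc w w', prod_mem_nhds (Icc_mem_nhds hfst.1 hfst.2)
    (prod_mem_nhds (Icc_mem_nhds hsnd.1 hsnd.2) (Icc_mem_nhds hwy hyw')),
    midCompact w T, midCompact_subset hw T, isCompact_midCompact hw T, ?_⟩
  rintro m ⟨hm, h₁, h₂, h₃⟩
  exact mem_midCompact hm hw h₃.1 (hT m hm (abs_le.2 h₁) (abs_le.2 h₂) h₃)

theorem center_mem_midUpper : (Real.pi / 2, 0, 1) ∈ midUpper := by
  have hone : BeforeZero 1 1 := ⟨one_pos, one_pos, fun s hs => by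
    rw [← sn_zero one_pos]
    exact sn_one_strictMono hs.1⟩
  exact ⟨⟨by positivity, by linarith [Real.pi_pos]⟩, by simpa [param] using hone⟩

theorem eq_center_of_midExp_eq (hm : m ∈ midUpper)
    (heq : midExp m = midExp (Real.pi / 2, 0, 1)) : m = (Real.pi / 2, 0, 1) := by
  obtain ⟨θ, p, τ⟩ := m
  obtain ⟨hθ, H⟩ := hm
  simp only [midExp, Prod.mk.injEq, Real.cos_pi_div_two, zero_mul, Real.sin_pi_div_two] at heq
  obtain ⟨hfst, hsnd, hthd⟩ := heq
  obtain rfl : p = 0 := (mul_eq_zero.1 hsnd).resolve_right H.eg_pos.ne'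
  have hcos : Real.cos θ = Real.cos (Real.pi / 2) := by
    rw [Real.cos_pi_div_two]
    exact (mul_eq_zero.1 hfst).resolve_right H.ef_pos.ne'
  obtain rfl : θ = Real.pi / 2 := Real.injOn_cos (Ioo_subset_Icc_self hθ)
    ⟨by positivity, by linarith [Real.pi_pos]⟩ hcos
  have hsn : sn 1 τ = sn 1 1 := by simpa [param] using hthd
  rw [sn_one_strictMono.injective hsn]

theorem existsUnique_midExp {y : ℝ × ℝ × ℝ} (hy : y.2.2 ∈ Ioo (0 : ℝ) 1) :
    ∃! m, m ∈ midUpper ∧ midExp m = y := by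
  refine existsUnique_of_proper (V := univ ×ˢ univ ×ˢ Ioo (0 : ℝ) 1)
    (y₀ := midExp (Real.pi / 2, 0, 1)) isOpen_midUpper
    (isOpen_univ.prod (isOpen_univ.prod isOpen_Ioo))
    (isPreconnected_univ.prod (isPreconnected_univ.prod isPreconnected_Ioo)) continuousOn_midExp
    (fun m hm => ?_) (fun m hm => ?_) (fun y hy => midExp_proper hy.2.2)
    ⟨trivial, trivial, midExp_mem center_mem_midUpper⟩
    ⟨_, ⟨center_mem_midUpper, rfl⟩, fun m hm => eq_center_of_midExp_eq hm.1 hm.2⟩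
    ⟨trivial, trivial, hy⟩
  all_goals obtain ⟨e, he⟩ := exists_equiv_hasStrictFDerivAt_midExp (midUpper_subset hm)
  · exact he.map_nhds_eq_of_equiv.ge
  · exact ⟨(he.toOpenPartialHomeomorph midExp).source,
      (he.toOpenPartialHomeomorph midExp).open_source.mem_nhds
        he.mem_toOpenPartialHomeomorph_source, (he.toOpenPartialHomeomorph midExp).injOn⟩

end MidUpper

/-! ### The inverse of `midExp` -/

/-- The inverse of `midExp` on `midUpper`; its values are junk unless `y.2.2 ∈ (0, 1)`. -/
def midLogUpper : ℝ × ℝ × ℝ → ℝ × ℝ × ℝ := Function.invFunOn midExp midUpper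

theorem midLogUpper_mem {y : ℝ × ℝ × ℝ} (hy : y.2.2 ∈ Ioo (0 : ℝ) 1) :
    midLogUpper y ∈ midUpper :=
  Function.invFunOn_mem (existsUnique_midExp hy).exists

theorem midExp_midLogUpper {y : ℝ × ℝ × ℝ} (hy : y.2.2 ∈ Ioo (0 : ℝ) 1) :
    midExp (midLogUpper y) = y :=
  Function.invFunOn_eq (existsUnique_midExp hy).exists

theorem midLogUpper_midExp {m : ℝ × ℝ × ℝ} (hm : m ∈ midUpper) : midLogUpper (midExp m) = m :=
  (existsUnique_midExp (midExp_mem hm)).unique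
    ⟨midLogUpper_mem (midExp_mem hm), midExp_midLogUpper (midExp_mem hm)⟩ ⟨hm, rfl⟩

theorem contDiffAt_midLogUpper {y : ℝ × ℝ × ℝ} (hy : y.2.2 ∈ Ioo (0 : ℝ) 1) :
    ContDiffAt ℝ ∞ midLogUpper y := by
  have hm := midLogUpper_mem hy
  rw [← midExp_midLogUpper hy]
  generalize midLogUpper y = m at hm
  obtain ⟨e, he⟩ := exists_equiv_hasStrictFDerivAt_midExp (midUpper_subset hm)
  have hsmooth := contDiffAt_midExp hm.2.param_pos
  refine (hsmooth.to_localInverse he.hasFDerivAt (by simp)).congr_of_eventuallyEq ?_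
  have hmem : ∀ᶠ z in 𝓝 (midExp m), he.localInverse midExp e m z ∈ midUpper := by
    refine he.localInverse_continuousAt.eventually_mem ?_
    rw [he.localInverse_apply_image]
    exact isOpen_midUpper.mem_nhds hm
  filter_upwards [he.eventually_right_inverse, hmem] with z hz hzmem
  change midLogUpper z = he.localInverse midExp e m z
  nth_rw 1 [← hz]
  exact midLogUpper_midExp hzmem

/-- The symmetry `(θ, p) ↦ (-θ, -p)` of the pendulum, in midpoint variables. -/
def midFlip (m : ℝ × ℝ × ℝ) : ℝ × ℝ × ℝ := (-m.1, -m.2.1, m.2.2)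

/-- The symmetry of the target that corresponds to `midFlip`. -/
def targetFlip (y : ℝ × ℝ × ℝ) : ℝ × ℝ × ℝ := (y.1, -y.2.1, -y.2.2)

theorem midExp_midFlip (m : ℝ × ℝ × ℝ) : midExp (midFlip m) = targetFlip (midExp m) := by
  simp [midExp, midFlip, targetFlip, param]

theorem midFlip_mem {m : ℝ × ℝ × ℝ} (hm : m ∈ midDomain) : midFlip m ∈ midDomain := by
  simpa [midDomain, midFlip, param] using hm

theorem sin_midFlip_pos {m : ℝ × ℝ × ℝ} (hs : Real.sin m.1 < 0) :
    0 < Real.sin (midFlip m).1 := by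
  simpa only [midFlip, Real.sin_neg, Left.neg_pos_iff]

/-- The inverse of `midExp` on `midDomain`, up to translations of the angle by `2π`; its values
are junk unless `0 < |y.2.2| < 1`. -/
def midLog (y : ℝ × ℝ × ℝ) : ℝ × ℝ × ℝ :=
  if 0 < y.2.2 then midLogUpper y else midFlip (midLogUpper (targetFlip y))

theorem targetFlip_mem {y : ℝ × ℝ × ℝ} (h1 : |y.2.2| < 1) (hneg : y.2.2 < 0) :
    (targetFlip y).2.2 ∈ Ioo (0 : ℝ) 1 :=
  ⟨neg_pos.2 hneg, neg_lt.1 (abs_lt.1 h1).1⟩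

theorem midLog_mem {y : ℝ × ℝ × ℝ} (h0 : y.2.2 ≠ 0) (h1 : |y.2.2| < 1) :
    midLog y ∈ midDomain := by
  rw [midLog]
  rcases h0.lt_or_gt with hneg | hpos
  · rw [if_neg hneg.not_gt]
    exact midFlip_mem (midUpper_subset (midLogUpper_mem (targetFlip_mem h1 hneg)))
  · rw [if_pos hpos]
    exact midUpper_subset (midLogUpper_mem ⟨hpos, (abs_lt.1 h1).2⟩)

theorem midExp_midLog {y : ℝ × ℝ × ℝ} (h0 : y.2.2 ≠ 0) (h1 : |y.2.2| < 1) :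
    midExp (midLog y) = y := by
  rw [midLog]
  rcases h0.lt_or_gt with hneg | hpos
  · rw [if_neg hneg.not_gt, midExp_midFlip, midExp_midLogUpper (targetFlip_mem h1 hneg)]
    simp only [targetFlip, neg_neg, Prod.mk.eta]
  · rw [if_pos hpos, midExp_midLogUpper ⟨hpos, (abs_lt.1 h1).2⟩]

theorem contDiffAt_midLog {y : ℝ × ℝ × ℝ} (h0 : y.2.2 ≠ 0) (h1 : |y.2.2| < 1) :
    ContDiffAt ℝ ∞ midLog y := by
  have hcont : ContinuousAt (fun y : ℝ × ℝ × ℝ => y.2.2) y := by fun_prop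
  rcases h0.lt_or_gt with hneg | hpos
  · have htarget : ContDiffAt ℝ ∞ targetFlip y := by unfold targetFlip; fun_prop
    have hmid : ContDiff ℝ ∞ midFlip := by unfold midFlip; fun_prop
    refine (hmid.contDiffAt.comp y ((contDiffAt_midLogUpper
      (targetFlip_mem h1 hneg)).comp y htarget)).congr_of_eventuallyEq ?_
    filter_upwards [hcont.tendsto.eventually_lt_const hneg] with z hz
    exact if_neg hz.not_gt
  · refine (contDiffAt_midLogUpper ⟨hpos, (abs_lt.1 h1).2⟩).congr_of_eventuallyEq ?_
    filter_upwards [hcont.tendsto.eventually_const_lt hpos] with z hz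
    exact if_pos hz

theorem exists_add_int_mul_two_pi_mem_Ioo {θ : ℝ} (hs : 0 < Real.sin θ) :
    ∃ k : ℤ, θ + k * (2 * Real.pi) ∈ Ioo 0 Real.pi := by
  have hmod := toIcoMod_mem_Ico Real.two_pi_pos 0 θ
  have heq : toIcoMod Real.two_pi_pos 0 θ =
      θ + ((-toIcoDiv Real.two_pi_pos 0 θ : ℤ) : ℝ) * (2 * Real.pi) := by
    rw [toIcoMod, zsmul_eq_mul]
    push_cast
    ring
  rw [heq, zero_add] at hmod
  generalize -toIcoDiv Real.two_pi_pos 0 θ = k at hmod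
  refine ⟨k, ?_⟩
  rw [← Real.sin_add_int_mul_two_pi θ k] at hs
  generalize θ + k * (2 * Real.pi) = φ at hs hmod ⊢
  refine ⟨hmod.1.lt_of_ne fun h0 => by simp [← h0] at hs, ?_⟩
  by_contra! hle
  have := Real.sin_nonneg_of_nonneg_of_le_pi (x := φ - Real.pi)
    (by linarith) (by linarith [hmod.2])
  rw [Real.sin_sub_pi] at this
  linarith

theorem mem_midDomain_add_int_mul_two_pi_iff (m : ℝ × ℝ × ℝ) (k : ℤ) :
    (m.1 + k * (2 * Real.pi), m.2) ∈ midDomain ↔ m ∈ midDomain := by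
  simp [midDomain, param, Real.sin_add_int_mul_two_pi]

theorem midExp_add_int_mul_two_pi (m : ℝ × ℝ × ℝ) (k : ℤ) :
    midExp (m.1 + k * (2 * Real.pi), m.2) = midExp m := by
  simp [midExp, param, Real.sin_add_int_mul_two_pi, Real.cos_add_int_mul_two_pi]

theorem exists_mem_midUpper {m : ℝ × ℝ × ℝ} (hm : m ∈ midDomain) (hs : 0 < Real.sin m.1) :
    ∃ k : ℤ, (m.1 + k * (2 * Real.pi), m.2) ∈ midUpper := by
  obtain ⟨k, hk⟩ := exists_add_int_mul_two_pi_mem_Ioo hs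
  exact ⟨k, hk, ((mem_midDomain_add_int_mul_two_pi_iff m k).2 hm).2⟩

theorem midLogUpper_midExp_of_sin_pos {m : ℝ × ℝ × ℝ} (hm : m ∈ midDomain) (hs : 0 < Real.sin m.1) :
    ∃ k : ℤ, midLogUpper (midExp m) = (m.1 + k * (2 * Real.pi), m.2) := by
  obtain ⟨k, hk⟩ := exists_mem_midUpper hm hs
  exact ⟨k, by rw [← midExp_add_int_mul_two_pi m k, midLogUpper_midExp hk]⟩

theorem midLog_midExp {m : ℝ × ℝ × ℝ} (hm : m ∈ midDomain) :
    ∃ k : ℤ, midLog (midExp m) = (m.1 + k * (2 * Real.pi), m.2) := by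
  rcases hm.1.lt_or_gt with hneg | hpos
  · obtain ⟨k, hk⟩ := midLogUpper_midExp_of_sin_pos (midFlip_mem hm) (sin_midFlip_pos hneg)
    have hw : (midExp m).2.2 < 0 := mul_neg_of_neg_of_pos hneg hm.2.sn_time_pos
    refine ⟨-k, ?_⟩
    rw [midLog, if_neg hw.not_gt, ← midExp_midFlip, hk]
    simp only [midFlip, neg_neg, Prod.mk.injEq, and_true]
    push_cast
    ring
  · have hw : 0 < (midExp m).2.2 := mul_pos hpos hm.2.sn_time_pos
    rw [midLog, if_pos hw]
    exact midLogUpper_midExp_of_sin_pos hm hpos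

theorem midExp_ne_zero {m : ℝ × ℝ × ℝ} (hm : m ∈ midDomain) : (midExp m).2.2 ≠ 0 :=
  mul_ne_zero hm.1 hm.2.sn_time_pos.ne'

/-! ### Extremals in terms of their midpoints -/

/-- The equations of the pendulum for the sine and the cosine of the half-angle and half the
velocity. -/
structure HalfPendulum (a b c : ℝ → ℝ) : Prop where
  deriv_sin : ∀ s, HasDerivAt a (b s * c s) s
  deriv_cos : ∀ s, HasDerivAt b (-(a s * c s)) s
  deriv_vel : ∀ s, HasDerivAt c (-(a s * b s)) s

namespace HalfPendulum

variable {a b c a' b' c' : ℝ → ℝ}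

theorem unique (H : HalfPendulum a b c) (H' : HalfPendulum a' b' c') (ha : a 0 = a' 0)
    (hb : b 0 = b' 0) (hc : c 0 = c' 0) : a = a' ∧ b = b' ∧ c = c' := by
  let V : ℝ × ℝ × ℝ → ℝ × ℝ × ℝ := fun q => (q.2.1 * q.2.2, -(q.1 * q.2.2), -(q.1 * q.2.1))
  have hV : ContDiff ℝ 1 V := by fun_prop
  have hcurve : ∀ {a b c : ℝ → ℝ}, HalfPendulum a b c →
      IsMIntegralCurve (I := 𝓘(ℝ, ℝ × ℝ × ℝ)) (fun s => (a s, b s, c s)) (fun y => V y) :=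
    fun {a b c} H s => hasMFDerivAt_iff_hasFDerivAt.2
      ((H.deriv_sin s).prodMk ((H.deriv_cos s).prodMk (H.deriv_vel s))).hasFDerivAt
  have heq := isMIntegralCurve_Ioo_eq_of_contMDiff_boundaryless (t₀ := 0)
    (I := 𝓘(ℝ, ℝ × ℝ × ℝ)) (v := fun y => V y)
    (contMDiff_vectorSpace_iff_contDiff.2 hV) (hcurve H) (hcurve H') (by simp [ha, hb, hc])
  exact ⟨funext fun s => congrArg Prod.fst (congrFun heq s),
    funext fun s => congrArg (fun q => q.2.1) (congrFun heq s),
    funext fun s => congrArg (fun q => q.2.2) (congrFun heq s)⟩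

theorem comp_const_add (H : HalfPendulum a b c) (r : ℝ) :
    HalfPendulum (fun s => a (r + s)) (fun s => b (r + s)) (fun s => c (r + s)) :=
  ⟨fun s => (H.deriv_sin (r + s)).comp_const_add r s,
    fun s => (H.deriv_cos (r + s)).comp_const_add r s,
    fun s => (H.deriv_vel (r + s)).comp_const_add r s⟩

theorem comp_const_sub (H : HalfPendulum a b c) (r : ℝ) :
    HalfPendulum (fun s => a (r - s)) (fun s => b (r - s)) (fun s => -c (r - s)) :=
  ⟨fun s => ((H.deriv_sin (r - s)).comp_const_sub r s).congr_deriv (by ring),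
    fun s => ((H.deriv_cos (r - s)).comp_const_sub r s).congr_deriv (by ring),
    fun s => ((H.deriv_vel (r - s)).comp_const_sub r s).neg.congr_deriv (by ring)⟩

theorem neg (H : HalfPendulum a b c) : HalfPendulum (fun s => -a s) b (fun s => -c s) :=
  ⟨fun s => (H.deriv_sin s).neg.congr_deriv (by ring),
    fun s => (H.deriv_cos s).congr_deriv (by ring),
    fun s => (H.deriv_vel s).neg.congr_deriv (by ring)⟩

end HalfPendulum

section AdditionFormulas

variable {h u v p : ℝ}

/-- The denominator in the addition formulas for Jacobi's functions. -/
def addDenom (h u s : ℝ) : ℝ := 1 - u ^ 2 * sn h s ^ 2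

/-- The sine of the half-angle of the pendulum of energy parameter `h = p ^ 2 + u ^ 2` that starts
at sine `u`, cosine `v` and half-velocity `p`. -/
def addSin (h u v p s : ℝ) : ℝ := (u * cn h s * dn h s + v * p * sn h s) / addDenom h u s

/-- The cosine of the half-angle that goes with `addSin`. -/
def addCos (h u v p s : ℝ) : ℝ := (v * dn h s - u * p * sn h s * cn h s) / addDenom h u s

/-- The half-velocity that goes with `addSin`. -/
def addVel (h u v p s : ℝ) : ℝ := (p * cn h s - u * v * sn h s * dn h s) / addDenom h u s

theorem abs_mul_sn_lt_one (hh : 0 < h) (hhe : h = p ^ 2 + u ^ 2) (huv : u ^ 2 + v ^ 2 = 1)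
    (s : ℝ) : |u * sn h s| < 1 := by
  have hu : |u| ≤ 1 := (sq_le_one_iff_abs_le_one u).1 (by linarith [sq_nonneg v])
  have hsn := abs_sn_le_one hh s
  rw [abs_mul]
  by_contra! hle
  have hu1 : u ^ 2 = 1 := by
    rw [← sq_abs, le_antisymm hu (hle.trans (mul_le_of_le_one_right (abs_nonneg _) hsn)), one_pow]
  have hsn1 : sn h s ^ 2 = 1 := by
    rw [← sq_abs, le_antisymm hsn (hle.trans (mul_le_of_le_one_left (abs_nonneg _) hu)), one_pow]
  have hcn := pow_pos (cn_pos_of_one_le (by linarith [sq_nonneg p] : 1 ≤ h) s) 2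
  linarith [sn_sq_add_cn_sq hh s]

theorem addDenom_pos (hh : 0 < h) (hhe : h = p ^ 2 + u ^ 2) (huv : u ^ 2 + v ^ 2 = 1) (s : ℝ) :
    0 < addDenom h u s := by
  have := (sq_lt_one_iff_abs_lt_one _).2 (abs_mul_sn_lt_one hh hhe huv s)
  rw [mul_pow] at this
  exact sub_pos.2 this

theorem hasDerivAt_div_of_eq_mul {N Q : ℝ → ℝ} {N' Q' A B s : ℝ} (hN : HasDerivAt N N' s)
    (hQ : HasDerivAt Q Q' s) (hQ0 : Q s ≠ 0) (h : N' * Q s - N s * Q' = A * B) :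
    HasDerivAt (fun s => N s / Q s) (A / Q s * (B / Q s)) s :=
  (hN.div hQ hQ0).congr_deriv (by rw [h, div_mul_div_comm, sq])

theorem hasDerivAt_addDenom (hh : 0 < h) (u s : ℝ) :
    HasDerivAt (addDenom h u) (-(2 * u ^ 2 * sn h s * (cn h s * dn h s))) s := by
  refine ((((hasDerivAt_sn hh s).pow 2).const_mul (u ^ 2)).const_sub 1).congr_deriv ?_
  simp
  ring

theorem hasDerivAt_addSin (hh : 0 < h) (hhe : h = p ^ 2 + u ^ 2) (huv : u ^ 2 + v ^ 2 = 1)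
    (s : ℝ) : HasDerivAt (addSin h u v p) (addCos h u v p s * addVel h u v p s) s := by
  have hnum : HasDerivAt (fun s => u * cn h s * dn h s + v * p * sn h s)
      (u * (-(sn h s * dn h s * dn h s) - h * sn h s * cn h s * cn h s) +
        v * p * (cn h s * dn h s)) s :=
    ((((hasDerivAt_cn hh s).const_mul u).mul (hasDerivAt_dn hh s)).add
      ((hasDerivAt_sn hh s).const_mul (v * p))).congr_deriv (by ring)
  refine hasDerivAt_div_of_eq_mul hnum (hasDerivAt_addDenom hh u s)
    (addDenom_pos hh hhe huv s).ne' ?_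
  rw [addDenom]
  linear_combination (-u * sn h s * cn h s ^ 2 + u ^ 3 * sn h s ^ 3 -
      u ^ 3 * sn h s ^ 3 * cn h s ^ 2 - u ^ 3 * sn h s ^ 5) * hhe +
    (u * sn h s * dn h s ^ 2) * huv +
    (-u ^ 3 * sn h s + 2 * u ^ 3 * sn h s * cn h s ^ 2 + u ^ 3 * sn h s ^ 3) *
      dn_sq_add_sn_sq hh s +
    (u ^ 3 * sn h s - u ^ 3 * p ^ 2 * sn h s ^ 3 - u ^ 5 * sn h s ^ 3) * sn_sq_add_cn_sq hh s

theorem hasDerivAt_addCos (hh : 0 < h) (hhe : h = p ^ 2 + u ^ 2) (huv : u ^ 2 + v ^ 2 = 1)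
    (s : ℝ) : HasDerivAt (addCos h u v p) (-(addSin h u v p s * addVel h u v p s)) s := by
  have hnum : HasDerivAt (fun s => v * dn h s - u * p * sn h s * cn h s)
      (-(v * h * sn h s * cn h s) -
        u * p * (cn h s * cn h s * dn h s - sn h s * sn h s * dn h s)) s :=
    (((hasDerivAt_dn hh s).const_mul v).sub
      (((hasDerivAt_sn hh s).const_mul (u * p)).mul (hasDerivAt_cn hh s))).congr_deriv (by ring)
  rw [← neg_mul, addSin, ← neg_div]
  refine hasDerivAt_div_of_eq_mul hnum (hasDerivAt_addDenom hh u s)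
    (addDenom_pos hh hhe huv s).ne' ?_
  rw [addDenom]
  linear_combination (-v * sn h s * cn h s) * hhe + (-u * p * sn h s ^ 2 * dn h s) * huv +
    (u ^ 2 * v * sn h s * cn h s) * dn_sq_add_sn_sq hh s +
    (-u ^ 3 * p * sn h s ^ 2 * dn h s) * sn_sq_add_cn_sq hh s

theorem hasDerivAt_addVel (hh : 0 < h) (hhe : h = p ^ 2 + u ^ 2) (huv : u ^ 2 + v ^ 2 = 1)
    (s : ℝ) : HasDerivAt (addVel h u v p) (-(addSin h u v p s * addCos h u v p s)) s := by
  have hnum : HasDerivAt (fun s => p * cn h s - u * v * sn h s * dn h s)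
      (-(p * sn h s * dn h s) -
        u * v * (cn h s * dn h s * dn h s - h * sn h s * sn h s * cn h s)) s :=
    (((hasDerivAt_cn hh s).const_mul p).sub
      (((hasDerivAt_sn hh s).const_mul (u * v)).mul (hasDerivAt_dn hh s))).congr_deriv (by ring)
  rw [← neg_mul, addSin, ← neg_div]
  refine hasDerivAt_div_of_eq_mul hnum (hasDerivAt_addDenom hh u s)
    (addDenom_pos hh hhe huv s).ne' ?_
  rw [addDenom]
  linear_combination (u * v * sn h s ^ 2 * cn h s) * hhe + (p * sn h s * dn h s) * huv +
    (-u ^ 3 * v * sn h s ^ 2 * cn h s) * dn_sq_add_sn_sq hh s +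
    (u ^ 2 * p * sn h s * dn h s) * sn_sq_add_cn_sq hh s

theorem halfPendulum_add (hh : 0 < h) (hhe : h = p ^ 2 + u ^ 2) (huv : u ^ 2 + v ^ 2 = 1) :
    HalfPendulum (addSin h u v p) (addCos h u v p) (addVel h u v p) :=
  ⟨hasDerivAt_addSin hh hhe huv, hasDerivAt_addCos hh hhe huv, hasDerivAt_addVel hh hhe huv⟩

theorem HalfPendulum.eq_add {a b c : ℝ → ℝ} (H : HalfPendulum a b c) (hh : 0 < h)
    (hhe : h = c 0 ^ 2 + a 0 ^ 2) (hab : a 0 ^ 2 + b 0 ^ 2 = 1) :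
    a = addSin h (a 0) (b 0) (c 0) ∧ b = addCos h (a 0) (b 0) (c 0) := by
  obtain ⟨ha, hb, -⟩ := H.unique (halfPendulum_add hh hhe hab)
    (by simp [addSin, addDenom, sn_zero hh, cn_zero hh, dn_zero hh])
    (by simp [addCos, addDenom, sn_zero hh, dn_zero hh])
    (by simp [addVel, addDenom, sn_zero hh, cn_zero hh])
  exact ⟨ha, hb⟩

end AdditionFormulas

namespace HalfPendulum

variable {a b c Z X : ℝ → ℝ} {h r : ℝ}

theorem comp_add_mul_addDenom (H : HalfPendulum a b c) (hh : 0 < h) (hhe : h = c r ^ 2 + a r ^ 2)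
    (hab : a r ^ 2 + b r ^ 2 = 1) (s : ℝ) :
    a (r + s) * addDenom h (a r) s = a r * cn h s * dn h s + b r * c r * sn h s ∧
      b (r + s) * addDenom h (a r) s = b r * dn h s - a r * c r * sn h s * cn h s := by
  have hQ := (addDenom_pos hh hhe hab s).ne'
  obtain ⟨ha, hb⟩ := (H.comp_const_add r).eq_add hh (by simpa only [add_zero]) (by simpa)
  rw [congrFun ha s, congrFun hb s]
  simp only [add_zero]
  exact ⟨div_mul_cancel₀ _ hQ, div_mul_cancel₀ _ hQ⟩

theorem comp_sub_mul_addDenom (H : HalfPendulum a b c) (hh : 0 < h) (hhe : h = c r ^ 2 + a r ^ 2)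
    (hab : a r ^ 2 + b r ^ 2 = 1) (s : ℝ) :
    a (r - s) * addDenom h (a r) s = a r * cn h s * dn h s - b r * c r * sn h s ∧
      b (r - s) * addDenom h (a r) s = b r * dn h s + a r * c r * sn h s * cn h s := by
  have hreflect := ((H.comp_const_sub r).comp_add_mul_addDenom (r := 0) hh
    (by simpa only [sub_zero, neg_sq]) (by simpa) s)
  simp only [zero_add, sub_zero] at hreflect
  exact ⟨by linear_combination hreflect.1, by linear_combination hreflect.2⟩

theorem exp_integral_mul (H : HalfPendulum a b c) (hZ : ∀ s, HasDerivAt Z (a s) s) (hh : 0 < h)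
    (hhe : h = c r ^ 2 + a r ^ 2) (hab : a r ^ 2 + b r ^ 2 = 1) (s : ℝ) :
    Real.exp (Z (r + s)) * (1 - a r * sn h s) = Real.exp (Z (r - s)) * (1 + a r * sn h s) := by
  have hlt := fun s => abs_lt.1 (abs_mul_sn_lt_one hh hhe hab s)
  have hpos : ∀ s, 0 < 1 + a r * sn h s := fun s => by linarith [(hlt s).1]
  have hneg : ∀ s, 0 < 1 - a r * sn h s := fun s => by linarith [(hlt s).2]
  have hderiv : ∀ s, HasDerivAt (fun s => Z (r + s) - Z (r - s) -
      (Real.log (1 + a r * sn h s) - Real.log (1 - a r * sn h s))) 0 s := fun s => by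
    have hlogpos := (((hasDerivAt_sn hh s).const_mul (a r)).const_add 1).log (hpos s).ne'
    have hlogneg := (((hasDerivAt_sn hh s).const_mul (a r)).const_sub 1).log (hneg s).ne'
    refine ((((hZ (r + s)).comp_const_add r s).sub ((hZ (r - s)).comp_const_sub r s)).sub
      (hlogpos.sub hlogneg)).congr_deriv ?_
    have hadd := (H.comp_add_mul_addDenom hh hhe hab s).1
    have hsub := (H.comp_sub_mul_addDenom hh hhe hab s).1
    rw [addDenom] at hadd hsub
    have hpos' := (hpos s).ne'
    have hneg' := (hneg s).ne'
    field_simp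
    linear_combination hadd + hsub
  have hconst := eq_of_hasDerivAt_zero hderiv s 0
  simp only [sn_zero hh, mul_zero, add_zero, sub_zero, sub_self] at hconst
  have hlog : Z (r + s) + Real.log (1 - a r * sn h s) =
      Z (r - s) + Real.log (1 + a r * sn h s) := by linarith
  simpa only [Real.exp_add, Real.exp_log (hpos s), Real.exp_log (hneg s)]
    using congrArg Real.exp hlog

theorem integral_increment (H : HalfPendulum a b c) (hZ : ∀ s, HasDerivAt Z (a s) s)
    (hX : ∀ s, HasDerivAt X (b s * Real.exp (Z s)) s) (hh : 0 < h)
    (hhe : h = c r ^ 2 + a r ^ 2) (hab : a r ^ 2 + b r ^ 2 = 1) (s : ℝ) :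
    X (r + s) - X (r - s) = (Real.exp (Z (r + s)) + Real.exp (Z (r - s))) *
      (b r * ef h s - c r * eg h s) := by
  have hderiv : ∀ s, HasDerivAt (fun s => X (r + s) - X (r - s) -
      (Real.exp (Z (r + s)) + Real.exp (Z (r - s))) * (b r * ef h s - c r * eg h s)) 0 s :=
    fun s => by
    refine ((((hX (r + s)).comp_const_add r s).sub ((hX (r - s)).comp_const_sub r s)).sub
      ((((hZ (r + s)).comp_const_add r s).exp.add ((hZ (r - s)).comp_const_sub r s).exp).mul
      (((hasDerivAt_ef hh s).const_mul (b r)).sub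
        ((hasDerivAt_eg hh s).const_mul (c r))))).congr_deriv ?_
    obtain ⟨hadd_a, hadd_b⟩ := H.comp_add_mul_addDenom hh hhe hab s
    obtain ⟨hsub_a, hsub_b⟩ := H.comp_sub_mul_addDenom hh hhe hab s
    have hneg : 0 < 1 - a r * sn h s := by
      linarith [(abs_lt.1 (abs_mul_sn_lt_one hh hhe hab s)).2]
    obtain ⟨k, hk⟩ : ∃ k, Real.exp (Z (r - s)) = k * (1 - a r * sn h s) :=
      ⟨_, (div_mul_cancel₀ _ hneg.ne').symm⟩
    have hk' : Real.exp (Z (r + s)) = k * (1 + a r * sn h s) := by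
      refine mul_right_cancel₀ hneg.ne' ?_
      rw [H.exp_integral_mul hZ hh hhe hab s, hk]
      ring
    simp only [Pi.add_apply, Pi.sub_apply, hk', hk]
    refine (mul_eq_zero.1 (?_ : addDenom h (a r) s * _ = 0)).resolve_left
      (addDenom_pos hh hhe hab s).ne'
    rw [addDenom] at hadd_a hadd_b hsub_a hsub_b ⊢
    linear_combination k * (1 + a r * sn h s) * hadd_b + k * (1 - a r * sn h s) * hsub_b -
      (k * (1 + a r * sn h s) * hadd_a - k * (1 - a r * sn h s) * hsub_a) *
        (b r * ef h s - c r * eg h s) -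
      2 * k * (c r * sn h s * ef h s * hab + c r * sn h s * a r ^ 2 * ef h s *
          sn_sq_add_cn_sq hh s + sn h s * b r * eg h s * hhe -
        sn h s * a r ^ 2 * b r * eg h s * dn_sq_add_sn_sq hh s +
        sn h s * a r ^ 2 * (b r * dn h s - c r * cn h s) * ef_mul_cn_add_eg_mul_dn hh s)
  have hconst := eq_of_hasDerivAt_zero hderiv s 0
  simp only [add_zero, sub_zero, sub_self, ef_zero hh, eg_zero hh, mul_zero] at hconst
  linarith

end HalfPendulum

/-! ### The first zero of `sn` -/

/-- The incomplete elliptic integral of the first kind. -/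
def ellipticF (k φ : ℝ) : ℝ := ∫ θ in (0 : ℝ)..φ, 1 / Real.sqrt (1 - k ^ 2 * Real.sin θ ^ 2)

section Amplitude

variable {k : ℝ}

theorem one_sub_mul_sin_sq_pos (hk : k ^ 2 < 1) (θ : ℝ) : 0 < 1 - k ^ 2 * Real.sin θ ^ 2 := by
  nlinarith [Real.sin_sq_le_one θ, sq_nonneg k]

theorem continuous_ellipticF_integrand (hk : k ^ 2 < 1) :
    Continuous fun θ => 1 / Real.sqrt (1 - k ^ 2 * Real.sin θ ^ 2) :=
  continuous_const.div (by fun_prop) fun θ => (Real.sqrt_pos.2 (one_sub_mul_sin_sq_pos hk θ)).ne'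

theorem hasDerivAt_ellipticF (hk : k ^ 2 < 1) (φ : ℝ) :
    HasDerivAt (ellipticF k) (1 / Real.sqrt (1 - k ^ 2 * Real.sin φ ^ 2)) φ :=
  ((continuous_ellipticF_integrand hk).integral_hasStrictDerivAt 0 φ).hasDerivAt

theorem ellipticF_zero (k : ℝ) : ellipticF k 0 = 0 := intervalIntegral.integral_same

theorem ellipticF_strictMono (hk : k ^ 2 < 1) : StrictMono (ellipticF k) :=
  strictMono_of_hasDerivAt_pos (hasDerivAt_ellipticF hk) fun φ =>
    one_div_pos.2 (Real.sqrt_pos.2 (one_sub_mul_sin_sq_pos hk φ))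

theorem ellipticF_pi (hk : k ^ 2 < 1) : ellipticF k Real.pi = 2 * ellipticK k := by
  have hc := continuous_ellipticF_integrand hk
  have hsplit := intervalIntegral.integral_add_adjacent_intervals
    (hc.intervalIntegrable 0 (Real.pi / 2)) (hc.intervalIntegrable (Real.pi / 2) Real.pi)
    (μ := MeasureTheory.volume)
  have hreflect := intervalIntegral.integral_comp_sub_left (a := 0) (b := Real.pi / 2)
    (fun θ => 1 / Real.sqrt (1 - k ^ 2 * Real.sin θ ^ 2)) Real.pi
  simp only [Real.sin_pi_sub, sub_zero, sub_half] at hreflect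
  rw [ellipticF, ← hsplit, ← hreflect, ellipticK]
  ring

theorem ellipticK_pos (hk : k ^ 2 < 1) : 0 < ellipticK k := by
  have := ellipticF_strictMono hk Real.pi_pos
  rw [ellipticF_zero, ellipticF_pi hk] at this
  linarith

theorem eq_sin_integral {A B w : ℝ → ℝ} (hw : Continuous w)
    (hA : ∀ s, HasDerivAt A (w s * B s) s) (hB : ∀ s, HasDerivAt B (-(w s * A s)) s)
    (hA0 : A 0 = 0) (hB0 : B 0 = 1) (s : ℝ) : A s = Real.sin (∫ u in (0 : ℝ)..s, w u) := by
  have hφ := fun s => (hw.integral_hasStrictDerivAt 0 s).hasDerivAt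
  have hderiv : ∀ s, HasDerivAt (fun s => (A s - Real.sin (∫ u in (0 : ℝ)..s, w u)) ^ 2 +
      (B s - Real.cos (∫ u in (0 : ℝ)..s, w u)) ^ 2) 0 s := fun s => by
    refine ((((hA s).sub (hφ s).sin).pow 2).add (((hB s).sub (hφ s).cos).pow 2)).congr_deriv ?_
    simp only [Pi.sub_apply, Nat.cast_ofNat, Nat.add_one_sub_one, pow_one]
    ring
  have hdist := eq_of_hasDerivAt_zero hderiv s 0
  simp only [hA0, hB0, intervalIntegral.integral_same, Real.sin_zero, Real.cos_zero, sub_self]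
    at hdist
  refine sub_eq_zero.1 (pow_eq_zero_iff two_ne_zero |>.1 ?_)
  nlinarith [sq_nonneg (A s - Real.sin (∫ u in (0 : ℝ)..s, w u)),
    sq_nonneg (B s - Real.cos (∫ u in (0 : ℝ)..s, w u))]

theorem ellipticF_integral_mul (hk : k ^ 2 < 1) {W : ℝ → ℝ} (r : ℝ) (hW : Continuous W)
    (hW0 : ∀ s, 0 < W s)
    (hW2 : ∀ s, W s ^ 2 = 1 - k ^ 2 * Real.sin (∫ u in (0 : ℝ)..s, r * W u) ^ 2) (s : ℝ) :
    ellipticF k (∫ u in (0 : ℝ)..s, r * W u) = r * s := by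
  have hφ := fun s => ((hW.const_mul r).integral_hasStrictDerivAt 0 s).hasDerivAt
  have hderiv : ∀ s, HasDerivAt
      (fun s => ellipticF k (∫ u in (0 : ℝ)..s, r * W u) - r * s) 0 s := fun s => by
    refine (((hasDerivAt_ellipticF hk _).comp s (hφ s)).sub
      ((hasDerivAt_id s).const_mul r)).congr_deriv ?_
    have := (hW0 s).ne'
    rw [← hW2, Real.sqrt_sq (hW0 s).le]
    field_simp
    ring
  have hconst := eq_of_hasDerivAt_zero hderiv s 0
  simp only [intervalIntegral.integral_same, ellipticF_zero, mul_zero, sub_self] at hconst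
  exact sub_eq_zero.1 hconst

theorem first_zero_of_amplitude (hk : k ^ 2 < 1) {A B W : ℝ → ℝ} {r : ℝ} (hr : 0 < r)
    (hW : Continuous W) (hW0 : ∀ s, 0 < W s) (hW2 : ∀ s, W s ^ 2 = 1 - k ^ 2 * A s ^ 2)
    (hA : ∀ s, HasDerivAt A (r * W s * B s) s) (hB : ∀ s, HasDerivAt B (-(r * W s * A s)) s)
    (hA0 : A 0 = 0) (hB0 : B 0 = 1) :
    A (2 * ellipticK k / r) = 0 ∧ ∀ s ∈ Ioo 0 (2 * ellipticK k / r), 0 < A s := by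
  have hrW := hW.const_mul r
  have hsin := eq_sin_integral hrW hA hB hA0 hB0
  have hF := ellipticF_integral_mul hk r hW hW0 fun s => by rw [← hsin, hW2]
  have hmono : StrictMono fun s => ∫ u in (0 : ℝ)..s, r * W u :=
    strictMono_of_hasDerivAt_pos (fun s => (hrW.integral_hasStrictDerivAt 0 s).hasDerivAt)
      fun s => mul_pos hr (hW0 s)
  have hpi : ∫ u in (0 : ℝ)..(2 * ellipticK k / r), r * W u = Real.pi := by
    refine (ellipticF_strictMono hk).injective ?_
    rw [hF, ellipticF_pi hk, mul_div_cancel₀ _ hr.ne']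
  refine ⟨by rw [hsin, hpi, Real.sin_pi], fun s hs => ?_⟩
  rw [hsin]
  exact Real.sin_pos_of_pos_of_lt_pi (by simpa using hmono hs.1) (by simpa [hpi] using hmono hs.2)

end Amplitude

theorem beforeZero_iff_lt {h t T : ℝ} (hh : 0 < h) (hT : 0 < T)
    (hfirst : sn h T = 0 ∧ ∀ s ∈ Ioo 0 T, 0 < sn h s) (ht : 0 < t) : BeforeZero h t ↔ t < T :=
  ⟨fun H => lt_of_not_ge fun hle => (H.sn_pos T ⟨hT, hle⟩).ne' hfirst.1, fun hlt =>
    ⟨hh, ht, fun s hs => hfirst.2 s ⟨hs.1, hs.2.trans_lt hlt⟩⟩⟩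

theorem beforeZero_iff_of_lt_one {h t : ℝ} (hh : 0 < h) (h1 : h < 1) (ht : 0 < t) :
    BeforeZero h t ↔ t < 2 * ellipticK (Real.sqrt h) := by
  have hk : Real.sqrt h ^ 2 = h := Real.sq_sqrt hh.le
  have hk1 : Real.sqrt h ^ 2 < 1 := by rwa [hk]
  have hfirst := first_zero_of_amplitude hk1 one_pos
    (continuous_of_hasDerivAt (hasDerivAt_dn hh)) (dn_pos_of_le_one hh h1.le)
    (fun s => by rw [hk]; linarith [dn_sq_add_sn_sq hh s])
    (fun s => (hasDerivAt_sn hh s).congr_deriv (by ring))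
    (fun s => (hasDerivAt_cn hh s).congr_deriv (by ring)) (sn_zero hh) (cn_zero hh)
  rw [div_one] at hfirst
  exact beforeZero_iff_lt hh (mul_pos two_pos (ellipticK_pos hk1)) hfirst ht

theorem beforeZero_iff_of_one_lt {h t : ℝ} (h1 : 1 < h) (ht : 0 < t) :
    BeforeZero h t ↔ t < 2 * Real.sqrt (1 / h) * ellipticK (Real.sqrt (1 / h)) := by
  have hh : 0 < h := one_pos.trans h1
  have hr : 0 < Real.sqrt h := Real.sqrt_pos.2 hh
  have hr2 : Real.sqrt h ^ 2 = h := Real.sq_sqrt hh.le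
  have hk : Real.sqrt (1 / h) ^ 2 = 1 / h := Real.sq_sqrt (by positivity)
  have hk1 : Real.sqrt (1 / h) ^ 2 < 1 := by rwa [hk, div_lt_one hh]
  have hfirst := first_zero_of_amplitude (A := fun s => Real.sqrt h * sn h s) (B := dn h) hk1 hr
    (continuous_of_hasDerivAt (hasDerivAt_cn hh)) (cn_pos_of_one_le h1.le)
    (fun s => by
      rw [hk, mul_pow, hr2, ← mul_assoc, one_div_mul_cancel hh.ne', one_mul]
      linarith [sn_sq_add_cn_sq hh s])
    (fun s => ((hasDerivAt_sn hh s).const_mul (Real.sqrt h)).congr_deriv (by ring))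
    (fun s => (hasDerivAt_dn hh s).congr_deriv (by linear_combination sn h s * cn h s * hr2))
    (by simp [sn_zero hh]) (dn_zero hh)
  have hT : 2 * ellipticK (Real.sqrt (1 / h)) / Real.sqrt h =
      2 * Real.sqrt (1 / h) * ellipticK (Real.sqrt (1 / h)) := by
    rw [Real.sqrt_div zero_le_one h, Real.sqrt_one]
    field_simp
  rw [← hT]
  exact beforeZero_iff_lt hh (div_pos (mul_pos two_pos (ellipticK_pos hk1)) hr)
    ⟨(mul_eq_zero.1 hfirst.1).resolve_left hr.ne',
      fun s hs => pos_of_mul_pos_right (hfirst.2 s hs) hr.le⟩ ht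

theorem beforeZero_one {t : ℝ} (ht : 0 < t) : BeforeZero 1 t :=
  ⟨one_pos, ht, fun s hs => by rw [← sn_zero one_pos]; exact sn_one_strictMono hs.1⟩

theorem coe_lt_tBound_iff {lam : PhaseCylinder} (hE : -1 < energy lam) {t : ℝ} (ht : 0 < t) :
    (t : EReal) < tBound lam ↔ BeforeZero ((energy lam + 1) / 2) (t / 2) := by
  have ht2 : 0 < t / 2 := by positivity
  rcases lt_trichotomy (energy lam) 1 with hlt | heq | hgt
  · have hC₁ : lam ∈ C₁ := ⟨hE, hlt⟩
    rw [tBound, if_pos hC₁, EReal.coe_lt_coe_iff,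
      beforeZero_iff_of_lt_one (by linarith) (by linarith) ht2, modulusC₁]
    constructor <;> intro <;> linarith
  · have hC₁ : lam ∉ C₁ := fun h => h.2.ne heq
    have hC₂ : lam ∉ C₂ := fun h => (mem_Ioi.1 h).ne' heq
    have hC₄ : lam ∉ C₄ := fun h => by linarith [h.1]
    rw [tBound, if_neg hC₁, if_neg hC₂, if_neg hC₄, heq, add_self_div_two]
    exact iff_of_true (EReal.coe_lt_top t) (beforeZero_one ht2)
  · have hC₁ : lam ∉ C₁ := fun h => h.2.not_gt hgt
    have hC₂ : lam ∈ C₂ := hgt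
    rw [tBound, if_neg hC₁, if_pos hC₂, EReal.coe_lt_coe_iff,
      beforeZero_iff_of_one_lt (by linarith) ht2, modulusC₂, one_div_div]
    constructor <;> intro <;> linarith

/-! ### The domain `Ñ` in terms of the midpoint -/

namespace NormalExtremal

variable {lam : PhaseCylinder} (e : NormalExtremal lam)

/-- Half of the angle and half of the velocity at the midpoint `t / 2` of the extremal, and half of
its duration. -/
def mid (t : ℝ) : ℝ × ℝ × ℝ := (e.γ (t / 2) / 2, e.c (t / 2) / 2, t / 2)

theorem energy_eq (s : ℝ) : e.c s ^ 2 / 2 - Real.cos (e.γ s) = energy lam := by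
  have hderiv : ∀ s, HasDerivAt (fun s => e.c s ^ 2 / 2 - Real.cos (e.γ s)) 0 s := fun s => by
    refine ((((e.deriv_c s).pow 2).div_const 2).sub (e.deriv_γ s).cos).congr_deriv ?_
    simp only [Nat.cast_ofNat, Nat.add_one_sub_one, pow_one]
    ring
  refine (eq_of_hasDerivAt_zero hderiv s 0).trans ?_
  rw [← energy_coe, e.γ_zero, e.c_zero]

theorem param_mid (t : ℝ) : param (e.mid t) = (energy lam + 1) / 2 := by
  rw [← e.energy_eq (t / 2), param, mid, Real.sin_sq_eq_half_sub,
    mul_div_cancel₀ _ two_ne_zero]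
  ring

theorem γ_eq_of_mem (hlam : lam ∈ C₅) (s : ℝ) : e.γ s = e.γ 0 := by
  obtain ⟨hE, hc⟩ := hlam
  have hcos : Real.cos (e.γ 0) = -1 := by
    have := e.energy_eq 0
    rw [hE, e.c_zero, hc] at this
    linarith
  have hsin : Real.sin (e.γ 0) = 0 := by
    have := Real.sin_sq_add_cos_sq (e.γ 0)
    rw [hcos] at this
    exact pow_eq_zero_iff two_ne_zero |>.1 (by linarith)
  have hconst : ∀ s, HasDerivAt (fun _ : ℝ => (e.γ 0, (0 : ℝ))) (pendulum (e.γ 0, 0)) s := fun s =>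
    (hasDerivAt_const s _).congr_deriv (by simp only [pendulum, hsin, neg_zero]; rfl)
  have heq := pendulum_unique (t₀ := 0) (a := fun s => (e.γ s, e.c s))
    (fun s => (e.deriv_γ s).prodMk (e.deriv_c s)) hconst (by simp [e.c_zero, hc])
  exact congrArg Prod.fst (congrFun heq s)

theorem sin_half_ne_zero_of_mem (hlam : lam ∈ C₅) (s : ℝ) : Real.sin (e.γ s / 2) ≠ 0 := by
  have hE := e.energy_eq 0
  rw [hlam.1, e.c_zero, hlam.2] at hE
  rw [e.γ_eq_of_mem hlam, ← sq_pos_iff, Real.sin_sq_eq_half_sub, mul_div_cancel₀ _ two_ne_zero]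
  linarith

end NormalExtremal

theorem mem_C₁_union_C₂_union_C₃_union_C₅_iff (lam : PhaseCylinder) :
    lam ∈ C₁ ∪ C₂ ∪ C₃ ∨ lam ∈ C₅ ↔ -1 < energy lam := by
  constructor
  · rintro (((h | h) | h) | h)
    · exact h.1
    · linarith [show 1 < energy lam from h]
    all_goals linarith [h.1]
  · intro hE
    rcases lt_trichotomy (energy lam) 1 with hlt | heq | hgt
    · exact Or.inl (Or.inl (Or.inl ⟨hE, hlt⟩))
    · exact (em (lam.2 = 0)).symm.imp (fun hc => Or.inr ⟨heq, hc⟩) fun hc => ⟨heq, hc⟩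
    · exact Or.inl (Or.inl (Or.inr hgt))

theorem mem_NTilde_iff (ν : PhaseCylinder × ℝ) :
    ν ∈ NTilde ↔ (extremal ν.1).mid ν.2 ∈ midDomain := by
  obtain ⟨lam, t⟩ := ν
  simp only [NTilde, midDomain, mem_union, mem_ofPred_eq, (extremal lam).param_mid t]
  constructor
  · rintro (⟨ht, hC, hlt, hs⟩ | ⟨ht, hC⟩)
    · have hE := (mem_C₁_union_C₂_union_C₃_union_C₅_iff lam).1 (Or.inl hC)
      exact ⟨hs, (coe_lt_tBound_iff hE ht).1 hlt⟩
    · refine ⟨(extremal lam).sin_half_ne_zero_of_mem hC _, ?_⟩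
      rw [hC.1, add_self_div_two]
      exact beforeZero_one (half_pos ht)
  · rintro ⟨hs, H⟩
    have ht : 0 < t := pos_of_mul_pos_left H.time_pos (by norm_num)
    have hE : -1 < energy lam := by linarith [H.param_pos]
    exact ((mem_C₁_union_C₂_union_C₃_union_C₅_iff lam).2 hE).imp
      (fun hC => ⟨ht, hC, (coe_lt_tBound_iff hE ht).2 H, hs⟩) fun hC => ⟨ht, hC⟩

/-! ### The exponential mapping in the coordinates of the target -/

/-- Coordinates on `SH(2)` in which the exponential mapping is `midExp` of the midpoint. The last
one is `tanh (z / 2)`; the others combine `x + y` and `x - y`, whose derivatives `cos (γ / 2) e ^ z`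
and `cos (γ / 2) e ^ (-z)` make them scale with `1 + e ^ z` and `1 + e ^ (-z)`. -/
def targetChart (q : ℝ × ℝ × ℝ) : ℝ × ℝ × ℝ :=
  (((q.1 + q.2.1) / (1 + Real.exp q.2.2) + (q.1 - q.2.1) / (1 + Real.exp (-q.2.2))) / 2,
    ((q.1 - q.2.1) / (1 + Real.exp (-q.2.2)) - (q.1 + q.2.1) / (1 + Real.exp q.2.2)) / 2,
    (Real.exp q.2.2 - 1) / (Real.exp q.2.2 + 1))

theorem contDiff_targetChart : ContDiff ℝ ∞ targetChart := by
  have hpos : ∀ q : ℝ × ℝ × ℝ, 1 + Real.exp q.2.2 ≠ 0 := fun q => by positivity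
  have hneg : ∀ q : ℝ × ℝ × ℝ, 1 + Real.exp (-q.2.2) ≠ 0 := fun q => by positivity
  have hpos' : ∀ q : ℝ × ℝ × ℝ, Real.exp q.2.2 + 1 ≠ 0 := fun q => by positivity
  unfold targetChart
  fun_prop (disch := assumption)

theorem targetChart_injective : Function.Injective targetChart := by
  rintro ⟨x, y, z⟩ ⟨x', y', z'⟩ h
  simp only [targetChart, Prod.mk.injEq] at h
  obtain ⟨h1, h2, h3⟩ := h
  obtain rfl : z = z' := by
    rw [div_eq_div_iff (by positivity) (by positivity)] at h3
    exact Real.exp_injective (by linarith)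
  have hadd : (x + y) / (1 + Real.exp z) = (x' + y') / (1 + Real.exp z) := by linarith
  have hsub : (x - y) / (1 + Real.exp (-z)) = (x' - y') / (1 + Real.exp (-z)) := by linarith
  rw [div_left_inj' (by positivity)] at hadd hsub
  rw [Prod.mk.injEq, Prod.mk.injEq]
  exact ⟨by linarith, by linarith, rfl⟩

theorem targetChart_ne_zero_iff {q : ℝ × ℝ × ℝ} : (targetChart q).2.2 ≠ 0 ↔ q.2.2 ≠ 0 := by
  have hne : Real.exp q.2.2 + 1 ≠ 0 := by positivity
  simp [targetChart, hne, sub_eq_zero]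

theorem abs_targetChart_lt_one (q : ℝ × ℝ × ℝ) : |(targetChart q).2.2| < 1 := by
  have hpos := Real.exp_pos q.2.2
  rw [targetChart, abs_lt, lt_div_iff₀ (by positivity), div_lt_one (by positivity)]
  constructor <;> linarith

namespace NormalExtremal

variable {lam : PhaseCylinder} (e : NormalExtremal lam) {t : ℝ}

theorem halfPendulum : HalfPendulum (fun s => Real.sin (e.γ s / 2))
    (fun s => Real.cos (e.γ s / 2)) (fun s => e.c s / 2) :=
  ⟨fun s => hasDerivAt_sin_half (e.deriv_γ s), fun s => hasDerivAt_cos_half (e.deriv_γ s),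
    fun s => hasDerivAt_half_of_neg_sin (e.deriv_c s)⟩

theorem hasDerivAt_x_add_y (s : ℝ) :
    HasDerivAt (fun s => e.x s + e.y s) (Real.cos (e.γ s / 2) * Real.exp (e.z s)) s :=
  ((e.deriv_x s).add (e.deriv_y s)).congr_deriv (by rw [← mul_add, Real.cosh_add_sinh])

theorem hasDerivAt_x_sub_y (s : ℝ) :
    HasDerivAt (fun s => e.x s - e.y s) (Real.cos (e.γ s / 2) * Real.exp (-e.z s)) s :=
  ((e.deriv_x s).sub (e.deriv_y s)).congr_deriv (by rw [← mul_sub, Real.cosh_sub_sinh])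

theorem exp_z_mul (hm : 0 < param (e.mid t)) :
    Real.exp (e.z t) * (1 - (midExp (e.mid t)).2.2) = 1 + (midExp (e.mid t)).2.2 := by
  have h := e.halfPendulum.exp_integral_mul (r := t / 2) e.deriv_z hm rfl
    (Real.sin_sq_add_cos_sq _) (t / 2)
  rwa [add_halves, sub_self, e.z_zero, Real.exp_zero, one_mul] at h

theorem x_add_y_eq (hm : 0 < param (e.mid t)) :
    e.x t + e.y t = (1 + Real.exp (e.z t)) * ((midExp (e.mid t)).1 - (midExp (e.mid t)).2.1) := by
  have h := e.halfPendulum.integral_increment (r := t / 2) e.deriv_z e.hasDerivAt_x_add_y hm rfl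
    (Real.sin_sq_add_cos_sq _) (t / 2)
  rwa [add_halves, sub_self, e.x_zero, e.y_zero, e.z_zero, Real.exp_zero, add_zero, sub_zero,
    add_comm _ (1 : ℝ)] at h

theorem x_sub_y_eq (hm : 0 < param (e.mid t)) :
    e.x t - e.y t = (1 + Real.exp (-e.z t)) * ((midExp (e.mid t)).1 + (midExp (e.mid t)).2.1) := by
  have h := e.halfPendulum.neg.integral_increment (r := t / 2) (fun s => (e.deriv_z s).neg)
    e.hasDerivAt_x_sub_y hm (by simp only [neg_sq]; rfl)
    (by simpa only [neg_sq] using Real.sin_sq_add_cos_sq _) (t / 2)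
  rwa [add_halves, sub_self, e.x_zero, e.y_zero, Pi.neg_apply, Pi.neg_apply, e.z_zero, neg_zero,
    Real.exp_zero, sub_zero, sub_zero, add_comm _ (1 : ℝ), neg_mul, sub_neg_eq_add] at h

theorem targetChart_eq (hm : 0 < param (e.mid t)) :
    targetChart (e.x t, e.y t, e.z t) = midExp (e.mid t) := by
  have hz : (Real.exp (e.z t) - 1) / (Real.exp (e.z t) + 1) = (midExp (e.mid t)).2.2 := by
    rw [div_eq_iff (by positivity)]
    linear_combination e.exp_z_mul hm
  simp only [targetChart, e.x_add_y_eq hm, e.x_sub_y_eq hm, hz]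
  rw [mul_div_cancel_left₀ _ (by positivity), mul_div_cancel_left₀ _ (by positivity)]
  ring_nf

end NormalExtremal

/-! ### Lifts to the universal cover of the phase cylinder -/

theorem pendulumFlow_pendulumFlow (s : ℝ × ℝ) (a b : ℝ) :
    pendulumFlow (pendulumFlow s a) b = pendulumFlow s (a + b) :=
  congrFun (pendulum_unique (t₀ := 0) (hasDerivAt_pendulumFlow _)
    (fun b => (hasDerivAt_pendulumFlow s (a + b)).comp_const_add a b)
    (by simp [pendulumFlow_zero])) b

theorem pendulum_add_int_mul_four_pi (s : ℝ × ℝ) (k : ℤ) :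
    pendulum (s.1 + k * (4 * Real.pi), s.2) = pendulum s := by
  have hsin := Real.sin_add_int_mul_two_pi s.1 (2 * k)
  push_cast at hsin
  rw [pendulum, pendulum, ← hsin]
  ring_nf

theorem pendulumFlow_add_int_mul_four_pi (s : ℝ × ℝ) (k : ℤ) (t : ℝ) :
    pendulumFlow (s.1 + k * (4 * Real.pi), s.2) t =
      ((pendulumFlow s t).1 + k * (4 * Real.pi), (pendulumFlow s t).2) := by
  refine congrFun (pendulum_unique (t₀ := 0) (hasDerivAt_pendulumFlow _)
    (b := fun t => ((pendulumFlow s t).1 + k * (4 * Real.pi), (pendulumFlow s t).2))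
    (fun t => ?_) (by simp [pendulumFlow_zero])) t
  rw [pendulum_add_int_mul_four_pi]
  exact ((hasDerivAt_pendulumFlow_fst s t).add_const _).prodMk (hasDerivAt_pendulumFlow_snd s t)

/-- The point of the phase cylinder below a point of its universal cover. -/
def project (s : ℝ × ℝ) : PhaseCylinder := ((s.1 : AddCircle (4 * Real.pi)), s.2)

/-- The covering map of `C × ℝ` by `ℝ² × ℝ`. -/
def projectProd (q : (ℝ × ℝ) × ℝ) : PhaseCylinder × ℝ := (project q.1, q.2)

theorem project_surjective : Function.Surjective project := fun lam =>
  ⟨(lam.1.out, lam.2), Prod.ext (Quotient.out_eq lam.1) rfl⟩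

theorem projectProd_surjective : Function.Surjective projectProd :=
  project_surjective.prodMap Function.surjective_id

theorem project_eq_iff {s s' : ℝ × ℝ} :
    project s' = project s ↔ ∃ k : ℤ, s' = (s.1 + k * (4 * Real.pi), s.2) := by
  simp only [project, Prod.ext_iff, QuotientAddGroup.eq_iff_sub_mem, AddSubgroup.mem_zmultiples_iff,
    zsmul_eq_mul, eq_sub_iff_add_eq', eq_comm (a := s'.1), exists_and_right]

/-- The midpoint of an extremal as a function on the universal cover. -/
def liftMid (q : (ℝ × ℝ) × ℝ) : ℝ × ℝ × ℝ :=
  ((pendulumFlow q.1 (q.2 / 2)).1 / 2, (pendulumFlow q.1 (q.2 / 2)).2 / 2, q.2 / 2)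

theorem NormalExtremal.eq_pendulumFlow {s : ℝ × ℝ} (e : NormalExtremal (project s)) :
    ∃ k : ℤ, ∀ t, e.γ t = (pendulumFlow s t).1 + k * (4 * Real.pi) ∧
      e.c t = (pendulumFlow s t).2 := by
  obtain ⟨k, hk⟩ := project_eq_iff.1 (Prod.ext e.γ_zero e.c_zero : project (e.γ 0, e.c 0) = _)
  have heq := pendulum_unique (t₀ := 0) (a := fun t => (e.γ t, e.c t))
    (fun t => (e.deriv_γ t).prodMk (e.deriv_c t)) (hasDerivAt_pendulumFlow (e.γ 0, e.c 0))
    (pendulumFlow_zero _).symm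
  refine ⟨k, fun t => Prod.mk_inj.1 ?_⟩
  rw [← pendulumFlow_add_int_mul_four_pi, ← hk]
  exact congrFun heq t

theorem NormalExtremal.mid_eq {s : ℝ × ℝ} (e : NormalExtremal (project s)) (t : ℝ) :
    ∃ k : ℤ, e.mid t = ((liftMid (s, t)).1 + k * (2 * Real.pi), (liftMid (s, t)).2) := by
  obtain ⟨k, hk⟩ := e.eq_pendulumFlow
  refine ⟨k, ?_⟩
  simp only [NormalExtremal.mid, liftMid, hk, Prod.mk.injEq, and_true]
  ring

theorem projectProd_mem_NTilde_iff (q : (ℝ × ℝ) × ℝ) :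
    projectProd q ∈ NTilde ↔ liftMid q ∈ midDomain := by
  obtain ⟨k, hk⟩ := (extremal (project q.1)).mid_eq q.2
  rw [mem_NTilde_iff, ← mem_midDomain_add_int_mul_two_pi_iff (liftMid q) k]
  exact hk ▸ Iff.rfl

theorem targetChart_expMap_projectProd {q : (ℝ × ℝ) × ℝ} (hq : liftMid q ∈ midDomain) :
    targetChart (expMap (projectProd q)) = midExp (liftMid q) := by
  obtain ⟨k, hk⟩ := (extremal (project q.1)).mid_eq q.2
  have hmem := (mem_NTilde_iff _).1 ((projectProd_mem_NTilde_iff q).2 hq)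
  rw [← midExp_add_int_mul_two_pi (liftMid q) k]
  exact ((extremal (project q.1)).targetChart_eq hmem.2.param_pos).trans (congrArg midExp hk)

theorem contDiff_liftMid : ContDiff ℝ ∞ liftMid := by
  have h : ContDiff ℝ ∞ fun q : (ℝ × ℝ) × ℝ => pendulumFlow q.1 (q.2 / 2) :=
    contDiff_pendulumFlow.comp (f := fun q : (ℝ × ℝ) × ℝ => (q.1, q.2 / 2)) (by fun_prop)
  exact (h.fst.div_const 2).prodMk ((h.snd.div_const 2).prodMk (by fun_prop))

/-- The vector field of the normal Hamiltonian system. -/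
def hamiltonianField (s : ℝ × ℝ × ℝ × ℝ × ℝ) : ℝ × ℝ × ℝ × ℝ × ℝ :=
  (s.2.1, -Real.sin s.1, Real.cos (s.1 / 2) * Real.cosh s.2.2.2.2,
    Real.cos (s.1 / 2) * Real.sinh s.2.2.2.2, Real.sin (s.1 / 2))

/-- The solution of the normal Hamiltonian system as a function on the universal cover. -/
def liftSolution (s : ℝ × ℝ) (t : ℝ) : ℝ × ℝ × ℝ × ℝ × ℝ :=
  ((pendulumFlow s t).1, (pendulumFlow s t).2, expMap (projectProd (s, t)))

theorem liftSolution_zero (s : ℝ × ℝ) : liftSolution s 0 = (s.1, s.2, 0, 0, 0) := by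
  simp [liftSolution, pendulumFlow_zero, projectProd, expMap, NormalExtremal.x_zero,
    NormalExtremal.y_zero, NormalExtremal.z_zero]

theorem hasDerivAt_liftSolution (s : ℝ × ℝ) (t : ℝ) :
    HasDerivAt (liftSolution s) (hamiltonianField (liftSolution s t)) t := by
  set e := extremal (project s)
  obtain ⟨k, hk⟩ := e.eq_pendulumFlow
  have hhalf : e.γ t / 2 = (pendulumFlow s t).1 / 2 + k * (2 * Real.pi) := by
    rw [(hk t).1]
    ring
  refine ((hasDerivAt_pendulumFlow_fst s t).prodMk ((hasDerivAt_pendulumFlow_snd s t).prodMk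
    ((e.deriv_x t).prodMk ((e.deriv_y t).prodMk (e.deriv_z t))))).congr_deriv ?_
  rw [hhalf, Real.cos_add_int_mul_two_pi, Real.sin_add_int_mul_two_pi]
  rfl

theorem contDiff_expMap_projectProd : ContDiff ℝ ∞ fun q => expMap (projectProd q) := by
  have hfield : ContDiff ℝ ∞ hamiltonianField := by unfold hamiltonianField; fun_prop
  refine contDiff_iff_contDiffAt.2 fun q => ?_
  have hsol := contDiffAt_solution (p := q.1) (by simp) hfield (φ := liftSolution)
    (by simp only [liftSolution_zero]; fun_prop) (.of_forall hasDerivAt_liftSolution) q.2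
  exact hsol.snd.snd

/-! ### The exponential mapping and its inverse -/

theorem contMDiff_coe_addCircle (p : ℝ) [hp : Fact (0 < p)] :
    ContMDiff 𝓘(ℝ, ℝ) 𝓘(ℝ, ℝ) ∞ (fun r : ℝ => (r : AddCircle p)) := fun r => by
  have hmem : (AddCircle.openPartialHomeomorphCoe p (r - p / 2)).symm ∈
      IsManifold.maximalAtlas 𝓘(ℝ, ℝ) ∞ (AddCircle p) :=
    IsManifold.subset_maximalAtlas ⟨_, rfl⟩
  have hr : Ioo (r - p / 2) (r - p / 2 + p) ∈ 𝓝 r :=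
    Ioo_mem_nhds (by linarith [hp.out]) (by linarith [hp.out])
  exact (contMDiffOn_symm_of_mem_maximalAtlas hmem).contMDiffAt hr

/-- The local section through `ν₀` of the covering map `projectProd`. -/
def localLift (ν₀ ν : PhaseCylinder × ℝ) : (ℝ × ℝ) × ℝ :=
  ((chartAt ℝ ν₀.1.1 ν.1.1, ν.1.2), ν.2)

theorem contMDiffAt_localLift (ν₀ : PhaseCylinder × ℝ) :
    ContMDiffAt ((𝓘(ℝ, ℝ).prod 𝓘(ℝ, ℝ)).prod 𝓘(ℝ, ℝ)) 𝓘(ℝ, (ℝ × ℝ) × ℝ) ∞ (localLift ν₀) ν₀ := by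
  have hchart : ContMDiffAt 𝓘(ℝ, ℝ) 𝓘(ℝ, ℝ) ∞ (chartAt ℝ ν₀.1.1) ν₀.1.1 :=
    contMDiffOn_chart.contMDiffAt (chart_source_mem_nhds ℝ ν₀.1.1)
  have hangle : ContMDiffAt ((𝓘(ℝ, ℝ).prod 𝓘(ℝ, ℝ)).prod 𝓘(ℝ, ℝ)) 𝓘(ℝ, ℝ) ∞
      (fun ν : PhaseCylinder × ℝ => chartAt ℝ ν₀.1.1 ν.1.1) ν₀ :=
    ContMDiffAt.comp (g := chartAt ℝ ν₀.1.1) (f := fun ν : PhaseCylinder × ℝ => ν.1.1) ν₀ hchart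
      (contMDiffAt_fst.comp ν₀ contMDiffAt_fst)
  exact (hangle.prodMk_space (contMDiffAt_snd.comp ν₀ contMDiffAt_fst)).prodMk_space contMDiffAt_snd

theorem eventually_projectProd_localLift (ν₀ : PhaseCylinder × ℝ) :
    ∀ᶠ ν in 𝓝 ν₀, projectProd (localLift ν₀ ν) = ν := by
  have hangle : ContinuousAt (fun ν : PhaseCylinder × ℝ => ν.1.1) ν₀ := by fun_prop
  filter_upwards [hangle.preimage_mem_nhds (chart_source_mem_nhds ℝ ν₀.1.1)] with ν hν
  exact congrArg (fun γ => ((γ, ν.1.2), ν.2)) ((chartAt ℝ ν₀.1.1).left_inv hν)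

theorem contMDiff_expMap :
    ContMDiff ((𝓘(ℝ, ℝ).prod 𝓘(ℝ, ℝ)).prod 𝓘(ℝ, ℝ)) 𝓘(ℝ, ℝ × ℝ × ℝ) ∞ expMap := fun ν₀ => by
  refine (ContMDiffAt.comp (g := fun q => expMap (projectProd q)) ν₀
    contDiff_expMap_projectProd.contMDiff.contMDiffAt
    (contMDiffAt_localLift ν₀)).congr_of_eventuallyEq ?_
  filter_upwards [eventually_projectProd_localLift ν₀] with ν hν
  exact congrArg expMap hν.symm

theorem isOpen_NTilde : IsOpen NTilde := by
  refine isOpen_iff_mem_nhds.2 fun ν₀ hν₀ => ?_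
  have hcont : ContinuousAt (fun ν => liftMid (localLift ν₀ ν)) ν₀ :=
    contDiff_liftMid.continuous.continuousAt.comp (contMDiffAt_localLift ν₀).continuousAt
  have hmem : liftMid (localLift ν₀ ν₀) ∈ midDomain := by
    rwa [← projectProd_mem_NTilde_iff, (eventually_projectProd_localLift ν₀).self_of_nhds]
  filter_upwards [eventually_projectProd_localLift ν₀,
    hcont.preimage_mem_nhds (isOpen_midDomain.mem_nhds hmem)] with ν hν hmid
  rw [← hν, projectProd_mem_NTilde_iff]
  exact hmid

theorem isOpen_MTilde : IsOpen MTilde :=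
  isOpen_ne_fun (by fun_prop) continuous_const

/-- The inverse of the exponential mapping, with values in the universal cover: the pendulum flow
carries the midpoint of the extremal back to its initial covector. -/
def liftLog (q : ℝ × ℝ × ℝ) : (ℝ × ℝ) × ℝ :=
  (pendulumFlow (2 * (midLog (targetChart q)).1, 2 * (midLog (targetChart q)).2.1)
    (-(midLog (targetChart q)).2.2), 2 * (midLog (targetChart q)).2.2)

/-- The inverse of the exponential mapping. -/
def logMap (q : ℝ × ℝ × ℝ) : PhaseCylinder × ℝ := projectProd (liftLog q)

theorem liftMid_liftLog (q : ℝ × ℝ × ℝ) : liftMid (liftLog q) = midLog (targetChart q) := by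
  simp [liftMid, liftLog, pendulumFlow_pendulumFlow, pendulumFlow_zero]

theorem contDiffAt_liftLog {q : ℝ × ℝ × ℝ} (hq : q ∈ MTilde) : ContDiffAt ℝ ∞ liftLog q := by
  have hmid : ContDiffAt ℝ ∞ (fun q => midLog (targetChart q)) q :=
    (contDiffAt_midLog (targetChart_ne_zero_iff.2 hq) (abs_targetChart_lt_one q)).comp q
      contDiff_targetChart.contDiffAt
  have hflow := contDiff_pendulumFlow.contDiffAt.comp q
    (((contDiffAt_const.mul hmid.fst).prodMk (contDiffAt_const.mul hmid.snd.fst)).prodMk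
      hmid.snd.snd.neg)
    (f := fun q => ((2 * (midLog (targetChart q)).1, 2 * (midLog (targetChart q)).2.1),
      -(midLog (targetChart q)).2.2))
  exact hflow.prodMk (contDiffAt_const.mul hmid.snd.snd)

theorem contMDiffOn_logMap :
    ContMDiffOn 𝓘(ℝ, ℝ × ℝ × ℝ) ((𝓘(ℝ, ℝ).prod 𝓘(ℝ, ℝ)).prod 𝓘(ℝ, ℝ)) ∞ logMap MTilde := by
  intro q hq
  have h := contDiffAt_liftLog hq
  have hangle := (contMDiff_coe_addCircle (4 * Real.pi)).contMDiffAt.comp q h.fst.fst.contMDiffAt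
  exact ((hangle.prodMk h.fst.snd.contMDiffAt).prodMk h.snd.contMDiffAt).contMDiffWithinAt

theorem logMap_mem {q : ℝ × ℝ × ℝ} (hq : q ∈ MTilde) : logMap q ∈ NTilde := by
  rw [logMap, projectProd_mem_NTilde_iff, liftMid_liftLog]
  exact midLog_mem (targetChart_ne_zero_iff.2 hq) (abs_targetChart_lt_one q)

theorem expMap_mem {ν : PhaseCylinder × ℝ} (hν : ν ∈ NTilde) : expMap ν ∈ MTilde := by
  obtain ⟨q, rfl⟩ := projectProd_surjective ν
  rw [projectProd_mem_NTilde_iff] at hν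
  rw [MTilde, mem_ofPred_eq, ← targetChart_ne_zero_iff, targetChart_expMap_projectProd hν]
  exact midExp_ne_zero hν

theorem expMap_logMap {q : ℝ × ℝ × ℝ} (hq : q ∈ MTilde) : expMap (logMap q) = q := by
  have hmem : liftMid (liftLog q) ∈ midDomain := (projectProd_mem_NTilde_iff _).1 (logMap_mem hq)
  refine targetChart_injective ?_
  rw [logMap, targetChart_expMap_projectProd hmem, liftMid_liftLog]
  exact midExp_midLog (targetChart_ne_zero_iff.2 hq) (abs_targetChart_lt_one q)

theorem logMap_expMap {ν : PhaseCylinder × ℝ} (hν : ν ∈ NTilde) : logMap (expMap ν) = ν := by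
  obtain ⟨⟨s, t⟩, rfl⟩ := projectProd_surjective ν
  rw [projectProd_mem_NTilde_iff] at hν
  obtain ⟨k, hk⟩ := midLog_midExp hν
  have hmid : (2 * ((liftMid (s, t)).1 + k * (2 * Real.pi)), 2 * (liftMid (s, t)).2.1) =
      ((pendulumFlow s (t / 2)).1 + k * (4 * Real.pi), (pendulumFlow s (t / 2)).2) := by
    simp only [liftMid, Prod.mk.injEq]
    constructor <;> ring
  have hlift : liftLog (expMap (projectProd (s, t))) = ((s.1 + k * (4 * Real.pi), s.2), t) := by
    rw [liftLog, targetChart_expMap_projectProd hν, hk, hmid, pendulumFlow_add_int_mul_four_pi,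
      liftMid, pendulumFlow_pendulumFlow, add_neg_cancel, pendulumFlow_zero,
      mul_div_cancel₀ _ two_ne_zero]
  rw [logMap, hlift]
  exact Prod.ext (project_eq_iff.2 ⟨k, rfl⟩) rfl

end SH2

end

theorem mainTheorem4 :
    ∃ Φ : PartialDiffeomorph ((𝓘(ℝ, ℝ).prod 𝓘(ℝ, ℝ)).prod 𝓘(ℝ, ℝ)) 𝓘(ℝ, ℝ × ℝ × ℝ)
        (SH2.PhaseCylinder × ℝ) (ℝ × ℝ × ℝ) ∞,
      Φ.source = SH2.NTilde ∧ Φ.target = SH2.MTilde ∧ EqOn Φ SH2.expMap SH2.NTilde := by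
  refine ⟨{ toFun := SH2.expMap
            invFun := SH2.logMap
            source := SH2.NTilde
            target := SH2.MTilde
            map_source' := fun _ => SH2.expMap_mem
            map_target' := fun _ => SH2.logMap_mem
            left_inv' := fun _ => SH2.logMap_expMap
            right_inv' := fun _ => SH2.expMap_logMap
            open_source := SH2.isOpen_NTilde
            open_target := SH2.isOpen_MTilde
            contMDiffOn_toFun := SH2.contMDiff_expMap.contMDiffOn
            contMDiffOn_invFun := SH2.contMDiffOn_logMap }, rfl, rfl, fun _ _ => rfl⟩
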